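/- A lattice is a free $\mathbb{Z}$-module of finite rank with a $\mathbb{Z}$-valued symmetric bilinear form; $L(2)$ denotes $L$ with its form multiplied by $2$. Let $U$ be the hyperbolic plane (Gram matrix $\begin{pmatrix}0&1\\1&0\end{pmatrix}$), let $E_8$ and $D_4$ be the negative definite root lattices of these types, and let $S=U\oplus E_8\oplus D_4\oplus D_4$. For an even nondegenerate lattice $L$ let $A_L=L^*/L$, where $L^*=\{x\in L\otimes\mathbb{Q} : (x,l)\in\mathbb{Z}\text{ for all } l\in L\}$, with discriminant bilinear form $b_L:A_L\times A_L\to\mathbb{Q}/\mathbb{Z}$ and discriminant quadratic form $q_L:A_L\to\mathbb{Q}/2\mathbb{Z}$ induced by the form of $L$. Let $\mathfrak{M}$ be the set of primitive sublattices $M\subset S$ that are isomorphic to $U(2)\oplus E_8(2)$ and are orthogonal to no vector $x \in S$ with $(x,x)=-2$. For $M\in\mathfrak{M}$ put $N=M^\perp\subset S$, let $\Gamma\subset A_M\oplus A_N$ be the image of $S/(M\oplus N)$ under $S\subset M^*\oplus N^*$, let $\Gamma_N\subset A_N$ be the projection of $\Gamma$, and let $\Gamma_N^\perp\subset A_N$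 be its orthogonal complement with respect to $b_N$. Then: (1) For every $M\in\mathfrak{M}$, $N=M^\perp$ is isomorphic to $E_8(2)$. (2) The set $\mathfrak{M}$ consists of exactly two orbits under the orthogonal group $O(S)$. (3) For every $M\in\mathfrak{M}$ the group $\Gamma_N^\perp$ has order $2$, say $\Gamma_N^\perp=\{0,z_N\}$ with $z_N\neq 0$, and $q_N(z_N)$ is $0$ or $1$ in $\mathbb{Q}/2\mathbb{Z}$. Both values occur, and $M_1,M_2\in\mathfrak{M}$ with orthogonal complements $N_1,N_2$ lie in the same $O(S)$-orbit if and only if $q_{N_1}(z_{N_1})=q_{N_2}(z_{N_2})$. -/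

import Mathlib

open scoped TensorProduct

noncomputable section

/-- A `ℤ`-valued symmetric bilinear form on `L` that is even: `(x, x) ∈ 2ℤ` for all `x`.
When `L` is free of finite rank over `ℤ`, this makes `L` an even lattice. -/
structure EvenForm (L : Type*) [AddCommGroup L] where
  form : LinearMap.BilinForm ℤ L
  symm : ∀ x y, form x y = form y x
  even : ∀ x, Even (form x x)

namespace EvenForm

variable {L L' : Type*} [AddCommGroup L] [AddCommGroup L']

/-! ### Constructions -/

/-- The lattice `ℤⁿ` with a given symmetric Gram matrix with even diagonal. -/
def ofMatrix {n : ℕ} (A : Matrix (Fin n) (Fin n) ℤ) (hs : A.IsSymm) (hd : ∀ i, Even (A i i)) :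
    EvenForm (Fin n → ℤ) where
  form := Matrix.toBilin' A
  symm x y := by
    have h : (Matrix.toBilin' A).IsSymm := (Matrix.isSymm_toBilin'_iff_isSymm (M := A)).2 hs
    exact h.eq x y
  even x := by
    have h : (Matrix.toBilin' A).IsSymm := (Matrix.isSymm_toBilin'_iff_isSymm (M := A)).2 hs
    induction x using Pi.single_induction with
    | zero => simp
    | add f g hf hg =>
      have h2 := h.eq f g
      simp only [map_add, LinearMap.add_apply]
      rw [h2]
      rw [Int.even_iff] at *
      omega
    | single i m =>
      have : (Pi.single i m : Fin n → ℤ) = m • Pi.single i 1 := by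
        ext j; by_cases h : j = i
        · subst h; simp
        · simp [h]
      rw [this]
      simp only [map_smul, LinearMap.smul_apply, Matrix.toBilin'_single, smul_eq_mul]
      exact ((hd i).mul_left m).mul_left m

/-- The lattice `L(k)`: the same group, with the form multiplied by `k`. -/
def scale (k : ℤ) (S : EvenForm L) : EvenForm L where
  form := k • S.form
  symm x y := by simp [S.symm x y]
  even x := by simpa using (S.even x).mul_left k

/-- The orthogonal direct sum of two lattices. -/
def sum (S : EvenForm L) (T : EvenForm L') : EvenForm (L × L') where
  form := S.form.compl₁₂ (LinearMap.fst ℤ L L') (LinearMap.fst ℤ L L') +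
    T.form.compl₁₂ (LinearMap.snd ℤ L L') (LinearMap.snd ℤ L L')
  symm x y := by simp [S.symm x.1, T.symm x.2]
  even x := by simpa using (S.even x.1).add (T.even x.2)

/-- The restriction of the form to a sublattice. -/
def restrict (S : EvenForm L) (M : Submodule ℤ L) : EvenForm M where
  form := S.form.restrict M
  symm x y := S.symm x y
  even x := S.even x

/-- The orthogonal complement `M^⊥` of a sublattice. -/
def perp (S : EvenForm L) (M : Submodule ℤ L) : Submodule ℤ L := S.form.orthogonal M

/-- Two lattices are isomorphic (isometric). -/
def Iso (S : EvenForm L) (T : EvenForm L') : Prop := S.form.Equivalent T.form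

/-! ### The discriminant form -/

/-- The `ℚ`-bilinear extension of the form to `L ⊗ ℚ`. -/
def formQ (S : EvenForm L) : LinearMap.BilinForm ℚ (ℚ ⊗[ℤ] L) := S.form.baseChange ℚ

lemma formQ_symm (S : EvenForm L) (x y : ℚ ⊗[ℤ] L) : S.formQ x y = S.formQ y x :=
  (LinearMap.BilinForm.IsSymm.baseChange ℚ (B₂ := S.form) ⟨S.symm⟩).eq x y

/-- The image of `L` in `L ⊗ ℚ`. -/
def lat (_S : EvenForm L) : Submodule ℤ (ℚ ⊗[ℤ] L) := LinearMap.range (TensorProduct.mk ℤ ℚ L 1)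

/-- The dual lattice `L^* = {x ∈ L ⊗ ℚ : (x, l) ∈ ℤ for all l ∈ L}`. -/
def dual (S : EvenForm L) : Submodule ℤ (ℚ ⊗[ℤ] L) := S.formQ.dualSubmodule S.lat

/-- `L` as a subgroup of `L^*`. -/
def latInDual (S : EvenForm L) : Submodule ℤ S.dual := S.lat.submoduleOf S.dual

/-- The discriminant group `A_L = L^* / L`. -/
abbrev Disc (S : EvenForm L) : Type _ := S.dual ⧸ S.latInDual

/-- The pairing `L^* × L^* → ℚ/ℤ`. -/
def dualBilin (S : EvenForm L) : S.dual →ₗ[ℤ] S.dual →ₗ[ℤ] AddCircle (1 : ℚ) :=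
  LinearMap.mk₂ ℤ (fun x y => ((S.formQ x y : ℚ) : AddCircle (1 : ℚ)))
    (by intros; simp) (by intros; simp) (by intros; simp) (by intros; simp)

lemma dualBilin_symm (S : EvenForm L) (x y : S.dual) : S.dualBilin x y = S.dualBilin y x := by
  simp [dualBilin, S.formQ_symm x.1 y.1]

lemma dualBilin_eq_zero (S : EvenForm L) (x y : S.dual) (hy : y ∈ S.latInDual) :
    S.dualBilin x y = 0 := by
  obtain ⟨n, hn⟩ := Submodule.mem_one.mp (x.2 y.1 hy)
  simp only [dualBilin, LinearMap.mk₂_apply, ← hn]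
  rw [AddCircle.coe_eq_zero_iff]
  exact ⟨n, by simp⟩

/-- The discriminant bilinear form `b_L : A_L × A_L → ℚ/ℤ`. -/
def discBilin (S : EvenForm L) : S.Disc →ₗ[ℤ] S.Disc →ₗ[ℤ] AddCircle (1 : ℚ) :=
  S.latInDual.liftQ
    (S.latInDual.liftQ S.dualBilin (fun x hx => by
      ext y
      rw [S.dualBilin_symm]
      exact S.dualBilin_eq_zero y x hx)).flip
    (fun y hy => by
      ext x
      exact S.dualBilin_eq_zero x y hy)

lemma discBilin_mk (S : EvenForm L) (x y : S.dual) :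
    S.discBilin (S.latInDual.mkQ x) (S.latInDual.mkQ y) =
      ((S.formQ x y : ℚ) : AddCircle (1 : ℚ)) := by
  rw [S.formQ_symm]; rfl

/-- The discriminant quadratic form `q_L : A_L → ℚ/2ℤ`, `q_L(x mod L) = (x, x) mod 2ℤ`. -/
def discQuad (S : EvenForm L) (a : S.Disc) : AddCircle (2 : ℚ) :=
  Quotient.liftOn' a (fun x => ((S.formQ x x : ℚ) : AddCircle (2 : ℚ))) (by
    intro x y hxy
    have h : x - y ∈ S.latInDual := (Submodule.quotientRel_def _).1 hxy
    obtain ⟨n, hn⟩ := Submodule.mem_one.mp (y.2 (x - y : S.dual).1 h)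
    obtain ⟨l, hl⟩ := h
    obtain ⟨k, hk⟩ := S.even l
    have h1 : S.formQ (x - y : S.dual).1 (x - y : S.dual).1 = ((k + k : ℤ) : ℚ) := by
      change _ = (x - y : S.dual).1 at hl
      rw [← hl, ← hk]
      change S.form.baseChange ℚ (1 ⊗ₜ[ℤ] l) (1 ⊗ₜ[ℤ] l) = _
      rw [LinearMap.BilinForm.baseChange_tmul]; simp
    have hx : x.1 = y.1 + (x - y : S.dual).1 := by simp
    change ((S.formQ x.1 x.1 : ℚ) : AddCircle (2 : ℚ)) = ((S.formQ y.1 y.1 : ℚ) : AddCircle (2 : ℚ))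
    have h2 : S.formQ x.1 x.1 = S.formQ y.1 y.1 + (((n + k : ℤ) : ℚ) * 2) := by
      rw [hx, map_add, map_add, LinearMap.add_apply, LinearMap.add_apply, h1,
        S.formQ_symm (x - y : S.dual).1 y.1, ← hn]
      simp; ring
    rw [h2, AddCircle.coe_add]
    convert! add_zero _
    rw [AddCircle.coe_eq_zero_iff]
    exact ⟨n + k, by simp⟩)

lemma discQuad_mk (S : EvenForm L) (x : S.dual) :
    S.discQuad (S.latInDual.mkQ x) = ((S.formQ x x : ℚ) : AddCircle (2 : ℚ)) := rfl

/-- The orthogonal complement in `A_L` of a subgroup of `A_L`, with respect to `b_L`. -/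
def discPerp (S : EvenForm L) (G : Submodule ℤ S.Disc) : Submodule ℤ S.Disc where
  carrier := {a | ∀ g ∈ G, S.discBilin g a = 0}
  add_mem' ha hb g hg := by rw [map_add, ha g hg, hb g hg, add_zero]
  zero_mem' g _ := map_zero _
  smul_mem' c a ha g hg := by rw [map_smul, ha g hg, smul_zero]

/-! ### Gluing -/

/-- The map `(M ⊗ ℚ) × (N ⊗ ℚ) → L ⊗ ℚ`, `(m, n) ↦ m + n`, restricted to `M^* × N^*`. -/
def dualSumMap (S : EvenForm L) (M N : Submodule ℤ L) :
    (S.restrict M).dual × (S.restrict N).dual →ₗ[ℤ] ℚ ⊗[ℤ] L :=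
  LinearMap.coprod
    ((M.subtype.lTensor ℚ).comp (S.restrict M).dual.subtype)
    ((N.subtype.lTensor ℚ).comp (S.restrict N).dual.subtype)

/-- The gluing subgroup `Γ = L / (M ⊕ N) ⊂ A_M ⊕ A_N` of orthogonal sublattices `M`, `N` of `L`:
the classes of the pairs `(m, n) ∈ M^* × N^*` with `m + n ∈ L`. -/
def glue (S : EvenForm L) (M N : Submodule ℤ L) :
    Submodule ℤ ((S.restrict M).Disc × (S.restrict N).Disc) :=
  (S.lat.comap (S.dualSumMap M N)).map
    (LinearMap.prodMap (S.restrict M).latInDual.mkQ (S.restrict N).latInDual.mkQ)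

/-- For a sublattice `M` with `N = M^⊥`: the projection `Γ_N ⊂ A_N` of the gluing subgroup
`Γ ⊂ A_M ⊕ A_N`. -/
def glueN (S : EvenForm L) (M : Submodule ℤ L) :
    Submodule ℤ (S.restrict (S.perp M)).Disc :=
  (S.glue M (S.perp M)).map (LinearMap.snd ℤ _ _)

/-- `z` is the generator `z_N` of `Γ_N^⊥`: it is nonzero and `Γ_N^⊥ = {0, z}`. -/
def IsGlueGenerator (S : EvenForm L) (M : Submodule ℤ L) (z : (S.restrict (S.perp M)).Disc) :
    Prop :=
  z ≠ 0 ∧ ((S.restrict (S.perp M)).discPerp (S.glueN M) : Set _) = {0, z}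

/-! ### Sublattices up to isometry -/

/-- `M` is a primitive sublattice of `L`: the quotient `L / M` is torsion-free. -/
def Primitive (M : Submodule ℤ L) : Prop := ∀ (k : ℤ) (x : L), k ≠ 0 → k • x ∈ M → x ∈ M

/-- `M₁` and `M₂` lie in the same orbit of the orthogonal group `O(L)`. -/
def SameOrbit (S : EvenForm L) (M₁ M₂ : Submodule ℤ L) : Prop :=
  ∃ φ : S.form.IsometryEquiv S.form, M₁.map φ.toLinearEquiv.toLinearMap = M₂

lemma sameOrbit_equivalence (S : EvenForm L) : Equivalence S.SameOrbit where
  refl M := ⟨LinearMap.BilinForm.IsometryEquiv.refl _, by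
    ext x; exact ⟨fun ⟨y, hy, h⟩ => h ▸ hy, fun h => ⟨x, h, rfl⟩⟩⟩
  symm := by
    rintro M _ ⟨φ, rfl⟩
    refine ⟨φ.symm, ?_⟩
    ext x
    constructor
    · rintro ⟨_, ⟨y, hy, rfl⟩, rfl⟩
      have : φ.toLinearEquiv.symm (φ.toLinearEquiv y) = y := φ.toLinearEquiv.symm_apply_apply y
      exact this.symm ▸ hy
    · intro h
      exact ⟨φ.toLinearEquiv x, ⟨x, h, rfl⟩, φ.toLinearEquiv.symm_apply_apply x⟩
  trans := by
    rintro M _ _ ⟨φ, rfl⟩ ⟨ψ, rfl⟩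
    refine ⟨φ.trans ψ, ?_⟩
    rw [← Submodule.map_comp]
    rfl

/-- The `O(L)`-orbit relation on the sublattices with a given property. -/
def orbitSetoid (S : EvenForm L) (P : Submodule ℤ L → Prop) : Setoid {M : Submodule ℤ L // P M} where
  r M₁ M₂ := S.SameOrbit M₁ M₂
  iseqv := ⟨fun M => S.sameOrbit_equivalence.refl M, fun h => S.sameOrbit_equivalence.symm h,
    fun h h' => S.sameOrbit_equivalence.trans h h'⟩

end EvenForm

/-! ### The lattices at hand -/

/-- The hyperbolic plane `U`. -/
def latU : EvenForm (Fin 2 → ℤ) :=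
  EvenForm.ofMatrix !![0, 1; 1, 0] (by decide) (by decide)

/-- The negative definite lattice `E₈`. -/
def latE8 : EvenForm (Fin 8 → ℤ) :=
  (EvenForm.ofMatrix CartanMatrix.E₈ CartanMatrix.E₈_isSymm
    (fun i => by rw [CartanMatrix.E₈_diag]; exact even_two)).scale (-1)

/-- The negative definite lattice `D₄`. -/
def latD4 : EvenForm (Fin 4 → ℤ) :=
  (EvenForm.ofMatrix (CartanMatrix.D 4) (CartanMatrix.D_isSymm 4)
    (fun i => by rw [CartanMatrix.D_diag]; exact even_two)).scale (-1)

/-- `S = U ⊕ E₈ ⊕ D₄ ⊕ D₄`. -/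
def latS : EvenForm (((Fin 2 → ℤ) × (Fin 8 → ℤ)) × ((Fin 4 → ℤ) × (Fin 4 → ℤ))) :=
  (latU.sum latE8).sum (latD4.sum latD4)

/-- `U(2) ⊕ E₈(2)`. -/
def latU2E82 : EvenForm ((Fin 2 → ℤ) × (Fin 8 → ℤ)) := (latU.scale 2).sum (latE8.scale 2)

/-- `M` is a primitive sublattice of `S`, isomorphic to `U(2) ⊕ E₈(2)`, that is orthogonal to
no `(-2)`-vector of `S`. -/
structure IsEnriquesSublattice
    (M : Submodule ℤ (((Fin 2 → ℤ) × (Fin 8 → ℤ)) × ((Fin 4 → ℤ) × (Fin 4 → ℤ)))) : Prop where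
  primitive : EvenForm.Primitive M
  iso : (latS.restrict M).Iso latU2E82
  no_root : ∀ x ∈ latS.perp M, latS.form x x ≠ -2

end

/-! Let `f` embed (U ⊕ E₈)(2) onto `M`, and let N be the orthogonal complement. Since S has
signature (1, 17) and 2S* ⊂ S, and M(1/2) is unimodular, N is negative definite of rank 8, 2S ⊂ M ⊕
N and 2N* ⊂ N.

Why N is E₈(2): `subD`/2 is an even unimodular overlattice of S and f(`subT`)/2 is one of M;
together they cut out an even unimodular overlattice P = `subF`/2 of N, with 2P ⊂ N ⊂ P. By the
uniqueness of E₈, every class of P modulo 2P is zero, the class of a root, or the class of a sum of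
two orthogonal roots. If N met the class of a root, then 2P ⊂ N would put that root into N, which is
excluded. Vectors in the remaining classes have norm divisible by 4 (`four_dvd_perp_norm`). So
N(-1/2) is even, and 2N* ⊂ N makes it unimodular (`exists_formN`).

Uniqueness of E₈: Hermite's bound yields a root orthogonal to any k < 8 orthogonal roots, hence a
frame of eight. Half sums over the frame form a self-dual code with weights divisible by 4, which
must be the Hamming code. Such a frame can begin with any given root, or any two orthogonal ones, so
isometries are transitive on the nonzero classes modulo two of each value of the quadratic form
(`IsEvenUnimodular8.exists_equiv`).

Classification: counting dimensions modulo two shows that Γ_N is a hyperplane of A_N = (N/2)/N, so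
its complement is {0, z/2} with q(z/2) = (z, z)/4, an integer modulo 2 (`exists_glue_vector`). Given
this value, N can be identified with E₈(2) so that z, hence Γ_N, is standard. Then Γ is given by an
isometric embedding of a fixed hyperplane of E₈/2E₈ into (U ⊕ E₈)/2. Two such embeddings differ by
an isometry of U ⊕ E₈: this is Witt's extension theorem, proved with transvections that lift to ℤ
(`exists_isometry_modTwo`). That isometry of M, together with the identification of the complements,
extends to S (`IsEnriquesEmbedding.exists_isometry`). Explicit embeddings `embAEven` and `embAOdd`
realise the two values. -/

noncomputable section

/-! ### Saturated submodules -/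

section Saturated

variable {L : Type*} [AddCommGroup L] [Module.Finite ℤ L]

theorem free_quotient_of_primitive {p : Submodule ℤ L} (h : EvenForm.Primitive p) :
    Module.Free ℤ (L ⧸ p) := by
  have : Module.IsTorsionFree ℤ (L ⧸ p) := by
    rw [Module.isTorsionFree_iff_smul_eq_zero]
    intro k x hx
    by_contra! hk
    obtain ⟨y, rfl⟩ := p.mkQ_surjective x
    apply hk.2
    rw [← map_smul] at hx
    simp only [Submodule.mkQ_apply, Submodule.Quotient.mk_eq_zero] at hx ⊢
    exact h k y hk.1 hx
  infer_instance

/-- The free quotient splits off. The retraction serves to extend functionals from a primitive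
sublattice to the whole lattice. -/
theorem exists_retraction_of_primitive {p : Submodule ℤ L} (h : EvenForm.Primitive p) :
    ∃ π : L →ₗ[ℤ] p, ∀ x : p, π x = x := by
  have := free_quotient_of_primitive h
  obtain ⟨s, hs⟩ := LinearMap.exists_rightInverse_of_surjective p.mkQ p.range_mkQ
  have key : ∀ x, x - s (p.mkQ x) ∈ p := by
    intro x
    rw [← Submodule.Quotient.mk_eq_zero, ← Submodule.mkQ_apply, map_sub]
    have := LinearMap.congr_fun hs (p.mkQ x)
    simp only [LinearMap.comp_apply, LinearMap.id_apply] at this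
    rw [this, sub_self]
  refine ⟨LinearMap.codRestrict p (LinearMap.id - s ∘ₗ p.mkQ) key, fun x => ?_⟩
  have hx : p.mkQ (x : L) = 0 := by simp
  ext
  simp [-Submodule.mkQ_apply, hx]

end Saturated

/-! ### Hermite's bound -/

/-- Clear the first column by row operations. For a Gram matrix, the remaining block is the Gram
matrix of the projections orthogonal to the first basis vector. -/
theorem Matrix.det_eq_mul_det_schur {n : ℕ} (M : Matrix (Fin (n + 1)) (Fin (n + 1)) ℚ)
    (h : M 0 0 ≠ 0) :
    M.det = M 0 0 *
      (Matrix.of fun i j : Fin n => M i.succ j.succ - M i.succ 0 * M 0 j.succ / M 0 0).det := by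
  have h1 : M.det = (Matrix.of fun i j : Fin (n + 1) =>
      M i j - (if i = 0 then 0 else M i 0 / M 0 0) * M 0 j).det := by
    symm
    refine Matrix.det_eq_of_forall_row_eq_smul_add_const
      (fun i => if i = 0 then 0 else - (M i 0 / M 0 0)) 0 (by simp) ?_
    intro i j
    by_cases hi : i = 0 <;> simp [hi]; ring
  rw [h1, Matrix.det_succ_column_zero, Finset.sum_eq_single 0]
  · simp only [Fin.val_zero, pow_zero, one_mul, Matrix.of_apply, if_true, zero_mul, sub_zero]
    congr 2
    ext i j
    simp [Matrix.submatrix_apply]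
    ring
  · intro i _ hi
    simp [hi, h]
  · simp

section Hermite

variable {L : Type*} [AddCommGroup L]

/-- Strict Cauchy–Schwarz. The common denominator `d` makes a multiple of the projection of `x`
orthogonal to `v` a lattice vector, to which positivity applies. -/
theorem mul_self_lt_of_posDef (B : L →ₗ[ℤ] L →ₗ[ℤ] ℚ) (hs : ∀ x y, B x y = B y x)
    (hp : ∀ x, x ≠ 0 → 0 < B x x) (d : ℤ) (hd : 0 < d) (hB : ∀ x y, ∃ k : ℤ, d * B x y = k)
    (x v : L) (hv : v ≠ 0) (hx : ∀ a b : ℤ, a ≠ 0 → a • x ≠ b • v) :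
    B x v * B x v < B v v * B x x := by
  obtain ⟨k, hk⟩ := hB x v
  obtain ⟨l, hl⟩ := hB v v
  have hdq : (0 : ℚ) < d := by exact_mod_cast hd
  have hvv := hp v hv
  have hl0 : l ≠ 0 := by
    rintro rfl
    have : (0 : ℚ) < d * B v v := by positivity
    rw [hl] at this; simp at this
  have h1 := hp (l • x - k • v) (by rw [sub_ne_zero]; exact hx l k hl0)
  simp only [map_sub, map_smul, LinearMap.sub_apply, LinearMap.smul_apply, zsmul_eq_mul] at h1
  rw [hs v x, ← hk, ← hl] at h1
  have h2 : (d : ℚ) ^ 2 * B v v * (B v v * B x x - B x v * B x v) > 0 := by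
    convert h1 using 1; ring
  have h3 : 0 < B v v * B x x - B x v * B x v := by
    by_contra hc
    push Not at hc
    have : (d : ℚ) ^ 2 * B v v * (B v v * B x x - B x v * B x v) ≤ 0 :=
      mul_nonpos_of_nonneg_of_nonpos (by positivity) hc
    linarith
  linarith

/-- The values `d * B x x` are natural numbers, so a least one exists. -/
theorem exists_minimal_vector [Nontrivial L] (B : L →ₗ[ℤ] L →ₗ[ℤ] ℚ)
    (hp : ∀ x, x ≠ 0 → 0 < B x x) (d : ℤ) (hd : 0 < d) (hB : ∀ x y, ∃ k : ℤ, d * B x y = k) :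
    ∃ v, v ≠ 0 ∧ ∀ x, x ≠ 0 → B v v ≤ B x x := by
  have hdq : (0 : ℚ) < d := by exact_mod_cast hd
  choose k hk using fun x => hB x x
  obtain ⟨w, hw⟩ := exists_ne (0 : L)
  have hne : {x : L | x ≠ 0}.Nonempty := ⟨w, hw⟩
  let v := Function.argminOn (fun x => (k x).toNat) {x : L | x ≠ 0} hne
  refine ⟨v, Function.argminOn_mem (fun x => (k x).toNat) _ hne, fun x hx => ?_⟩
  have h := Function.argminOn_le (fun x => (k x).toNat) {x : L | x ≠ 0} hx
  have hk0 : 0 ≤ k x := by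
    have : (0 : ℚ) ≤ k x := by rw [← hk]; exact mul_nonneg hdq.le (hp x hx).le
    exact_mod_cast this
  have h1 : k v ≤ k x := by
    have h' : (k v).toNat ≤ (k x).toNat := h
    omega
  have h2 : d * B v v ≤ d * B x x := by rw [hk, hk]; exact_mod_cast h1
  exact le_of_mul_le_mul_left h2 hdq

/-- The form on `L` induced by the projection orthogonal to `v`. -/
def projForm (B : L →ₗ[ℤ] L →ₗ[ℤ] ℚ) (v : L) : L →ₗ[ℤ] L →ₗ[ℤ] ℚ :=
  LinearMap.mk₂ ℤ (fun x y => B x y - B x v * B v y / B v v)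
    (by intros; simp; ring) (by intros; simp; ring) (by intros; simp; ring) (by intros; simp; ring)

theorem exists_int_abs_sub_le (q : ℚ) : ∃ k : ℤ, (q - k) ^ 2 ≤ 1 / 4 := by
  refine ⟨round q, ?_⟩
  have := abs_le.1 (abs_sub_round q)
  nlinarith

/-- Hermite's induction: project orthogonally to a minimal vector `v`. The determinant drops by the
factor `B v v`, the minimum by at most the factor 3/4. Projection destroys integrality, which is why
rational forms with a common denominator are treated. -/
theorem hermite_bound.{u} (n : ℕ) : ∀ (L : Type u) [AddCommGroup L] [Module.Free ℤ L]
    [Module.Finite ℤ L], Module.finrank ℤ L = n → ∀ (B : L →ₗ[ℤ] L →ₗ[ℤ] ℚ),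
    (∀ x y, B x y = B y x) → (∀ x, x ≠ 0 → 0 < B x x) →
    ∀ d : ℤ, 0 < d → (∀ x y, ∃ k : ℤ, d * B x y = k) →
    ∀ m : ℚ, 0 ≤ m → (∀ x, x ≠ 0 → m ≤ B x x) →
    ∃ b : Module.Basis (Fin n) ℤ L,
      m ^ n ≤ (4 / 3) ^ (n * (n - 1) / 2) * (Matrix.of fun i j => B (b i) (b j)).det := by
  induction n with
  | zero =>
    intro L _ _ _ hn B _ _ d _ _ m _ _
    exact ⟨Module.finBasisOfFinrankEq ℤ L hn, by simp⟩
  | succ n ih =>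
    intro L _ _ _ hn B hs hp d hd hB m hm0 hm
    have : Nontrivial L := Module.nontrivial_of_finrank_pos (R := ℤ) (by omega)
    obtain ⟨v, hv, hmin⟩ := exists_minimal_vector B hp d hd hB
    have hvv := hp v hv
    -- If `k • x = c • v`, division with remainder gives a multiple of `v` by `(c % k) / k`, shorter
    -- than the minimal vector unless it is zero.
    have hprim : EvenForm.Primitive (ℤ ∙ v) := by
      intro k x hk hx
      obtain ⟨c, hc⟩ := Submodule.mem_span_singleton.1 hx
      have h1 : k • (x - (c / k) • v) = (c % k) • v := by
        have := Int.mul_ediv_add_emod c k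
        rw [smul_sub, ← hc, smul_smul, ← sub_smul]; congr 1; linarith
      by_cases h0 : x - (c / k) • v = 0
      · rw [sub_eq_zero] at h0
        rw [h0]; exact Submodule.smul_mem _ _ (Submodule.mem_span_singleton_self v)
      exfalso
      have h2 := hmin _ h0
      have h3 : (k : ℚ) * k * B (x - (c / k) • v) (x - (c / k) • v)
          = ((c % k : ℤ) : ℚ) * (c % k : ℤ) * B v v := by
        have := congrArg (fun y => B y y) h1
        simp only [map_smul, LinearMap.smul_apply, zsmul_eq_mul] at this
        linarith
      have h4 : ((c % k : ℤ) : ℚ) * (c % k : ℤ) < (k : ℚ) * k := by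
        have h5 := Int.emod_nonneg c hk
        have h6 := Int.emod_lt_abs c hk
        have : (c % k) * (c % k) < k * k := by
          rw [← abs_mul_abs_self k]; nlinarith
        exact_mod_cast this
      have hkk : (0 : ℚ) < (k : ℚ) * k := by
        have : (k : ℚ) ≠ 0 := by exact_mod_cast hk
        exact mul_self_pos.2 this
      nlinarith
    obtain ⟨π, hπ⟩ := exists_retraction_of_primitive hprim
    have hcompl := LinearMap.isCompl_of_proj hπ
    set N := LinearMap.ker π with hN
    have hrank : Module.finrank ℤ N = n := by
      have e := (Submodule.prodEquivOfIsCompl _ _ hcompl).finrank_eq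
      have e1 : Module.finrank ℤ (ℤ ∙ v) = 1 :=
        ((LinearEquiv.toSpanNonzeroSingleton ℤ L v hv).finrank_eq).symm.trans
          (Module.finrank_self ℤ)
      rw [Module.finrank_prod, e1, hn] at e
      omega
    have hind : ∀ x ∈ N, x ≠ 0 → ∀ a b : ℤ, a ≠ 0 → a • x ≠ b • v := by
      intro x hx hx0 a b ha h
      have h1 : a • x ∈ (ℤ ∙ v) ⊓ N :=
        ⟨h ▸ Submodule.smul_mem _ _ (Submodule.mem_span_singleton_self v), N.smul_mem _ hx⟩
      rw [hcompl.inf_eq_bot, Submodule.mem_bot] at h1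
      exact (smul_ne_zero ha hx0) h1
    let B' : N →ₗ[ℤ] N →ₗ[ℤ] ℚ := (projForm B v).compl₁₂ N.subtype N.subtype
    have hB' : ∀ x y : N, B' x y = B x y - B x v * B v y / B v v := fun _ _ => rfl
    have hpos : ∀ x : N, x ≠ 0 → 0 < B' x x := by
      intro x hx
      have hx' : (x : L) ≠ 0 := fun h => hx (Subtype.ext h)
      have := mul_self_lt_of_posDef B hs hp d hd hB x v hv (hind x x.2 hx')
      rw [hB', hs v x, sub_pos, div_lt_iff₀ hvv]
      linarith
    obtain ⟨l, hl⟩ := hB v v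
    have hdq : (0 : ℚ) < d := by exact_mod_cast hd
    have hl0 : 0 < l := by
      have : (0 : ℚ) < l := by rw [← hl]; exact mul_pos hdq hvv
      exact_mod_cast this
    -- Subtracting the nearest multiple of `v` leaves a component along `v` of norm at most `B v v /
    -- 4`, while the whole vector has norm at least `B v v`.
    have hmin' : ∀ x : N, x ≠ 0 → 3 / 4 * B v v ≤ B' x x := by
      intro x hx
      have hx' : (x : L) ≠ 0 := fun h => hx (Subtype.ext h)
      obtain ⟨k, hk⟩ := exists_int_abs_sub_le (B x v / B v v)
      have h1 := hmin (x - k • v) (by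
        rw [sub_ne_zero]
        have := hind x x.2 hx' 1 k one_ne_zero
        rwa [one_smul] at this)
      simp only [map_sub, map_smul, LinearMap.sub_apply, LinearMap.smul_apply, zsmul_eq_mul,
        hs v x] at h1
      rw [hB', hs v x]
      have h2 : B x x - k * B x v - k * (B x v - k * B v v) =
          (B x x - B x v * B x v / B v v) + (B x v / B v v - k) ^ 2 * B v v := by
        field_simp; ring
      have h1' : B v v ≤ B x x - k * B x v - k * (B x v - k * B v v) := by linarith
      rw [h2] at h1'
      nlinarith
    obtain ⟨b, hb⟩ := ih N hrank B' (fun x y => by rw [hB', hB', hs x y, hs v y, hs v x]; ring)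
      hpos (d * l) (by positivity) (fun x y => by
        obtain ⟨k1, h1⟩ := hB x y
        obtain ⟨k2, h2⟩ := hB x v
        obtain ⟨k3, h3⟩ := hB v y
        refine ⟨l * k1 - k2 * k3, ?_⟩
        rw [hB']; push_cast
        rw [← h1, ← h2, ← h3, ← hl]
        field_simp) (3 / 4 * B v v) (by positivity) hmin'
    have hli : ∀ (c : ℤ), ∀ x ∈ N, c • v + x = 0 → c = 0 := by
      intro c x hx h
      by_contra hc
      have h1 : c • v ∈ (ℤ ∙ v) ⊓ N :=
        ⟨Submodule.smul_mem _ _ (Submodule.mem_span_singleton_self v), by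
          rw [eq_neg_of_add_eq_zero_left h]; exact N.neg_mem hx⟩
      rw [hcompl.inf_eq_bot, Submodule.mem_bot] at h1
      exact (smul_ne_zero hc hv) h1
    have hsp : ∀ z : L, ∃ c : ℤ, z + c • v ∈ N := by
      intro z
      obtain ⟨c, hc⟩ := Submodule.mem_span_singleton.1 (π z).2
      refine ⟨-c, ?_⟩
      rw [neg_smul, hc, ← sub_eq_add_neg, hN, LinearMap.mem_ker, map_sub, hπ, sub_self]
    refine ⟨Module.Basis.mkFinCons v b hli hsp, ?_⟩
    rw [Module.Basis.coe_mkFinCons, Matrix.det_eq_mul_det_schur _ (by simpa using hvv.ne')]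
    simp only [Matrix.of_apply, Fin.cons_zero, Fin.cons_succ, Function.comp_apply]
    have hb' : (3 / 4 * B v v) ^ n ≤ (4 / 3) ^ (n * (n - 1) / 2) * (Matrix.of fun i j =>
        B (b i) (b j) - B (b i) v * B v (b j) / B v v).det := hb
    set D := (Matrix.of fun i j => B (b i) (b j) - B (b i) v * B v (b j) / B v v).det
    have hexp : (n + 1) * (n + 1 - 1) / 2 = n + n * (n - 1) / 2 := by
      have h1 : (n + 1) * (n + 1 - 1) = n * (n - 1) + 2 * n := by
        cases n with
        | zero => rfl
        | succ k => simp; ring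
      omega
    calc m ^ (n + 1) ≤ (B v v) ^ (n + 1) := pow_le_pow_left₀ hm0 (hm v hv) _
      _ = (4 / 3) ^ n * B v v * (3 / 4 * B v v) ^ n := by
        rw [mul_pow, pow_succ]
        have : ((4 : ℚ) / 3) ^ n * (3 / 4) ^ n = 1 := by rw [← mul_pow]; norm_num
        linear_combination (- B v v ^ n * B v v) * this
      _ ≤ (4 / 3) ^ n * B v v * ((4 / 3) ^ (n * (n - 1) / 2) * D) := by gcongr
      _ = _ := by rw [hexp, pow_add]; ring

end Hermite

/-! ### Even unimodular positive definite lattices of rank eight -/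

/-- `B` is an even unimodular positive definite form of rank eight. -/
structure IsEvenUnimodular8 {E : Type*} [AddCommGroup E] (B : LinearMap.BilinForm ℤ E) : Prop where
  symm : ∀ x y, B x y = B y x
  even : ∀ x, Even (B x x)
  pos : ∀ x, x ≠ 0 → 0 < B x x
  unimodular : ∀ φ : E →ₗ[ℤ] ℤ, ∃ x, ∀ y, B x y = φ y
  rank : Module.finrank ℤ E = 8

/-- A family of pairwise orthogonal roots. -/
def IsFrame {E : Type*} [AddCommGroup E] (B : LinearMap.BilinForm ℤ E) {k : ℕ}
    (e : Fin k → E) : Prop :=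
  ∀ i j, B (e i) (e j) = if i = j then 2 else 0

/-! ### Orthogonal roots and their extension to a frame of eight -/

section Frame

variable {E : Type*} [AddCommGroup E] {B : LinearMap.BilinForm ℤ E}

/-- The inner products with the vectors of a family. -/
def frameMap (B : LinearMap.BilinForm ℤ E) {k : ℕ} (e : Fin k → E) : E →ₗ[ℤ] Fin k → ℤ :=
  LinearMap.pi fun i => B (e i)

@[simp] theorem frameMap_apply {k : ℕ} (e : Fin k → E) (x : E) (i : Fin k) :
    frameMap B e x i = B (e i) x := rfl

theorem mem_ker_frameMap {k : ℕ} (e : Fin k → E) (x : E) :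
    x ∈ LinearMap.ker (frameMap B e) ↔ ∀ i, B (e i) x = 0 := by
  rw [LinearMap.mem_ker, funext_iff]; rfl

theorem IsFrame.apply_sum {k : ℕ} {e : Fin k → E} (he : IsFrame B e) (i : Fin k)
    (c : Fin k → ℤ) : B (e i) (∑ j, c j • e j) = 2 * c i := by
  simp [he i, mul_comm]

/-- As roots have norm 2, this is twice the projection orthogonal to the family, and it is integral.
-/
theorem IsFrame.two_smul_sub_mem_ker {k : ℕ} {e : Fin k → E} (he : IsFrame B e) (x : E) :
    (2 : ℤ) • x - ∑ i, B (e i) x • e i ∈ LinearMap.ker (frameMap B e) := by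
  rw [mem_ker_frameMap]
  intro i
  rw [map_sub, he.apply_sum, map_smul, smul_eq_mul, sub_self]

theorem primitive_ker {L L' : Type*} [AddCommGroup L] [AddCommGroup L'] [Module.IsTorsionFree ℤ L']
    (f : L →ₗ[ℤ] L') : EvenForm.Primitive (LinearMap.ker f) := by
  intro k x hk hx
  rw [LinearMap.mem_ker, map_smul] at hx
  rw [LinearMap.mem_ker]
  exact (smul_eq_zero.1 hx).resolve_left hk

theorem IsFrame.snoc (hs : ∀ x y, B x y = B y x) {k : ℕ}
    {e : Fin k → E} (he : IsFrame B e) {r : E} (hr : B r r = 2) (h : ∀ i, B (e i) r = 0) :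
    IsFrame B (Fin.snoc e r : Fin (k + 1) → E) := by
  intro i j
  induction i using Fin.lastCases with
  | last =>
    induction j using Fin.lastCases with
    | last => simpa using hr
    | cast j =>
      have : Fin.last k ≠ j.castSucc := (Fin.castSucc_lt_last j).ne'
      simp [this, hs r, h j]
  | cast i =>
    induction j using Fin.lastCases with
    | last =>
      have : i.castSucc ≠ Fin.last k := (Fin.castSucc_lt_last i).ne
      simp [this, h i]
    | cast j => simpa using he i j

variable [Module.Finite ℤ E]

/-- The image of `frameMap` contains 2ℤᵏ, so it has rank `k`. -/
theorem IsFrame.finrank_ker (hB : IsEvenUnimodular8 B) {k : ℕ} {e : Fin k → E}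
    (he : IsFrame B e) : Module.finrank ℤ (LinearMap.ker (frameMap B e)) + k = 8 := by
  have h := Submodule.finrank_quotient_add_finrank (LinearMap.ker (frameMap B e))
  rw [(frameMap B e).quotKerEquivRange.finrank_eq] at h
  have h1 : Module.finrank ℤ (LinearMap.range (frameMap B e)) = k := by
    apply le_antisymm
    · simpa using Submodule.finrank_le (LinearMap.range (frameMap B e))
    · have hmem : ∀ c : Fin k → ℤ, (2 : ℤ) • c ∈ LinearMap.range (frameMap B e) := fun c =>
        ⟨∑ j, c j • e j, by ext i; rw [frameMap_apply, he.apply_sum]; simp⟩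
      have := LinearMap.finrank_le_finrank_of_injective
        (f := LinearMap.codRestrict (LinearMap.range (frameMap B e))
          ((2 : ℤ) • LinearMap.id) hmem) (by
          intro x y h
          exact smul_right_injective _ (two_ne_zero (α := ℤ)) (congrArg Subtype.val h))
      simpa using this
  rw [hB.rank, h1] at h
  omega

theorem exists_dual_of_primitive (hB : IsEvenUnimodular8 B) {K : Submodule ℤ E}
    (hK : EvenForm.Primitive K) (φ : K →ₗ[ℤ] ℤ) : ∃ y, ∀ x : K, B y x = φ x := by
  obtain ⟨π, hπ⟩ := exists_retraction_of_primitive hK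
  obtain ⟨y, hy⟩ := hB.unimodular (φ ∘ₗ π)
  exact ⟨y, fun x => by rw [hy, LinearMap.comp_apply, hπ]⟩

/-- Dual basis vectors extend to vectors of `E`, and twice their projections lie in the kernel.
Hence the Gram matrix divides 2 times the identity. -/
theorem IsFrame.det_dvd (hB : IsEvenUnimodular8 B) {k n : ℕ} {e : Fin k → E}
    (he : IsFrame B e) (b : Module.Basis (Fin n) ℤ (LinearMap.ker (frameMap B e))) :
    (Matrix.of fun i j => B (b i) (b j)).det ∣ 2 ^ n := by
  choose y hy using fun j => exists_dual_of_primitive hB (primitive_ker (frameMap B e)) (b.coord j)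
  let κ : Fin n → LinearMap.ker (frameMap B e) := fun j => ⟨_, he.two_smul_sub_mem_ker (y j)⟩
  have hκ : ∀ i j, B (b i) (κ j) = if i = j then 2 else 0 := by
    intro i j
    have h1 : ∀ l, B (b i) (e l) = 0 := fun l => by
      rw [hB.symm]; exact (mem_ker_frameMap e _).1 (b i).2 l
    have h2 := hy j (b i)
    rw [hB.symm] at h2
    simp only [κ, map_sub, map_smul, map_sum, h1, h2]
    simp [Finsupp.single_apply]
  have h : (Matrix.of fun i j => B (b i) (b j)) * (Matrix.of fun i j => b.repr (κ j) i) =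
      (2 : ℤ) • (1 : Matrix (Fin n) (Fin n) ℤ) := by
    ext i j
    have h1 : B (b i) (κ j) = ∑ l, b.repr (κ j) l * B (b i) (b l) := by
      have h0 := congrArg (fun z : LinearMap.ker (frameMap B e) => B (b i) (z : E))
        (b.sum_repr (κ j))
      simp only [Submodule.coe_sum, Submodule.coe_smul, map_sum, map_smul, smul_eq_mul] at h0
      exact h0.symm
    rw [hκ] at h1
    simp only [Matrix.mul_apply, Matrix.of_apply, Matrix.smul_apply, Matrix.one_apply]
    simp_rw [mul_comm (B _ _)]
    rw [← h1]; simp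
  have h2 := congrArg Matrix.det h
  rw [Matrix.det_mul, Matrix.det_smul, Matrix.det_one, Fintype.card_fin, mul_one] at h2
  exact ⟨_, h2.symm⟩

/-- The determinant is the order of the discriminant group of the kernel. A class there is
represented by a vector of `E`, and is determined by the parities of its products with the `k`
roots. -/
theorem IsFrame.natAbs_det_le (hB : IsEvenUnimodular8 B) {k n : ℕ} {e : Fin k → E}
    (he : IsFrame B e) (b : Module.Basis (Fin n) ℤ (LinearMap.ker (frameMap B e)))
    (hdet : (Matrix.of fun i j => B (b i) (b j)).det ≠ 0) :
    (Matrix.of fun i j => B (b i) (b j)).det.natAbs ≤ 2 ^ k := by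
  set G : Matrix (Fin n) (Fin n) ℤ := Matrix.of fun i j => B (b i) (b j) with hG
  have hinj : Function.Injective (Matrix.toLin' G) := by
    rw [← LinearMap.ker_eq_bot]
    by_contra hne
    obtain ⟨v, hv, hv0⟩ := Submodule.exists_mem_ne_zero_of_ne_bot hne
    exact hdet (Matrix.exists_mulVec_eq_zero_iff.1 ⟨v, hv0, by simpa using hv⟩)
  have h1 := Submodule.natAbs_det_equiv (LinearMap.range (Matrix.toLin' G))
    (LinearEquiv.ofInjective _ hinj)
  have h2 : (LinearMap.range (Matrix.toLin' G)).subtype ∘ₗ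
      ((LinearEquiv.ofInjective _ hinj : (Fin n → ℤ) ≃ₗ[ℤ] _) : (Fin n → ℤ) →+ _).toIntLinearMap
      = Matrix.toLin' G := by ext; rfl
  rw [h2, LinearMap.det_toLin'] at h1
  rw [h1]
  have hsurj : ∀ c : Fin n → ℤ, ∃ y, ∀ i, B y (b i) = c i := by
    intro c
    obtain ⟨y, hy⟩ := exists_dual_of_primitive hB (primitive_ker (frameMap B e))
      (b.constr ℤ c)
    exact ⟨y, fun i => by rw [hy, b.constr_basis]⟩
  choose y hy using hsurj
  let par : ((Fin n → ℤ) ⧸ LinearMap.range (Matrix.toLin' G)) → Fin k → ZMod 2 :=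
    fun c i => (B (e i) (y c.out) : ZMod 2)
  have hpar : Function.Injective par := by
    intro c d h
    have h3 : ∀ i, ∃ t : ℤ, B (e i) (y c.out - y d.out) = 2 * t := by
      intro i
      have := congrFun h i
      simp only [par] at this
      rw [ZMod.intCast_eq_intCast_iff_dvd_sub] at this
      obtain ⟨t, ht⟩ := this
      refine ⟨-t, ?_⟩
      rw [map_sub]; push_cast at ht; linarith
    choose t ht using h3
    -- Frame vectors correct the difference to an element of the kernel without changing its
    -- products with the kernel.
    have hmem : (y c.out - y d.out) - ∑ i, t i • e i ∈ LinearMap.ker (frameMap B e) := by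
      rw [mem_ker_frameMap]
      intro i
      rw [map_sub, he.apply_sum, ht, sub_self]
    rw [← Submodule.Quotient.mk_out c, ← Submodule.Quotient.mk_out d, Submodule.Quotient.eq]
    refine ⟨b.repr ⟨_, hmem⟩, ?_⟩
    ext i
    have h4 : B (b i) ((y c.out - y d.out) - ∑ i, t i • e i) =
        ∑ l, b.repr ⟨_, hmem⟩ l * B (b i) (b l) := by
      have h0 := congrArg (fun z : LinearMap.ker (frameMap B e) => B (b i) (z : E))
        (b.sum_repr ⟨_, hmem⟩)
      simp only [Submodule.coe_sum, Submodule.coe_smul, map_sum, map_smul, smul_eq_mul] at h0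
      simpa only [map_sum, map_smul, smul_eq_mul] using h0.symm
    have h5 : ∀ l, B (b i) (e l) = 0 := fun l => by
      rw [hB.symm]; exact (mem_ker_frameMap e _).1 (b i).2 l
    simp only [Matrix.toLin'_apply, Matrix.mulVec, dotProduct, hG, Matrix.of_apply, Pi.sub_apply]
    rw [← hy c.out i, ← hy d.out i, hB.symm _ (b i : E), hB.symm _ (b i : E), ← map_sub]
    simp only [map_sub, map_sum, map_smul, h5] at h4
    rw [map_sub]
    simp_rw [mul_comm (B _ _)]
    rw [← h4]; simp
  have := Nat.card_le_card_of_injective par hpar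
  simpa using this

variable [Module.Free ℤ E]

/-- Without roots the complement, of rank n = 8 - k, has minimum at least 4, so Hermite gives 4ⁿ ≤
(4/3)^(n(n-1)/2) D. This contradicts D ≤ 2ⁿ for small n and D ≤ 2ᵏ for large n; neither bound alone
suffices for every k. -/
theorem IsFrame.exists_root_orthogonal (hB : IsEvenUnimodular8 B) {k : ℕ} (hk : k < 8)
    {e : Fin k → E} (he : IsFrame B e) : ∃ r, B r r = 2 ∧ ∀ i, B (e i) r = 0 := by
  by_contra! hno
  have hrank : Module.finrank ℤ (LinearMap.ker (frameMap B e)) = 8 - k := by have := he.finrank_ker hB; omega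
  let BK : LinearMap.ker (frameMap B e) →ₗ[ℤ] LinearMap.ker (frameMap B e) →ₗ[ℤ] ℚ :=
    (B.compl₁₂ (Submodule.subtype _) (Submodule.subtype _)).compr₂ (Int.castAddHom ℚ).toIntLinearMap
  have hBK : ∀ x y, BK x y = (B x y : ℚ) := fun _ _ => rfl
  obtain ⟨b, hb⟩ := hermite_bound (8 - k) _ hrank BK
    (fun x y => by rw [hBK, hBK, hB.symm])
    (fun x hx => by
      rw [hBK]; exact_mod_cast hB.pos x (fun h => hx (Subtype.ext h)))
    1 one_pos (fun x y => ⟨B x y, by rw [hBK]; simp⟩) 4 (by norm_num)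
    (fun x hx => by
      have h1 := hB.pos x (fun h => hx (Subtype.ext h))
      have h2 : B x x ≠ 2 := fun h => by
        obtain ⟨i, hi⟩ := hno x h
        exact hi ((mem_ker_frameMap e _).1 x.2 i)
      obtain ⟨t, ht⟩ := hB.even x
      rw [hBK]
      have : 4 ≤ B (x : E) x := by omega
      exact_mod_cast this)
  have hdet : (Matrix.of fun i j => BK (b i) (b j)).det =
      (((Matrix.of fun i j => B (b i) (b j)).det : ℤ) : ℚ) := by
    rw [Int.cast_det]; rfl
  rw [hdet] at hb
  obtain ⟨D, hDdef⟩ : ∃ D, D = (Matrix.of fun i j => B (b i) (b j)).det := ⟨_, rfl⟩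
  rw [← hDdef] at hb
  have hD : 0 < D := by
    by_contra hD
    have h1 : ((4 / 3 : ℚ) ^ ((8 - k) * (8 - k - 1) / 2) * (D : ℚ)) ≤ 0 :=
      mul_nonpos_of_nonneg_of_nonpos (by positivity) (by exact_mod_cast not_lt.1 hD)
    have h2 : (0 : ℚ) < 4 ^ (8 - k) := by positivity
    linarith
  have hD1 : D ≤ 2 ^ (8 - k) := Int.le_of_dvd (by positivity) (hDdef ▸ he.det_dvd hB b)
  have hD2 : D ≤ 2 ^ k := by
    have h := he.natAbs_det_le hB b (hDdef ▸ hD.ne')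
    rw [← hDdef] at h
    have h' : ((D.natAbs : ℕ) : ℤ) ≤ ((2 ^ k : ℕ) : ℤ) := Int.ofNat_le.2 h
    rw [Int.natAbs_of_nonneg hD.le] at h'
    simpa using h'
  have hD1' : (D : ℚ) ≤ 2 ^ (8 - k) := by exact_mod_cast hD1
  have hD2' : (D : ℚ) ≤ 2 ^ k := by exact_mod_cast hD2
  clear hDdef hdet b BK hBK
  interval_cases k <;> norm_num at hb hD1' hD2' <;> linarith

theorem IsFrame.exists_extension (hB : IsEvenUnimodular8 B) (l : ℕ) : ∀ {k : ℕ} (hk : k + l = 8)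
    {e : Fin k → E}, IsFrame B e → ∃ f : Fin 8 → E, IsFrame B f ∧
      ∀ i : Fin k, f (Fin.castLE (by omega) i) = e i := by
  induction l with
  | zero =>
    intro k hk e he
    obtain rfl : k = 8 := by omega
    exact ⟨e, he, fun i => rfl⟩
  | succ l ih =>
    intro k hk e he
    obtain ⟨r, hr, h⟩ := he.exists_root_orthogonal hB (by omega)
    obtain ⟨f, hf, hfe⟩ := ih (by omega) (he.snoc hB.symm hr h)
    refine ⟨f, hf, fun i => ?_⟩
    have := hfe i.castSucc
    rw [Fin.snoc_castSucc] at this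
    rw [← this]; rfl

end Frame

theorem exists_functional_of_dvd {E : Type*} [AddCommGroup E] (φ : E →ₗ[ℤ] ℤ) {k : ℤ}
    (hk : k ≠ 0) (h : ∀ x, k ∣ φ x) : ∃ ψ : E →ₗ[ℤ] ℤ, ∀ x, φ x = k * ψ x := by
  choose ψ hψ using h
  refine ⟨{ toFun := ψ, map_add' := fun x y => ?_, map_smul' := fun c x => ?_ }, hψ⟩
  · apply mul_left_cancel₀ hk
    rw [← hψ, map_add, hψ, hψ, mul_add]
  · apply mul_left_cancel₀ hk
    rw [← hψ, map_smul, hψ]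
    simp only [smul_eq_mul, RingHom.id_apply]; ring

/-! ### The binary code of half sums of a full frame -/

section FullFrame

variable {E : Type*} [AddCommGroup E] {B : LinearMap.BilinForm ℤ E}

theorem IsFrame.comp_perm {k : ℕ} {e : Fin k → E} (he : IsFrame B e) (σ : Equiv.Perm (Fin k)) :
    IsFrame B (e ∘ σ) := fun i j => by simp [he _ _]

theorem IsFrame.two_mul_inner {e : Fin 8 → E} (he : IsFrame B e)
    {f g : E} {c d : Fin 8 → ℤ}
    (hf : (2 : ℤ) • f = ∑ i, c i • e i) (hg : (2 : ℤ) • g = ∑ i, d i • e i) :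
    2 * B f g = ∑ i, c i * d i := by
  have h1 : B ((2 : ℤ) • f) ((2 : ℤ) • g) = ∑ i, c i * (2 * d i) := by
    rw [hf, hg]
    simp only [map_sum, LinearMap.sum_apply, map_smul, LinearMap.smul_apply, smul_eq_mul, he _ _]
    refine Finset.sum_congr rfl fun i _ => ?_
    simp; ring
  simp only [map_smul, LinearMap.smul_apply, smul_eq_mul] at h1
  have h2 : ∑ i, c i * (2 * d i) = 2 * ∑ i, c i * d i := by
    rw [Finset.mul_sum]; exact Finset.sum_congr rfl fun i _ => by ring
  linarith

/-- For coefficients 0 and 1 this says that the words of the code have weight divisible by 4. -/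
theorem IsFrame.four_dvd (hB : IsEvenUnimodular8 B) {e : Fin 8 → E} (he : IsFrame B e)
    {d : Fin 8 → ℤ} {f : E} (h : (2 : ℤ) • f = ∑ i, d i • e i) : 4 ∣ ∑ i, d i * d i := by
  have h1 := he.two_mul_inner h h
  obtain ⟨t, ht⟩ := hB.even f
  exact ⟨t, by omega⟩

theorem sum_extend_smul {A : Type*} [AddCommGroup A] (s : Fin 4 → Fin 8) (c : Fin 4 → ℤ)
    (u : Fin 8 → A) :
    ∑ i, (∑ a, if s a = i then c a else 0) • u i = ∑ a, c a • u (s a) := by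
  simp only [Finset.sum_smul, ite_smul, zero_smul]
  rw [Finset.sum_comm]
  simp

variable [Module.Free ℤ E]

theorem two_smul_injective {x y : E} (h : (2 : ℤ) • x = (2 : ℤ) • y) : x = y :=
  smul_right_injective _ (two_ne_zero (α := ℤ)) h

variable [Module.Finite ℤ E]

theorem IsFrame.two_smul_eq_sum (hB : IsEvenUnimodular8 B) {e : Fin 8 → E} (he : IsFrame B e)
    (x : E) : (2 : ℤ) • x = ∑ i, B (e i) x • e i := by
  have h := he.finrank_ker hB
  have h0 : Module.finrank ℤ (LinearMap.ker (frameMap B e)) = 0 := by omega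
  have := Module.finrank_zero_iff.1 h0
  have h1 : (⟨_, he.two_smul_sub_mem_ker x⟩ : LinearMap.ker (frameMap B e)) = 0 :=
    Subsingleton.elim _ _
  exact sub_eq_zero.1 (congrArg Subtype.val h1)

theorem IsFrame.ext (hB : IsEvenUnimodular8 B) {e : Fin 8 → E} (he : IsFrame B e)
    {x y : E} (h : ∀ i, B (e i) x = B (e i) y) : x = y := by
  apply two_smul_injective
  rw [he.two_smul_eq_sum hB, he.two_smul_eq_sum hB]
  simp_rw [h]

/-- Self-duality of the code: if `d` is orthogonal modulo two to all coordinate vectors, then half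
of its pairing is an integral functional, represented by some `f` by unimodularity. -/
theorem IsFrame.exists_half (hB : IsEvenUnimodular8 B) {e : Fin 8 → E} (he : IsFrame B e)
    (d : Fin 8 → ℤ) (h : ∀ x, 2 ∣ ∑ i, d i * B (e i) x) :
    ∃ f, (2 : ℤ) • f = ∑ i, d i • e i := by
  obtain ⟨ψ, hψ⟩ := exists_functional_of_dvd (∑ i, d i • B (e i)) (k := 2) two_ne_zero
    (fun x => by simpa using h x)
  obtain ⟨f, hf⟩ := hB.unimodular ψ
  refine ⟨f, he.ext hB fun i => ?_⟩
  rw [he.apply_sum, map_smul, hB.symm, smul_eq_mul, hf, ← hψ]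
  simp [he _ i]; ring

theorem IsFrame.four_dvd' (hB : IsEvenUnimodular8 B) {e : Fin 8 → E} (he : IsFrame B e)
    (x : E) : 4 ∣ ∑ i, B (e i) x * B (e i) x :=
  he.four_dvd hB (he.two_smul_eq_sum hB x)

/-- The all-one word is orthogonal to the code, because n² ≡ n modulo 2 and the sum of the squared
coordinates is even. -/
theorem IsFrame.exists_half_sum (hB : IsEvenUnimodular8 B) {e : Fin 8 → E} (he : IsFrame B e) :
    ∃ f, (2 : ℤ) • f = ∑ i, e i := by
  obtain ⟨f, hf⟩ := he.exists_half hB (fun _ => 1) (fun x => by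
    have h1 := he.four_dvd' hB x
    have h2 : ∀ i, ∃ t, B (e i) x * B (e i) x = B (e i) x + 2 * t := fun i => by
      obtain ⟨t, ht⟩ := Int.even_mul_succ_self (B (e i) x)
      exact ⟨t - B (e i) x, by linarith⟩
    choose t ht using h2
    simp_rw [ht, Finset.sum_add_distrib, ← Finset.mul_sum] at h1
    simp only [one_mul]
    omega)
  exact ⟨f, by simpa using hf⟩

/-- Subtracting frame vectors reduces the coordinates modulo two. -/
theorem IsFrame.exists_reduce (hB : IsEvenUnimodular8 B) {e : Fin 8 → E} (he : IsFrame B e)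
    (x : E) : ∃ f, (2 : ℤ) • f = ∑ i, (B (e i) x % 2) • e i := by
  refine ⟨x - ∑ i, (B (e i) x / 2) • e i, ?_⟩
  rw [smul_sub, he.two_smul_eq_sum hB, Finset.smul_sum, ← Finset.sum_sub_distrib]
  refine Finset.sum_congr rfl fun i _ => ?_
  rw [smul_smul, ← sub_smul]
  congr 1
  omega

/-- If the parities at four positions did not fill 𝔽₂⁴, a linear relation among them would by
`exists_half` be a nonzero word supported there. Its weight is divisible by 4, so it would be the
word excluded by `hno`. -/
theorem IsFrame.exists_separating (hB : IsEvenUnimodular8 B) {e : Fin 8 → E} (he : IsFrame B e)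
    (s : Fin 4 → Fin 8) (hs : Function.Injective s)
    (hno : ∀ f, (2 : ℤ) • f ≠ ∑ a, e (s a)) (v : Fin 4 → ZMod 2) :
    ∃ x, ∀ a, (B (e (s a)) x : ZMod 2) = v a := by
  let g : E →+ (Fin 4 → ZMod 2) :=
    { toFun := fun x a => (B (e (s a)) x : ZMod 2)
      map_zero' := by ext; simp
      map_add' := fun x y => by ext; simp }
  by_contra! hv
  have hvn : v ∉ AddSubgroup.toZModSubmodule 2 g.range := by
    rintro ⟨x, hx⟩
    obtain ⟨a, ha⟩ := hv x
    exact ha (congrFun hx a)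
  obtain ⟨φ, hφv, hφ⟩ := Submodule.exists_le_ker_of_notMem hvn
  let c : Fin 4 → ℤ := fun a => ((φ (Pi.single a 1)).val : ℤ)
  have hc : ∀ a, ((c a : ℤ) : ZMod 2) = φ (Pi.single a 1) := fun a => by simp [c]
  have hφs : ∀ w, φ w = ∑ a, w a * φ (Pi.single a 1) := fun w => by
    conv_lhs => rw [pi_eq_sum_univ' w]
    simp [map_sum, map_smul]
  let d : Fin 8 → ℤ := fun i => ∑ a, if s a = i then c a else 0
  obtain ⟨f, hf⟩ := he.exists_half hB d (fun x => by
    have h1 := sum_extend_smul s c (fun i => B (e i) x)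
    simp only [smul_eq_mul] at h1
    change 2 ∣ ∑ i, (∑ a, if s a = i then c a else 0) * B (e i) x
    rw [h1]
    have h2 : g x ∈ AddSubgroup.toZModSubmodule 2 g.range := ⟨x, rfl⟩
    have h3 : φ (g x) = 0 := LinearMap.mem_ker.1 (hφ h2)
    have h4 : ((∑ a, c a * B (e (s a)) x : ℤ) : ZMod 2) = 0 := by
      rw [← h3, hφs]
      push_cast
      refine Finset.sum_congr rfl fun a _ => ?_
      rw [hc, mul_comm]; rfl
    exact (ZMod.intCast_zmod_eq_zero_iff_dvd _ 2).1 h4)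
  have h4 := he.four_dvd hB hf
  have hdd := sum_extend_smul s c d
  simp only [smul_eq_mul] at hdd
  have hds : ∀ a, d (s a) = c a := fun a => by simp [d, hs.eq_iff]
  simp_rw [hds] at hdd
  change 4 ∣ ∑ i, (∑ a, if s a = i then c a else 0) * d i at h4
  rw [hdd] at h4
  have hc01 : ∀ a, c a = 0 ∨ c a = 1 := fun a => by
    have := ZMod.val_lt (φ (Pi.single a 1))
    simp only [c]; omega
  have hc0 : ∃ a, c a ≠ 0 := by
    by_contra! h
    apply hφv
    rw [hφs]
    refine Finset.sum_eq_zero fun a _ => ?_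
    rw [← hc, h]; simp
  have hc1 : ∀ a, c a = 1 := by
    rw [Fin.sum_univ_four] at h4
    obtain ⟨a0, ha0⟩ := hc0
    have key : ∀ a b c d : ℤ, (a = 0 ∨ a = 1) → (b = 0 ∨ b = 1) → (c = 0 ∨ c = 1) →
        (d = 0 ∨ d = 1) → 4 ∣ a * a + b * b + c * c + d * d →
        (a ≠ 0 ∨ b ≠ 0 ∨ c ≠ 0 ∨ d ≠ 0) → a = 1 ∧ b = 1 ∧ c = 1 ∧ d = 1 := by
      rintro a b c d (rfl | rfl) (rfl | rfl) (rfl | rfl) (rfl | rfl) <;> norm_num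
    have h0 : c 0 ≠ 0 ∨ c 1 ≠ 0 ∨ c 2 ≠ 0 ∨ c 3 ≠ 0 := by
      fin_cases a0
      exacts [Or.inl ha0, Or.inr (Or.inl ha0), Or.inr (Or.inr (Or.inl ha0)),
        Or.inr (Or.inr (Or.inr ha0))]
    obtain ⟨k0, k1, k2, k3⟩ := key _ _ _ _ (hc01 0) (hc01 1) (hc01 2) (hc01 3) h4 h0
    intro a
    fin_cases a
    exacts [k0, k1, k2, k3]
  apply hno f
  rw [hf]
  change ∑ i, (∑ a, if s a = i then c a else 0) • e i = _
  rw [sum_extend_smul]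
  simp [hc1]

/-- Any three positions lie in a word of weight 4. Either {i, j, k, l} is one, or some word contains
i, j, k and misses l; its weight lies between 3 and 7 and is divisible by 4. -/
theorem IsFrame.exists_fourth (hB : IsEvenUnimodular8 B) {e : Fin 8 → E} (he : IsFrame B e)
    {i j k : Fin 8} (hij : i ≠ j) (hik : i ≠ k) (hjk : j ≠ k) :
    ∃ l, l ≠ i ∧ l ≠ j ∧ l ≠ k ∧ ∃ f, (2 : ℤ) • f = e i + e j + e k + e l := by
  obtain ⟨l, hli, hlj, hlk⟩ : ∃ l, l ≠ i ∧ l ≠ j ∧ l ≠ k := by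
    revert i j k; decide
  by_cases h : ∃ f, (2 : ℤ) • f = e i + e j + e k + e l
  · exact ⟨l, hli, hlj, hlk, h⟩
  have hinj : Function.Injective ![i, j, k, l] := by
    intro a b
    fin_cases a <;> fin_cases b <;> simp_all [eq_comm]
  obtain ⟨x, hx⟩ := he.exists_separating hB ![i, j, k, l] hinj
    (fun f hf => h ⟨f, by simpa [Fin.sum_univ_four] using hf⟩) ![1, 1, 1, 0]
  obtain ⟨f, hf⟩ := he.exists_reduce hB x
  have h4 := he.four_dvd hB hf
  set c : Fin 8 → ℤ := fun i => B (e i) x % 2 with hc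
  have hodd : ∀ n : ℤ, (n : ZMod 2) = 1 → n % 2 = 1 := fun n hn => by
    have : ((n - 1 : ℤ) : ZMod 2) = 0 := by push_cast; rw [hn, sub_self]
    have := (ZMod.intCast_zmod_eq_zero_iff_dvd _ 2).1 this
    push_cast at this; omega
  have hci : c i = 1 := hodd _ (by simpa using hx 0)
  have hcj : c j = 1 := hodd _ (by simpa using hx 1)
  have hck : c k = 1 := hodd _ (by simpa using hx 2)
  have hcl : c l = 0 := by
    have := (ZMod.intCast_zmod_eq_zero_iff_dvd _ 2).1 (by simpa using hx 3 : (B (e l) x : ZMod 2) = 0)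
    push_cast at this
    simp only [hc]; omega
  have hc01 : ∀ m, c m = 0 ∨ c m = 1 := fun m => by simp only [hc]; omega
  have hcard : ∑ m, c m * c m = ((Finset.univ.filter fun m => c m = 1).card : ℤ) := by
    rw [Finset.card_filter]
    push_cast
    refine Finset.sum_congr rfl fun m _ => ?_
    rcases hc01 m with h | h <;> simp [h]
  change 4 ∣ ∑ m, c m * c m at h4
  rw [hcard] at h4
  have hsub : ({i, j, k} : Finset (Fin 8)) ⊆ Finset.univ.filter fun m => c m = 1 := by
    intro m hm
    simp only [Finset.mem_insert, Finset.mem_singleton] at hm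
    rw [Finset.mem_filter]
    rcases hm with rfl | rfl | rfl
    exacts [⟨Finset.mem_univ _, hci⟩, ⟨Finset.mem_univ _, hcj⟩, ⟨Finset.mem_univ _, hck⟩]
  have h3 : ({i, j, k} : Finset (Fin 8)).card = 3 := by simp [hij, hik, hjk]
  have hle := Finset.card_le_card hsub
  have hlt : (Finset.univ.filter fun m => c m = 1).card < 8 := by
    have : (Finset.univ.filter fun m => c m = 1) ⊂ Finset.univ := by
      rw [Finset.filter_ssubset]
      exact ⟨l, Finset.mem_univ _, by simp [hcl]⟩
    simpa using Finset.card_lt_card this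
  have h4' : (Finset.univ.filter fun m => c m = 1).card = 4 := by omega
  obtain ⟨m, hm⟩ : ∃ m, (Finset.univ.filter fun m => c m = 1) \ {i, j, k} = {m} := by
    rw [← Finset.card_eq_one, Finset.card_sdiff_of_subset hsub]; omega
  have hm' : m ∈ (Finset.univ.filter fun m => c m = 1) \ {i, j, k} := by rw [hm]; simp
  simp only [Finset.mem_sdiff, Finset.mem_filter, Finset.mem_univ, true_and, Finset.mem_insert,
    Finset.mem_singleton, not_or] at hm'
  refine ⟨m, hm'.2.1, hm'.2.2.1, hm'.2.2.2, f, ?_⟩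
  rw [hf]
  have h5 : ∑ n, (B (e n) x % 2) • e n = ∑ n ∈ Finset.univ.filter (fun m => c m = 1), e n := by
    rw [Finset.sum_filter]
    refine Finset.sum_congr rfl fun n _ => ?_
    change c n • e n = _
    rcases hc01 n with h | h <;> simp [h]
  rw [h5, ← Finset.sum_sdiff hsub, hm, Finset.sum_singleton, Finset.sum_insert (by simp [hij, hik]),
    Finset.sum_insert (by simp [hjk]), Finset.sum_singleton]
  abel

end FullFrame

/-! ### The Hamming code and the uniqueness of `E₈` -/

section Hamming

variable {E : Type*} [AddCommGroup E] {B : LinearMap.BilinForm ℤ E}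

/-- Generators of the Hamming code of length eight. -/
def hammingGen : Fin 4 → Fin 8 → ℤ :=
  ![![1, 1, 1, 1, 0, 0, 0, 0], ![1, 1, 0, 0, 1, 1, 0, 0], ![1, 0, 1, 0, 1, 0, 1, 0],
    ![1, 1, 1, 1, 1, 1, 1, 1]]

/-- The coordinates of simple roots of `E₈` with respect to half the vectors of a frame. -/
def simpleCoord : Fin 8 → Fin 8 → ℤ :=
  ![![0, 1, -1, 0, -1, 0, 0, -1], ![0, 0, 0, 0, 0, 0, 2, 0], ![0, 0, 0, 0, 0, 0, 0, 2],
    ![0, 0, 0, 0, 1, -1, -1, -1], ![0, 0, 0, 0, 0, 2, 0, 0], ![0, 0, 1, -1, -1, -1, 0, 0],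
    ![0, 0, 0, 2, 0, 0, 0, 0], ![1, -1, -1, -1, 0, 0, 0, 0]]

/-- The integral part of `simpleCoord`. -/
def simpleInt : Fin 8 → Fin 8 → ℤ :=
  ![![-2, -1, -2, -1, -2, -1, -1, -1], ![0, 0, 0, 0, 0, 0, 1, 0], ![0, 0, 0, 0, 0, 0, 0, 1],
    ![-1, -1, -1, -1, 0, -1, -1, -1], ![0, 0, 0, 0, 0, 1, 0, 0], ![-1, -1, 0, -1, -1, -1, 0, 0],
    ![0, 0, 0, 1, 0, 0, 0, 0], ![0, -1, -1, -1, 0, 0, 0, 0]]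

/-- The half-integral part of `simpleCoord`. -/
def simpleHalf : Fin 8 → Fin 4 → ℤ :=
  ![![1, 1, 1, 1], ![0, 0, 0, 0], ![0, 0, 0, 0], ![1, 0, 0, 1], ![0, 0, 0, 0], ![1, 1, 0, 0],
    ![0, 0, 0, 0], ![1, 0, 0, 0]]

/-- The coordinates of the frame with respect to the simple roots. -/
def frameCoord : Fin 8 → Fin 8 → ℤ :=
  ![![2, 3, 4, 6, 5, 4, 3, 2], ![2, 2, 3, 4, 3, 2, 1, 0], ![0, 1, 1, 2, 2, 2, 1, 0],
    ![0, 0, 0, 0, 0, 0, 1, 0], ![0, 1, 1, 2, 1, 0, 0, 0], ![0, 0, 0, 0, 1, 0, 0, 0],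
    ![0, 1, 0, 0, 0, 0, 0, 0], ![0, 0, 1, 0, 0, 0, 0, 0]]

theorem simpleCoord_eq (i j : Fin 8) : simpleCoord i j =
    2 * simpleInt i j + ∑ l, simpleHalf i l * hammingGen l j := by
  revert i j; decide

theorem frameCoord_mul (i j : Fin 8) :
    ∑ k, frameCoord i k * simpleCoord k j = if i = j then 2 else 0 := by
  revert i j; decide

theorem simpleCoord_inner (i j : Fin 8) :
    ∑ k, simpleCoord i k * simpleCoord j k = 2 * CartanMatrix.E₈ i j := by
  revert i j; decide

/-- A frame together with half sums according to the Hamming code. -/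
structure IsHammingFrame (B : LinearMap.BilinForm ℤ E) (e : Fin 8 → E) (f : Fin 4 → E) :
    Prop where
  frame : IsFrame B e
  half : ∀ l, (2 : ℤ) • f l = ∑ j, hammingGen l j • e j

variable [Module.Free ℤ E] [Module.Finite ℤ E]

/-- Complete the triples 012, 014, 024 to words of weight 4 and permute the new positions to 3, 5,
6. The first three roots stay in place, which later gives transitivity on roots and on orthogonal
pairs. -/
theorem IsFrame.exists_hamming (hB : IsEvenUnimodular8 B) {e : Fin 8 → E} (he : IsFrame B e) :
    ∃ e' f, IsHammingFrame B e' f ∧ e' 0 = e 0 ∧ e' 1 = e 1 ∧ e' 2 = e 2 := by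
  obtain ⟨l, hl0, hl1, hl2, f₁, hf₁⟩ := he.exists_fourth hB (i := 0) (j := 1) (k := 2)
    (by decide) (by decide) (by decide)
  have ha := he.comp_perm (Equiv.swap 3 l)
  obtain ⟨a, ha_def⟩ : ∃ a, a = e ∘ Equiv.swap 3 l := ⟨_, rfl⟩
  rw [← ha_def] at ha
  have ha0 : a 0 = e 0 := by
    rw [ha_def, Function.comp_apply, Equiv.swap_apply_of_ne_of_ne (by decide) hl0.symm]
  have ha1 : a 1 = e 1 := by
    rw [ha_def, Function.comp_apply, Equiv.swap_apply_of_ne_of_ne (by decide) hl1.symm]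
  have ha2 : a 2 = e 2 := by
    rw [ha_def, Function.comp_apply, Equiv.swap_apply_of_ne_of_ne (by decide) hl2.symm]
  have ha3 : a 3 = e l := by rw [ha_def, Function.comp_apply, Equiv.swap_apply_left]
  rw [← ha0, ← ha1, ← ha2, ← ha3] at hf₁
  rw [← ha0, ← ha1, ← ha2]
  clear ha0 ha1 ha2 ha3 ha_def hl0 hl1 hl2
  obtain ⟨l', hl0, hl1, hl4, f₂, hf₂⟩ := ha.exists_fourth hB (i := 0) (j := 1) (k := 4)
    (by decide) (by decide) (by decide)
  -- Two words meet in an even number of positions; here they would meet in three.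
  have hl23 : l' ≠ 2 ∧ l' ≠ 3 := by
    constructor
    · rintro rfl
      have := ha.two_mul_inner (f := f₁) (g := f₂) (c := ![1, 1, 1, 1, 0, 0, 0, 0])
        (d := ![1, 1, 1, 0, 1, 0, 0, 0])
        (by rw [hf₁]; simp [Fin.sum_univ_eight])
        (by rw [hf₂]; simp [Fin.sum_univ_eight]; abel)
      simp [Fin.sum_univ_eight] at this
      omega
    · rintro rfl
      have := ha.two_mul_inner (f := f₁) (g := f₂) (c := ![1, 1, 1, 1, 0, 0, 0, 0])
        (d := ![1, 1, 0, 1, 1, 0, 0, 0])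
        (by rw [hf₁]; simp [Fin.sum_univ_eight])
        (by rw [hf₂]; simp [Fin.sum_univ_eight]; abel)
      simp [Fin.sum_univ_eight] at this
      omega
  have hb := ha.comp_perm (Equiv.swap 5 l')
  obtain ⟨b, hb_def⟩ : ∃ b, b = a ∘ Equiv.swap 5 l' := ⟨_, rfl⟩
  rw [← hb_def] at hb
  have hbj : ∀ j, j ≠ 5 → j ≠ l' → b j = a j := fun j h5 hj => by
    rw [hb_def, Function.comp_apply, Equiv.swap_apply_of_ne_of_ne h5 hj]
  have hb5 : b 5 = a l' := by rw [hb_def, Function.comp_apply, Equiv.swap_apply_left]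
  rw [← hb5, ← hbj 4 (by decide) hl4.symm] at hf₂
  rw [← hbj 2 (by decide) hl23.1.symm, ← hbj 3 (by decide) hl23.2.symm] at hf₁
  rw [← hbj 2 (by decide) hl23.1.symm]
  rw [← hbj 0 (by decide) hl0.symm, ← hbj 1 (by decide) hl1.symm] at hf₁ hf₂ ⊢
  clear hbj hb5 hb_def hl0 hl1 hl4 hl23 ha he
  obtain ⟨m, hm0, hm2, hm4, f₃, hf₃⟩ := hb.exists_fourth hB (i := 0) (j := 2) (k := 4)
    (by decide) (by decide) (by decide)
  have hm135 : m ≠ 1 ∧ m ≠ 3 ∧ m ≠ 5 := by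
    refine ⟨?_, ?_, ?_⟩
    · rintro rfl
      have := hb.two_mul_inner (f := f₁) (g := f₃) (c := ![1, 1, 1, 1, 0, 0, 0, 0])
        (d := ![1, 1, 1, 0, 1, 0, 0, 0])
        (by rw [hf₁]; simp [Fin.sum_univ_eight])
        (by rw [hf₃]; simp [Fin.sum_univ_eight]; abel)
      simp [Fin.sum_univ_eight] at this
      omega
    · rintro rfl
      have := hb.two_mul_inner (f := f₁) (g := f₃) (c := ![1, 1, 1, 1, 0, 0, 0, 0])
        (d := ![1, 0, 1, 1, 1, 0, 0, 0])
        (by rw [hf₁]; simp [Fin.sum_univ_eight])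
        (by rw [hf₃]; simp [Fin.sum_univ_eight]; abel)
      simp [Fin.sum_univ_eight] at this
      omega
    · rintro rfl
      have := hb.two_mul_inner (f := f₂) (g := f₃) (c := ![1, 1, 0, 0, 1, 1, 0, 0])
        (d := ![1, 0, 1, 0, 1, 1, 0, 0])
        (by rw [hf₂]; simp [Fin.sum_univ_eight])
        (by rw [hf₃]; simp [Fin.sum_univ_eight])
      simp [Fin.sum_univ_eight] at this
      omega
  have hc := hb.comp_perm (Equiv.swap 6 m)
  obtain ⟨c, hc_def⟩ : ∃ c, c = b ∘ Equiv.swap 6 m := ⟨_, rfl⟩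
  rw [← hc_def] at hc
  have hcj : ∀ j, j ≠ 6 → j ≠ m → c j = b j := fun j h5 hj => by
    rw [hc_def, Function.comp_apply, Equiv.swap_apply_of_ne_of_ne h5 hj]
  have hc6 : c 6 = b m := by rw [hc_def, Function.comp_apply, Equiv.swap_apply_left]
  obtain ⟨f₄, hf₄⟩ := hc.exists_half_sum hB
  refine ⟨c, ![f₁, f₂, f₃, f₄], ⟨hc, fun l => ?_⟩, hcj 0 (by decide) hm0.symm,
    hcj 1 (by decide) hm135.1.symm, hcj 2 (by decide) hm2.symm⟩
  rw [← hcj 0 (by decide) hm0.symm, ← hcj 4 (by decide) hm4.symm] at *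
  rw [← hcj 1 (by decide) hm135.1.symm] at hf₁ hf₂
  rw [← hcj 2 (by decide) hm2.symm] at hf₁ hf₃
  rw [← hcj 3 (by decide) hm135.2.1.symm] at hf₁
  rw [← hcj 5 (by decide) hm135.2.2.symm] at hf₂
  rw [← hc6] at hf₃
  fin_cases l
  · simpa [Fin.sum_univ_eight, hammingGen] using hf₁
  · simpa [Fin.sum_univ_eight, hammingGen] using hf₂
  · simpa [Fin.sum_univ_eight, hammingGen] using hf₃
  · simpa [Fin.sum_univ_eight, hammingGen] using hf₄

omit [Module.Finite ℤ E] in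
-- Simple roots have half-integral coordinates in the frame; those halves are words of the Hamming
-- code, so the roots lie in `E`.
theorem IsHammingFrame.exists_simple {e : Fin 8 → E} {f : Fin 4 → E}
    (h : IsHammingFrame B e f) : ∃ α : Fin 8 → E,
      (∀ i j, B (α i) (α j) = CartanMatrix.E₈ i j) ∧
      ∀ i, e i = ∑ k, frameCoord i k • α k := by
  let α : Fin 8 → E := fun i => ∑ j, simpleInt i j • e j + ∑ l, simpleHalf i l • f l
  have hα : ∀ i, (2 : ℤ) • α i = ∑ j, simpleCoord i j • e j := by
    intro i
    have h1 : (2 : ℤ) • ∑ l, simpleHalf i l • f l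
        = ∑ j, (∑ l, simpleHalf i l * hammingGen l j) • e j := by
      simp_rw [Finset.smul_sum, smul_comm (2 : ℤ), h.half, Finset.smul_sum, Finset.sum_smul,
        mul_smul]
      rw [Finset.sum_comm]
    simp only [α]
    rw [smul_add, h1, Finset.smul_sum, ← Finset.sum_add_distrib]
    refine Finset.sum_congr rfl fun j _ => ?_
    rw [simpleCoord_eq, add_smul, mul_smul]
  refine ⟨α, fun i j => ?_, fun i => two_smul_injective ?_⟩
  · have := h.frame.two_mul_inner (hα i) (hα j)
    rw [simpleCoord_inner] at this
    omega
  · simp_rw [Finset.smul_sum, smul_comm (2 : ℤ), hα, Finset.smul_sum, ← mul_smul]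
    rw [Finset.sum_comm]
    simp_rw [← Finset.sum_smul, frameCoord_mul]
    simp

/-- The positive definite `E₈` form. -/
def formE8 : LinearMap.BilinForm ℤ (Fin 8 → ℤ) := Matrix.toBilin' CartanMatrix.E₈

theorem formE8_apply (x y : Fin 8 → ℤ) :
    formE8 x y = ∑ i, ∑ j, x i * CartanMatrix.E₈ i j * y j := Matrix.toBilin'_apply _ _ _

/-- The simple roots form a basis because the Cartan matrix has determinant 1. The frame corresponds
to fixed vectors `frameCoord`, independent of `E`. -/
theorem IsHammingFrame.exists_equiv (hB : IsEvenUnimodular8 B) {e : Fin 8 → E} {f : Fin 4 → E}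
    (h : IsHammingFrame B e f) : ∃ g : (Fin 8 → ℤ) ≃ₗ[ℤ] E,
      (∀ x y, B (g x) (g y) = formE8 x y) ∧ ∀ i, g (frameCoord i) = e i := by
  obtain ⟨α, hα, he⟩ := h.exists_simple
  let g : (Fin 8 → ℤ) →ₗ[ℤ] E := Fintype.linearCombination ℤ α
  have hg : ∀ x, g x = ∑ i, x i • α i := fun x => rfl
  have hgB : ∀ x y, B (g x) (g y) = formE8 x y := by
    intro x y
    simp only [hg, formE8_apply, map_sum, LinearMap.sum_apply, map_smul, LinearMap.smul_apply,
      smul_eq_mul, hα]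
    rw [Finset.sum_comm]
    refine Finset.sum_congr rfl fun i _ => ?_
    rw [Finset.mul_sum]
    exact Finset.sum_congr rfl fun j _ => by ring
  have hdet : IsUnit CartanMatrix.E₈.det := by rw [CartanMatrix.E₈_det]; exact isUnit_one
  have hgα : ∀ i x, B (α i) (g x) = CartanMatrix.E₈.mulVec x i := by
    intro i x
    simp [hg, hα, Matrix.mulVec, dotProduct, mul_comm]
  have hinj : Function.Injective g := by
    rw [← LinearMap.ker_eq_bot, LinearMap.ker_eq_bot']
    intro x hx
    have h1 : CartanMatrix.E₈.mulVec x = 0 := by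
      ext i; rw [← hgα, hx]; simp
    have h2 := congrArg (CartanMatrix.E₈⁻¹).mulVec h1
    rwa [Matrix.mulVec_mulVec, Matrix.nonsing_inv_mul _ hdet, Matrix.one_mulVec,
      Matrix.mulVec_zero] at h2
  have hsurj : Function.Surjective g := by
    intro y
    refine ⟨(CartanMatrix.E₈⁻¹).mulVec fun i => B (α i) y, h.frame.ext hB fun i => ?_⟩
    rw [he i]
    simp only [map_sum, LinearMap.sum_apply, map_smul, LinearMap.smul_apply, hgα]
    rw [Matrix.mulVec_mulVec, Matrix.mul_nonsing_inv _ hdet, Matrix.one_mulVec]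
  refine ⟨LinearEquiv.ofBijective g ⟨hinj, hsurj⟩, hgB, fun i => ?_⟩
  rw [he]; rfl

theorem IsHammingFrame.eq_sum_simple (hB : IsEvenUnimodular8 B) {e : Fin 8 → E} {f : Fin 4 → E}
    (h : IsHammingFrame B e f) : ∃ α : Fin 8 → E, (∀ i, B (α i) (α i) = 2) ∧
      ∀ x, ∃ c : Fin 8 → ℤ, x = ∑ i, c i • α i := by
  obtain ⟨g, hg, -⟩ := h.exists_equiv hB
  refine ⟨fun i => g (Pi.single i 1), fun i => ?_, fun x => ⟨g.symm x, ?_⟩⟩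
  · rw [hg, formE8, Matrix.toBilin'_single]; simp
  · conv_lhs => rw [← g.apply_symm_apply x, pi_eq_sum_univ' (g.symm x)]
    rw [map_sum]
    refine Finset.sum_congr rfl fun i _ => ?_
    rw [← map_smul]

/-! ### Classes modulo two -/

/-- `x` is congruent modulo `2E` to zero, to a root, or to a sum of two orthogonal roots. -/
def HasShortRep (B : LinearMap.BilinForm ℤ E) (x : E) : Prop :=
  (∃ y, x = (2 : ℤ) • y) ∨ (∃ r y, B r r = 2 ∧ x = r + (2 : ℤ) • y) ∨
    ∃ r s y, B r r = 2 ∧ B s s = 2 ∧ B r s = 0 ∧ x = r + s + (2 : ℤ) • y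

omit [Module.Free ℤ E] [Module.Finite ℤ E] in
theorem HasShortRep.add_two_smul {x : E} (h : HasShortRep B x) (z : E) :
    HasShortRep B (x + (2 : ℤ) • z) := by
  obtain ⟨y, rfl⟩ | ⟨r, y, hr, rfl⟩ | ⟨r, s, y, hr, hs, hrs, rfl⟩ := h
  · exact Or.inl ⟨y + z, by rw [smul_add]⟩
  · exact Or.inr (Or.inl ⟨r, y + z, hr, by rw [smul_add, add_assoc]⟩)
  · exact Or.inr (Or.inr ⟨r, s, y + z, hr, hs, hrs, by rw [smul_add, add_assoc]⟩)

omit [Module.Free ℤ E] [Module.Finite ℤ E] in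
-- Positivity of `r + s` and `r - s` bounds the inner product of two roots by 2 in absolute value.
theorem root_inner_cases (hB : IsEvenUnimodular8 B) {r s : E} (hr : B r r = 2) (hs : B s s = 2) :
    s = r ∨ s = -r ∨ B r s = 0 ∨ B (r + s) (r + s) = 2 ∨ B (r - s) (r - s) = 2 := by
  have hsr := hB.symm s r
  have h1 : B (r + s) (r + s) = 4 + 2 * B r s := by
    simp only [map_add, LinearMap.add_apply]; omega
  have h2 : B (r - s) (r - s) = 4 - 2 * B r s := by
    simp only [map_sub, LinearMap.sub_apply]; omega
  by_cases h3 : r + s = 0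
  · exact Or.inr (Or.inl (eq_neg_of_add_eq_zero_right h3))
  by_cases h4 : r - s = 0
  · exact Or.inl (sub_eq_zero.1 h4).symm
  have h5 := hB.pos _ h3
  have h6 := hB.pos _ h4
  omega

omit [Module.Free ℤ E] [Module.Finite ℤ E] in
theorem hasShortRep_add_root_of_root (hB : IsEvenUnimodular8 B) {r s : E} (hr : B r r = 2)
    (hs : B s s = 2) : HasShortRep B (r + s) := by
  rcases root_inner_cases hB hr hs with rfl | rfl | h | h | h
  · exact Or.inl ⟨s, by rw [two_smul]⟩
  · exact Or.inl ⟨0, by simp⟩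
  · exact Or.inr (Or.inr ⟨r, s, 0, hr, hs, h, by simp⟩)
  · exact Or.inr (Or.inl ⟨r + s, 0, h, by simp⟩)
  · exact Or.inr (Or.inl ⟨r - s, s, h, by rw [two_smul]; abel⟩)

/-- A root that is not orthogonal to a summand is absorbed by it modulo two. Only three mutually
orthogonal roots need the code. -/
theorem HasShortRep.add_root (hB : IsEvenUnimodular8 B) {x r : E} (h : HasShortRep B x)
    (hr : B r r = 2) : HasShortRep B (x + r) := by
  obtain ⟨y, rfl⟩ | ⟨s, y, hs, rfl⟩ | ⟨s, t, y, hs, ht, hst, rfl⟩ := h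
  · exact Or.inr (Or.inl ⟨r, y, hr, by abel⟩)
  · have := (hasShortRep_add_root_of_root hB hs hr).add_two_smul y
    convert this using 1; abel
  · have key : HasShortRep B (s + t + r) := by
      rcases root_inner_cases hB hs hr with rfl | rfl | h | h | h
      · exact Or.inr (Or.inl ⟨t, r, ht, by rw [two_smul]; abel⟩)
      · exact Or.inr (Or.inl ⟨t, 0, ht, by simp⟩)
      · rcases root_inner_cases hB ht hr with rfl | rfl | h' | h' | h'
        · exact Or.inr (Or.inl ⟨s, r, hs, by rw [two_smul]; abel⟩)
        · exact Or.inr (Or.inl ⟨s, 0, hs, by simp⟩)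
        -- A word of weight 4 through `s`, `t`, `r` shows that their sum is congruent to the fourth
        -- root modulo two.
        · have hfr : IsFrame B ![s, t, r] := by
            intro i j
            fin_cases i <;> fin_cases j <;> simp [hs, ht, hr, hst, h, h', hB.symm t s, hB.symm r s,
              hB.symm r t]
          obtain ⟨e, he, hee⟩ := hfr.exists_extension hB 5 (by norm_num)
          obtain ⟨l, -, -, -, f, hf⟩ := he.exists_fourth hB (i := 0) (j := 1) (k := 2)
            (by decide) (by decide) (by decide)
          have h0 : e 0 = s := hee 0
          have h1 : e 1 = t := hee 1
          have h2 : e 2 = r := hee 2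
          rw [h0, h1, h2] at hf
          refine Or.inr (Or.inl ⟨e l, f - e l, by simpa using he l l, ?_⟩)
          rw [smul_sub, hf, two_smul]; abel
        · have := hasShortRep_add_root_of_root hB hs h'
          convert this using 1; abel
        · have := (hasShortRep_add_root_of_root hB hs h').add_two_smul r
          convert this using 1; rw [two_smul]; abel
      · have := hasShortRep_add_root_of_root hB ht h
        convert this using 1; abel
      · have := (hasShortRep_add_root_of_root hB ht h).add_two_smul r
        convert this using 1; rw [two_smul]; abel
    convert key.add_two_smul y using 1; abel

theorem HasShortRep.add_zsmul_root (hB : IsEvenUnimodular8 B) {x r : E} (h : HasShortRep B x)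
    (hr : B r r = 2) (c : ℤ) : HasShortRep B (x + c • r) := by
  obtain ⟨t, rfl | rfl⟩ := Int.even_or_odd' c
  · rw [mul_smul]; exact h.add_two_smul _
  · rw [add_smul, mul_smul, one_smul, ← add_assoc]
    exact (h.add_two_smul _).add_root hB hr

theorem IsEvenUnimodular8.exists_frame (hB : IsEvenUnimodular8 B) :
    ∃ e : Fin 8 → E, IsFrame B e := by
  obtain ⟨e, he, -⟩ := IsFrame.exists_extension hB 8 (k := 0) (by norm_num) (e := Fin.elim0)
    (fun i => i.elim0)
  exact ⟨e, he⟩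

/-- Roots generate the lattice, and short representatives survive adding roots. -/
theorem IsEvenUnimodular8.hasShortRep (hB : IsEvenUnimodular8 B) (x : E) : HasShortRep B x := by
  obtain ⟨e, he⟩ := hB.exists_frame
  obtain ⟨e', f, h, -⟩ := he.exists_hamming hB
  obtain ⟨α, hα, hx⟩ := h.eq_sum_simple hB
  obtain ⟨c, rfl⟩ := hx x
  induction (Finset.univ : Finset (Fin 8)) using Finset.induction_on with
  | empty => exact Or.inl ⟨0, by simp⟩
  | insert a s ha ih =>
    rw [Finset.sum_insert ha, add_comm]
    exact ih.add_zsmul_root hB (hα a) _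

/-- Representatives in `E₈` of the nonzero classes modulo two: a root if `c` is odd, a sum of two
orthogonal roots if `c` is even. -/
def classRep (c : ℤ) : Fin 8 → ℤ :=
  if c % 2 = 0 then frameCoord 0 + frameCoord 1 else frameCoord 0

/-- The parity of `c` decides between a root and a sum of two orthogonal roots. These roots start a
Hamming frame, which is carried from the standard one. -/
theorem IsEvenUnimodular8.exists_equiv (hB : IsEvenUnimodular8 B) {z : E} {c : ℤ}
    (hz : ∀ y, z ≠ (2 : ℤ) • y) (hc : B z z = 2 * c) :
    ∃ g : (Fin 8 → ℤ) ≃ₗ[ℤ] E, (∀ x y, B (g x) (g y) = formE8 x y) ∧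
      ∃ y, z = g (classRep c) + (2 : ℤ) • y := by
  obtain ⟨y, rfl⟩ | ⟨r, y, hr, rfl⟩ | ⟨r, s, y, hr, hs, hrs, rfl⟩ := hB.hasShortRep z
  · exact absurd rfl (hz y)
  · have hfr : IsFrame B ![r] := by
      intro i j
      fin_cases i; fin_cases j; simp [hr]
    obtain ⟨e, he, hee⟩ := hfr.exists_extension hB 7 (by norm_num)
    obtain ⟨e', f, h, h0, -⟩ := he.exists_hamming hB
    obtain ⟨g, hg, hge⟩ := h.exists_equiv hB
    refine ⟨g, hg, y, ?_⟩
    have hc' : c % 2 ≠ 0 := by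
      obtain ⟨t, ht⟩ := hB.even y
      have := hB.symm r y
      simp only [map_add, LinearMap.add_apply, map_smul, LinearMap.smul_apply, smul_eq_mul] at hc
      omega
    have hr0 : e 0 = r := hee 0
    rw [classRep, if_neg hc', hge, h0, hr0]
  · have hfr : IsFrame B ![r, s] := by
      intro i j
      fin_cases i <;> fin_cases j <;> simp [hr, hs, hrs, hB.symm s r]
    obtain ⟨e, he, hee⟩ := hfr.exists_extension hB 6 (by norm_num)
    obtain ⟨e', f, h, h0, h1, -⟩ := he.exists_hamming hB
    obtain ⟨g, hg, hge⟩ := h.exists_equiv hB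
    refine ⟨g, hg, y, ?_⟩
    have hc' : c % 2 = 0 := by
      obtain ⟨t, ht⟩ := hB.even y
      have := hB.symm r y
      have := hB.symm s y
      have := hB.symm s r
      simp only [map_add, LinearMap.add_apply, map_smul, LinearMap.smul_apply, smul_eq_mul] at hc
      omega
    have hr0 : e 0 = r := hee 0
    have hs0 : e 1 = s := hee 1
    rw [classRep, if_pos hc', map_add, hge, hge, h0, h1, hr0, hs0]

end Hamming

/-! ### The lattices at hand in coordinates -/

theorem latU_form (x y : Fin 2 → ℤ) : latU.form x y = x 0 * y 1 + x 1 * y 0 := by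
  simp [latU, EvenForm.ofMatrix, Matrix.toBilin'_apply, Fin.sum_univ_two]

theorem formE8_coord (x y : Fin 8 → ℤ) : formE8 x y =
    2 * (x 0 * y 0 + x 1 * y 1 + x 2 * y 2 + x 3 * y 3 + x 4 * y 4 + x 5 * y 5 + x 6 * y 6 +
      x 7 * y 7) - (x 0 * y 2 + x 2 * y 0 + x 1 * y 3 + x 3 * y 1 + x 2 * y 3 + x 3 * y 2 +
      x 3 * y 4 + x 4 * y 3 + x 4 * y 5 + x 5 * y 4 + x 5 * y 6 + x 6 * y 5 +
      x 6 * y 7 + x 7 * y 6) := by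
  simp [formE8_apply, Fin.sum_univ_eight, CartanMatrix.E₈]
  ring

theorem latE8_form (x y : Fin 8 → ℤ) : latE8.form x y = - formE8 x y := by
  simp [latE8, EvenForm.scale, EvenForm.ofMatrix, formE8]

theorem cartanMatrix_D_four : CartanMatrix.D 4 =
    !![2, -1, 0, 0; -1, 2, -1, -1; 0, -1, 2, 0; 0, -1, 0, 2] := by decide

theorem latD4_form (x y : Fin 4 → ℤ) : latD4.form x y =
    x 0 * y 1 + x 1 * y 0 + x 1 * y 2 + x 2 * y 1 + x 1 * y 3 + x 3 * y 1 -
      2 * (x 0 * y 0 + x 1 * y 1 + x 2 * y 2 + x 3 * y 3) := by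
  simp [latD4, EvenForm.scale, EvenForm.ofMatrix, Matrix.toBilin'_apply, Fin.sum_univ_four,
    cartanMatrix_D_four]
  ring

theorem formE8_symm (x y : Fin 8 → ℤ) : formE8 x y = formE8 y x := by
  have := latE8.symm x y
  rw [latE8_form, latE8_form] at this
  exact neg_injective this

theorem formE8_pos (x : Fin 8 → ℤ) (hx : x ≠ 0) : 0 < formE8 x x := by
  -- Completing squares from the ends of the Dynkin diagram towards the branch node `x 3`; 60 clears
  -- denominators.
  have h : 60 * formE8 x x = 30 * (2 * x 0 - x 2) ^ 2 + 10 * (3 * x 2 - 2 * x 3) ^ 2 +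
      30 * (2 * x 1 - x 3) ^ 2 + 30 * (2 * x 7 - x 6) ^ 2 + 10 * (3 * x 6 - 2 * x 5) ^ 2 +
      5 * (4 * x 5 - 3 * x 4) ^ 2 + 3 * (5 * x 4 - 4 * x 3) ^ 2 + 2 * x 3 ^ 2 := by
    rw [formE8_coord]; ring
  by_contra! hn
  have hsq : ∀ a : ℤ, 0 ≤ a ^ 2 := sq_nonneg
  have z : ∀ a : ℤ, a ^ 2 ≤ 0 → a = 0 := fun a ha => pow_eq_zero_iff two_ne_zero |>.1
    (le_antisymm ha (sq_nonneg a))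
  have a1 := hsq (2 * x 0 - x 2)
  have a2 := hsq (3 * x 2 - 2 * x 3)
  have a3 := hsq (2 * x 1 - x 3)
  have a4 := hsq (2 * x 7 - x 6)
  have a5 := hsq (3 * x 6 - 2 * x 5)
  have a6 := hsq (4 * x 5 - 3 * x 4)
  have a7 := hsq (5 * x 4 - 4 * x 3)
  have a8 := hsq (x 3)
  have b1 := z (2 * x 0 - x 2) (by linarith)
  have b2 := z (3 * x 2 - 2 * x 3) (by linarith)
  have b3 := z (2 * x 1 - x 3) (by linarith)
  have b4 := z (2 * x 7 - x 6) (by linarith)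
  have b5 := z (3 * x 6 - 2 * x 5) (by linarith)
  have b6 := z (4 * x 5 - 3 * x 4) (by linarith)
  have b7 := z (5 * x 4 - 4 * x 3) (by linarith)
  have b8 := z (x 3) (by linarith)
  apply hx
  ext i
  fin_cases i <;> simp <;> omega

theorem latD4_neg (x : Fin 4 → ℤ) (hx : x ≠ 0) : latD4.form x x < 0 := by
  have h : -2 * latD4.form x x = (2 * x 0 - x 1) ^ 2 + (2 * x 2 - x 1) ^ 2 +
      (2 * x 3 - x 1) ^ 2 + x 1 ^ 2 := by
    rw [latD4_form]; ring
  by_contra! hn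
  have hsq : ∀ a : ℤ, 0 ≤ a ^ 2 := sq_nonneg
  have z : ∀ a : ℤ, a ^ 2 ≤ 0 → a = 0 := fun a ha => pow_eq_zero_iff two_ne_zero |>.1
    (le_antisymm ha (sq_nonneg a))
  have a1 := hsq (2 * x 0 - x 1)
  have a2 := hsq (2 * x 2 - x 1)
  have a3 := hsq (2 * x 3 - x 1)
  have a4 := hsq (x 1)
  have b1 := z (2 * x 0 - x 1) (by linarith)
  have b2 := z (2 * x 2 - x 1) (by linarith)
  have b3 := z (2 * x 3 - x 1) (by linarith)
  have b4 := z (x 1) (by linarith)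
  apply hx
  ext i
  fin_cases i <;> simp <;> omega

/-- The underlying group of `S`. -/
abbrev LS : Type := ((Fin 2 → ℤ) × (Fin 8 → ℤ)) × ((Fin 4 → ℤ) × (Fin 4 → ℤ))

/-- The underlying group of `U ⊕ E₈`. -/
abbrev LA : Type := (Fin 2 → ℤ) × (Fin 8 → ℤ)

/-- The lattice `U ⊕ E₈`. -/
def latA : EvenForm LA := latU.sum latE8

theorem latA_form (x y : LA) :
    latA.form x y = x.1 0 * y.1 1 + x.1 1 * y.1 0 - formE8 x.2 y.2 := by
  simp [latA, EvenForm.sum, latU_form, latE8_form]; ring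

theorem latS_form (x y : LS) :
    latS.form x y = latA.form x.1 y.1 + (latD4.form x.2.1 y.2.1 + latD4.form x.2.2 y.2.2) := by
  simp [latS, EvenForm.sum, latA]

theorem latU2E82_form (x y : LA) : latU2E82.form x y = 2 * latA.form x y := by
  simp [latU2E82, latA, EvenForm.sum, EvenForm.scale]; ring

/-! ### Dual vectors -/

theorem formE8_unimodular (φ : (Fin 8 → ℤ) →ₗ[ℤ] ℤ) : ∃ x, ∀ y, formE8 x y = φ y := by
  have hdet : IsUnit CartanMatrix.E₈.det := by rw [CartanMatrix.E₈_det]; exact isUnit_one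
  refine ⟨CartanMatrix.E₈⁻¹.mulVec fun i => φ (Pi.single i 1), fun y => ?_⟩
  have h1 : formE8 (CartanMatrix.E₈⁻¹.mulVec fun i => φ (Pi.single i 1)) y =
      dotProduct y (CartanMatrix.E₈.mulVec (CartanMatrix.E₈⁻¹.mulVec fun i => φ (Pi.single i 1))) := by
    rw [formE8_symm, formE8_apply]
    simp only [dotProduct, Matrix.mulVec, Finset.mul_sum]
    exact Finset.sum_congr rfl fun i _ => Finset.sum_congr rfl fun j _ => by ring_nf
  rw [h1, Matrix.mulVec_mulVec, Matrix.mul_nonsing_inv _ hdet, Matrix.one_mulVec]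
  conv_rhs => rw [pi_eq_sum_univ y]
  simp only [map_sum, map_smul, dotProduct, smul_eq_mul]
  refine Finset.sum_congr rfl fun i _ => ?_
  congr 2
  ext j; simp [Pi.single_apply, eq_comm]

theorem functional_coord {n : ℕ} (φ : (Fin n → ℤ) →ₗ[ℤ] ℤ) (y : Fin n → ℤ) :
    φ y = ∑ i, y i * φ (Pi.single i 1) := by
  conv_lhs => rw [pi_eq_sum_univ y]
  simp only [map_sum, map_smul, smul_eq_mul]
  refine Finset.sum_congr rfl fun i _ => ?_
  congr 2
  ext j; simp [Pi.single_apply, eq_comm]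

theorem isEvenUnimodular8_formE8 : IsEvenUnimodular8 formE8 where
  symm := formE8_symm
  even x := by
    have := latE8.even x
    rw [latE8_form] at this
    simpa using this
  pos := formE8_pos
  unimodular := formE8_unimodular
  rank := by simp

theorem latA_unimodular (φ : LA →ₗ[ℤ] ℤ) : ∃ x, ∀ y, latA.form x y = φ y := by
  obtain ⟨v, hv⟩ := formE8_unimodular (φ ∘ₗ LinearMap.inr ℤ _ _)
  refine ⟨(![φ (![0, 1], 0), φ (![1, 0], 0)], -v), fun y => ?_⟩
  have h1 : y = y.1 0 • ((![1, 0], 0) : LA) + y.1 1 • ((![0, 1], 0) : LA) + (0, y.2) := by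
    ext i
    · fin_cases i <;> simp
    · simp
  have h2 : φ (0, y.2) = formE8 v y.2 := (hv y.2).symm
  conv_rhs => rw [h1]
  rw [map_add, map_add, map_smul, map_smul, h2, latA_form]
  simp; ring

theorem latD4_exists_two_dual (φ : (Fin 4 → ℤ) →ₗ[ℤ] ℤ) :
    ∃ x, ∀ y, latD4.form x y = 2 * φ y := by
  -- The coefficients are those of -2 times the inverse Cartan matrix, which is integral.
  refine ⟨![-(2 * φ (Pi.single 0 1) + 2 * φ (Pi.single 1 1) + φ (Pi.single 2 1) + φ (Pi.single 3 1)),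
    -(2 * φ (Pi.single 0 1) + 4 * φ (Pi.single 1 1) + 2 * φ (Pi.single 2 1) + 2 * φ (Pi.single 3 1)),
    -(φ (Pi.single 0 1) + 2 * φ (Pi.single 1 1) + 2 * φ (Pi.single 2 1) + φ (Pi.single 3 1)),
    -(φ (Pi.single 0 1) + 2 * φ (Pi.single 1 1) + φ (Pi.single 2 1) + 2 * φ (Pi.single 3 1))],
    fun y => ?_⟩
  rw [functional_coord φ y, latD4_form, Fin.sum_univ_four]
  simp; ring

/-- This is 2S* ⊂ S: twice any functional is represented in S. -/
theorem latS_exists_two_dual (φ : LS →ₗ[ℤ] ℤ) : ∃ x, ∀ y, latS.form x y = 2 * φ y := by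
  obtain ⟨a, ha⟩ := latA_unimodular (φ ∘ₗ LinearMap.inl ℤ _ _)
  obtain ⟨p, hp⟩ := latD4_exists_two_dual (φ ∘ₗ LinearMap.inr ℤ _ _ ∘ₗ LinearMap.inl ℤ _ _)
  obtain ⟨q, hq⟩ := latD4_exists_two_dual (φ ∘ₗ LinearMap.inr ℤ _ _ ∘ₗ LinearMap.inr ℤ _ _)
  refine ⟨((2 : ℤ) • a, (p, q)), fun y => ?_⟩
  have h : y = (y.1, 0) + (0, (y.2.1, 0)) + (0, (0, y.2.2)) := by ext <;> simp
  conv_rhs => rw [h, map_add, map_add]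
  rw [latS_form]
  simp only [map_smul, LinearMap.smul_apply, ha, hp, hq]
  simp; ring

/-! ### Signature -/

theorem discrim_le_of_nonpos {L : Type*} [AddCommGroup L] (B : LinearMap.BilinForm ℤ L)
    (hs : ∀ x y, B x y = B y x) (h : ∀ x, B x x ≤ 0) (x y : L) :
    B x y * B x y ≤ B x x * B y y := by
  have h1 := h (B y y • x - B x y • y)
  have h2 := h (B x y • x)
  have h3 := h (x + y)
  have h4 := h (x - y)
  have h5 := h x
  have h6 := h y
  have hyx := hs y x
  simp only [map_sub, map_add, map_smul, LinearMap.sub_apply, LinearMap.add_apply,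
    LinearMap.smul_apply, smul_eq_mul, hyx] at h1 h3 h4
  have h1' : B y y * (B x x * B y y - B x y * B x y) ≤ 0 := by linarith
  by_cases h0 : B y y = 0
  · have : B x y = 0 := by
      by_contra hne
      -- The second of these test vectors has norm (B x y)² (2 - B x x) > 0 when `B y y = 0`.
      have k := h ((B x x - 1) • y + B x y • x)
      have k' := h ((B x x - 1) • y - B x y • x)
      simp only [map_add, map_sub, map_smul, LinearMap.add_apply, LinearMap.sub_apply,
        LinearMap.smul_apply, smul_eq_mul, hyx, h0] at k k'
      have hp : 0 < B x y * B x y := mul_self_pos.2 hne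
      nlinarith
    rw [this, h0]; simp
  · have : B y y < 0 := lt_of_le_of_ne h6 h0
    nlinarith

/-- The form of `S` is negative definite on the orthogonal complement of a positive vector. -/
theorem latS_neg_of_orthogonal (h x : LS) (hh : 0 < latS.form h h) (hx : latS.form h x = 0)
    (hx0 : x ≠ 0) : latS.form x x < 0 := by
  -- Split S = U ⊕ T with T negative definite.
  let T := latE8.sum (latD4.sum latD4)
  have hT : ∀ u : LS, ∀ v : LS, latS.form u v = u.1.1 0 * v.1.1 1 + u.1.1 1 * v.1.1 0 +
      T.form (u.1.2, u.2) (v.1.2, v.2) := by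
    intro u v
    rw [latS_form, latA_form]
    simp [T, EvenForm.sum, latE8_form]; ring
  have hTneg : ∀ v, v ≠ 0 → T.form v v < 0 := by
    rintro ⟨a, b, c⟩ hv
    have ha : a ≠ 0 → latE8.form a a < 0 := fun h => by
      rw [latE8_form]; have := formE8_pos a h; omega
    have hb := latD4_neg b
    have hc := latD4_neg c
    have hform : T.form (a, b, c) (a, b, c) =
        latE8.form a a + (latD4.form b b + latD4.form c c) := by simp [T, EvenForm.sum]
    rw [hform]
    by_cases h1 : a = 0 <;> by_cases h2 : b = 0 <;> by_cases h3 : c = 0 <;>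
      simp_all <;> omega
  have hTnp : ∀ v, T.form v v ≤ 0 := fun v => by
    by_cases hv : v = 0
    · simp [hv]
    · exact (hTneg v hv).le
  have hcs := discrim_le_of_nonpos T.form T.symm hTnp (h.1.2, h.2) (x.1.2, x.2)
  have e1 := hTnp (h.1.2, h.2)
  rw [hT] at hh hx ⊢
  by_cases hv : (x.1.2, x.2) = 0
  · rw [hv] at hx ⊢
    simp only [map_zero, add_zero] at hx ⊢
    have hne : x.1.1 0 ≠ 0 ∨ x.1.1 1 ≠ 0 := by
      by_contra! hc
      apply hx0
      simp only [Prod.mk_eq_zero] at hv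
      ext i
      · fin_cases i
        exacts [hc.1, hc.2]
      · simp [hv.1]
      · simp [hv.2]
      · simp [hv.2]
    have hab : 0 < h.1.1 0 * h.1.1 1 := by linarith
    by_contra! hcd
    have : (h.1.1 0 * x.1.1 1) * (h.1.1 1 * x.1.1 0) =
        (h.1.1 0 * h.1.1 1) * (x.1.1 0 * x.1.1 1) := by ring
    have h1 : h.1.1 0 * x.1.1 1 = - (h.1.1 1 * x.1.1 0) := by linarith
    have h2 : 0 ≤ x.1.1 0 * x.1.1 1 := by linarith
    have h3 : 0 ≤ (h.1.1 0 * x.1.1 1) * (h.1.1 1 * x.1.1 0) := by rw [this]; positivity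
    have h4 : h.1.1 1 * x.1.1 0 = 0 := by rw [h1] at h3; nlinarith
    have h5 : h.1.1 0 * x.1.1 1 = 0 := by rw [h1, h4]; simp
    rcases hne with hne | hne
    · have := (mul_eq_zero.1 h4).resolve_right hne; rw [this] at hab; simp at hab
    · have := (mul_eq_zero.1 h5).resolve_right hne; rw [this] at hab; simp at hab
  · have e2 := hTneg _ hv
    set p := T.form (h.1.2, h.2) (h.1.2, h.2)
    set r := T.form (x.1.2, x.2) (x.1.2, x.2)
    set s := T.form (h.1.2, h.2) (x.1.2, x.2)
    by_contra! hcd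
    generalize h.1.1 0 = a at *
    generalize h.1.1 1 = b at *
    generalize x.1.1 0 = c at *
    generalize x.1.1 1 = d at *
    -- Orthogonality and Cauchy–Schwarz in T give 4abcd ≤ (ad + bc)² ≤ pr, whereas 2ab > -p ≥ 0 and
    -- 2cd ≥ -r > 0 force 4abcd > pr.
    have k1 : (a * d + b * c) * (a * d + b * c) ≤ p * r := by
      have : s = -(a * d + b * c) := by linarith
      rw [this] at hcs; linarith
    have k2 : 4 * (a * b) * (c * d) ≤ (a * d + b * c) * (a * d + b * c) := by
      nlinarith [mul_self_nonneg (a * d - b * c)]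
    have k3 : 0 < (2 * (a * b) + p) := by linarith
    have k4 : 0 ≤ 2 * (c * d) + r := by linarith
    nlinarith

/-! ### General facts on integral forms -/

theorem exists_bilin_of_dvd {L : Type*} [AddCommGroup L] (B : LinearMap.BilinForm ℤ L) {k : ℤ}
    (hk : k ≠ 0) (h : ∀ x y, k ∣ B x y) :
    ∃ B' : LinearMap.BilinForm ℤ L, ∀ x y, B x y = k * B' x y := by
  choose B' hB' using h
  refine ⟨LinearMap.mk₂ ℤ B' ?_ ?_ ?_ ?_, hB'⟩
  · intro x y z
    apply mul_left_cancel₀ hk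
    rw [← hB', mul_add, ← hB', ← hB', map_add, LinearMap.add_apply]
  · intro c x y
    apply mul_left_cancel₀ hk
    rw [← hB', map_smul, LinearMap.smul_apply, hB', smul_eq_mul, smul_eq_mul]; ring
  · intro x y z
    apply mul_left_cancel₀ hk
    rw [← hB', mul_add, ← hB', ← hB', map_add]
  · intro c x y
    apply mul_left_cancel₀ hk
    rw [← hB', map_smul, hB', smul_eq_mul, smul_eq_mul]; ring

theorem dvd_inner_of_dvd_norm {L : Type*} [AddCommGroup L] (B : LinearMap.BilinForm ℤ L)
    (hs : ∀ x y, B x y = B y x) {k : ℤ} (p : Submodule ℤ L) (h : ∀ x ∈ p, 2 * k ∣ B x x)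
    {x y : L} (hx : x ∈ p) (hy : y ∈ p) : k ∣ B x y := by
  have h1 := h _ (p.add_mem hx hy)
  simp only [map_add, LinearMap.add_apply, hs y x] at h1
  have h2 : 2 * k ∣ 2 * B x y := by
    have := dvd_sub (dvd_sub h1 (h x hx)) (h y hy)
    have e : B x x + B x y + (B x y + B y y) - B x x - B y y = 2 * B x y := by ring
    rwa [e] at this
  exact (mul_dvd_mul_iff_left two_ne_zero).1 h2

theorem finrank_eq_of_two_smul_mem {L : Type*} [AddCommGroup L] [Module.Free ℤ L]
    [Module.Finite ℤ L] (p : Submodule ℤ L) (h : ∀ x, (2 : ℤ) • x ∈ p) :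
    Module.finrank ℤ p = Module.finrank ℤ L := by
  apply le_antisymm (Submodule.finrank_le p)
  exact LinearMap.finrank_le_finrank_of_injective
    (f := LinearMap.codRestrict p ((2 : ℤ) • LinearMap.id) h) fun x y hxy => by
      have h1 : (2 : ℤ) • x = (2 : ℤ) • y := congrArg Subtype.val hxy
      exact two_smul_injective h1

/-- `L ⧸ H` is a vector space over 𝔽₂. A linear form separating `x` from 0 there lifts to ℤ because
`L` is free. -/
theorem exists_parity_functional {L : Type*} [AddCommGroup L] [Module.Free ℤ L]
    (H : Submodule ℤ L) (h2 : ∀ x, (2 : ℤ) • x ∈ H) {x : L} (hx : x ∉ H) :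
    ∃ φ : L →ₗ[ℤ] ℤ, (∀ h ∈ H, 2 ∣ φ h) ∧ ¬ 2 ∣ φ x := by
  let _ : Module (ZMod 2) (L ⧸ H) := AddCommGroup.zmodModule (n := 2) (by
    intro y
    obtain ⟨y, rfl⟩ := H.mkQ_surjective y
    rw [← map_nsmul, Submodule.mkQ_apply, Submodule.Quotient.mk_eq_zero]
    have := h2 y
    rwa [two_smul, ← two_nsmul] at this)
  have hx0 : H.mkQ x ≠ 0 := by simpa using hx
  obtain ⟨ψ, hψ, -⟩ := Submodule.exists_le_ker_of_notMem (K := ZMod 2) (p := ⊥) (v := H.mkQ x)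
    (by rwa [Submodule.mem_bot])
  obtain ⟨φ, hφ⟩ := Module.projective_lifting_property
    ((Int.castAddHom (ZMod 2)).toIntLinearMap)
    (ψ.toAddMonoidHom.toIntLinearMap ∘ₗ H.mkQ) (ZMod.intCast_surjective)
  have hφ' : ∀ y, (φ y : ZMod 2) = ψ (H.mkQ y) := fun y => LinearMap.congr_fun hφ y
  refine ⟨φ, fun h hh => ?_, fun h => ?_⟩
  · have h1 : H.mkQ h = 0 := by simpa using hh
    have := hφ' h
    rw [h1, map_zero] at this
    exact (ZMod.intCast_zmod_eq_zero_iff_dvd _ 2).1 this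
  · apply hψ
    change ψ (H.mkQ x) = 0
    rw [← hφ']
    exact (ZMod.intCast_zmod_eq_zero_iff_dvd _ 2).2 h

/-! ### Twice a unimodular overlattice of `S` -/

/-- Twice an even unimodular overlattice of `S`. -/
def subD : Submodule ℤ LS where
  -- The overlattice glues the two copies of `D₄` along the diagonal of their discriminant groups:
  -- the conditions say that half of the first component lies in `D₄*` and that both halves agree
  -- modulo `D₄`.
  carrier := {x | (∀ i, 2 ∣ x.1.1 i) ∧ (∀ i, 2 ∣ x.1.2 i) ∧ 2 ∣ x.2.1 1 ∧
    2 ∣ x.2.1 0 + x.2.1 2 + x.2.1 3 ∧ ∀ i, 2 ∣ x.2.1 i - x.2.2 i}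
  zero_mem' := by simp
  add_mem' := by
    rintro x y ⟨h1, h2, h3, h4, h5⟩ ⟨k1, k2, k3, k4, k5⟩
    refine ⟨fun i => dvd_add (h1 i) (k1 i), fun i => dvd_add (h2 i) (k2 i), dvd_add h3 k3, ?_,
      fun i => ?_⟩
    · have := dvd_add h4 k4
      change 2 ∣ (x.2.1 0 + y.2.1 0) + (x.2.1 2 + y.2.1 2) + (x.2.1 3 + y.2.1 3)
      omega
    · have := dvd_add (h5 i) (k5 i)
      change 2 ∣ (x.2.1 i + y.2.1 i) - (x.2.2 i + y.2.2 i)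
      omega
  smul_mem' := by
    rintro c x ⟨h1, h2, h3, h4, h5⟩
    refine ⟨fun i => (h1 i).mul_left c, fun i => (h2 i).mul_left c, h3.mul_left c, ?_, fun i => ?_⟩
    · obtain ⟨k, hk⟩ := h4
      exact ⟨c * k, by
        change c * x.2.1 0 + c * x.2.1 2 + c * x.2.1 3 = _
        linear_combination c * hk⟩
    · obtain ⟨k, hk⟩ := h5 i
      exact ⟨c * k, by
        change c * x.2.1 i - c * x.2.2 i = _
        linear_combination c * hk⟩

theorem mem_subD {x : LS} : x ∈ subD ↔ (∀ i, 2 ∣ x.1.1 i) ∧ (∀ i, 2 ∣ x.1.2 i) ∧ 2 ∣ x.2.1 1 ∧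
    2 ∣ x.2.1 0 + x.2.1 2 + x.2.1 3 ∧ ∀ i, 2 ∣ x.2.1 i - x.2.2 i := Iff.rfl

theorem two_smul_mem_subD (x : LS) : (2 : ℤ) • x ∈ subD := by
  rw [mem_subD]
  refine ⟨fun i => ⟨_, rfl⟩, fun i => ⟨_, rfl⟩, ⟨_, rfl⟩, ⟨x.2.1 0 + x.2.1 2 + x.2.1 3, ?_⟩,
    fun i => ⟨x.2.1 i - x.2.2 i, ?_⟩⟩
  · simp; ring
  · simp; ring

theorem exists_two_smul_of_dvd {n : ℕ} {x : Fin n → ℤ} (h : ∀ i, 2 ∣ x i) :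
    ∃ y, x = (2 : ℤ) • y := by
  choose y hy using h
  exact ⟨y, funext hy⟩

theorem subD_norm {x : LS} (hx : x ∈ subD) : 8 ∣ latS.form x x := by
  obtain ⟨h1, h2, h3, h4, h5⟩ := mem_subD.1 hx
  obtain ⟨u, hu⟩ := exists_two_smul_of_dvd h1
  obtain ⟨v, hv⟩ := exists_two_smul_of_dvd h2
  have ha : latA.form x.1 x.1 = 4 * latA.form (u, v) (u, v) := by
    have : x.1 = (2 : ℤ) • (u, v) := Prod.ext hu hv
    rw [this]; simp only [map_smul, LinearMap.smul_apply, smul_eq_mul]; ring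
  obtain ⟨w, hw⟩ := latA.even (u, v)
  obtain ⟨s0, h50⟩ := h5 0
  obtain ⟨s1, h51⟩ := h5 1
  obtain ⟨s2, h52⟩ := h5 2
  obtain ⟨s3, h53⟩ := h5 3
  obtain ⟨c, hc⟩ := h3
  obtain ⟨k, hk⟩ := h4
  obtain ⟨t0, ht0⟩ := Int.even_mul_succ_self (x.2.1 0)
  obtain ⟨t2, ht2⟩ := Int.even_mul_succ_self (x.2.1 2)
  rw [latS_form, ha, hw, latD4_form, latD4_form]
  generalize x.2.1 0 = a0 at *
  generalize x.2.1 1 = a1 at *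
  generalize x.2.1 2 = a2 at *
  obtain ⟨a3, ha3⟩ : ∃ a3, a3 = x.2.1 3 := ⟨_, rfl⟩
  rw [← ha3] at hk h53 ⊢
  obtain rfl : a1 = 2 * c := hc
  have e3 : a3 = 2 * k - a0 - a2 := by linarith
  have e0 : x.2.2 0 = a0 - 2 * s0 := by linarith
  have e1 : x.2.2 1 = 2 * (c - s1) := by linarith
  have e2 : x.2.2 2 = a2 - 2 * s2 := by linarith
  have e4 : x.2.2 3 = 2 * k - a0 - a2 - 2 * s3 := by linarith
  rw [e0, e1, e2, e4, e3]
  have q0 : a0 * a0 = 2 * t0 - a0 := by linarith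
  have q2 : a2 * a2 = 2 * t2 - a2 := by linarith
  refine ⟨w + (-2 * t0 + a0 - 2 * t2 + a2 - a0 * a2 + 2 * k * (a0 + a2) - 2 * k * k)
    + (k * c - c * c) + ((k - s0 - s2 - s3) * (c - s1) - (c - s1) * (c - s1))
    + (a0 * s0 - s0 * s0 + a2 * s2 - s2 * s2 + (2 * k - a0 - a2) * s3 - s3 * s3), ?_⟩
  linear_combination (-8) * q0 + (-8) * q2

theorem latA_dvd {a : LA} {k : ℤ} (hk : k ≠ 0) (h : ∀ y, k ∣ latA.form a y) :
    ∃ b, a = k • b := by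
  obtain ⟨ψ, hψ⟩ := exists_functional_of_dvd (latA.form a) hk h
  obtain ⟨b, hb⟩ := latA_unimodular ψ
  refine ⟨b, ?_⟩
  have hz : ∀ y, latA.form (a - k • b) y = 0 := fun y => by
    rw [map_sub, map_smul, LinearMap.sub_apply, LinearMap.smul_apply, hb, hψ, smul_eq_mul, sub_self]
  have hz1 := hz (![1, 0], 0)
  have hz2 := hz (![0, 1], 0)
  have hz3 := hz (0, (a - k • b).2)
  rw [latA_form] at hz1 hz2 hz3
  simp only [map_zero, sub_zero, Pi.zero_apply, mul_zero, zero_add, zero_sub, neg_eq_zero,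
    Matrix.cons_val_zero, Matrix.cons_val_one, mul_one] at hz1 hz2 hz3
  have h2 : (a - k • b).2 = 0 := by
    by_contra hne
    have := formE8_pos _ hne
    omega
  have h1 : (a - k • b).1 = 0 := by
    ext i; fin_cases i
    · simpa using hz2
    · simpa using hz1
  exact sub_eq_zero.1 (Prod.ext h1 h2)

/-- Self-duality of `subD`/2: here r/2 lies in S* and pairs integrally with `subD`/2. -/
theorem mem_subD_of_dvd {r : LS} (h2 : ∀ y, 2 ∣ latS.form r y)
    (h4 : ∀ d ∈ subD, 4 ∣ latS.form r d) : r ∈ subD := by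
  obtain ⟨b, hb⟩ := latA_dvd (a := r.1) two_ne_zero (fun y => by
    have := h2 (y, 0)
    rw [latS_form] at this
    simpa using this)
  have hc := h2 (0, (Pi.single 0 1, 0))
  have ha := h2 (0, (Pi.single 1 1, 0))
  have hc' := h2 (0, (0, Pi.single 0 1))
  have ha' := h2 (0, (0, Pi.single 1 1))
  have k1 := h4 (0, (![1, 0, 1, 0], ![1, 0, 1, 0])) (by
    rw [mem_subD]; simp)
  have k2 := h4 (0, (![0, 0, 1, 1], ![0, 0, 1, 1])) (by
    rw [mem_subD]; simp)
  rw [latS_form, latD4_form, latD4_form] at hc ha hc' ha' k1 k2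
  simp at hc ha hc' ha' k1 k2
  rw [mem_subD]
  refine ⟨fun i => ⟨b.1 i, by rw [hb]; rfl⟩, fun i => ⟨b.2 i, by rw [hb]; rfl⟩, by omega, by omega,
    fun i => ?_⟩
  fin_cases i <;> simp <;> omega

/-! ### An even unimodular overlattice of `(U ⊕ E₈)(2)` -/

/-- A sublattice `T` of `U ⊕ E₈` such that `T(1/2)` is even unimodular. -/
def subT : Submodule ℤ LA where
  -- The five parities cut out a maximal totally singular subspace of the quadratic space (U ⊕ E₈)/2
  -- of dimension 10.
  carrier := {a | 2 ∣ a.1 1 ∧ 2 ∣ a.2 0 ∧ 2 ∣ a.2 4 ∧ 2 ∣ a.2 3 + a.2 5 + a.2 7 ∧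
    2 ∣ a.2 1 + a.2 2 + a.2 6}
  zero_mem' := by simp
  add_mem' := by
    rintro x y ⟨h1, h2, h3, h4, h5⟩ ⟨k1, k2, k3, k4, k5⟩
    refine ⟨dvd_add h1 k1, dvd_add h2 k2, dvd_add h3 k3, ?_, ?_⟩
    · have := dvd_add h4 k4
      change 2 ∣ (x.2 3 + y.2 3) + (x.2 5 + y.2 5) + (x.2 7 + y.2 7)
      omega
    · have := dvd_add h5 k5
      change 2 ∣ (x.2 1 + y.2 1) + (x.2 2 + y.2 2) + (x.2 6 + y.2 6)
      omega
  smul_mem' := by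
    rintro c x ⟨h1, h2, h3, h4, h5⟩
    refine ⟨h1.mul_left c, h2.mul_left c, h3.mul_left c, ?_, ?_⟩
    · obtain ⟨k, hk⟩ := h4
      exact ⟨c * k, by
        change c * x.2 3 + c * x.2 5 + c * x.2 7 = _
        linear_combination c * hk⟩
    · obtain ⟨k, hk⟩ := h5
      exact ⟨c * k, by
        change c * x.2 1 + c * x.2 2 + c * x.2 6 = _
        linear_combination c * hk⟩

theorem mem_subT {a : LA} : a ∈ subT ↔ 2 ∣ a.1 1 ∧ 2 ∣ a.2 0 ∧ 2 ∣ a.2 4 ∧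
    2 ∣ a.2 3 + a.2 5 + a.2 7 ∧ 2 ∣ a.2 1 + a.2 2 + a.2 6 := Iff.rfl

theorem subT_norm {x : LA} (hx : x ∈ subT) : 4 ∣ latA.form x x := by
  obtain ⟨⟨k1, h1⟩, ⟨k2, h2⟩, ⟨k3, h3⟩, ⟨k4, h4⟩, ⟨k5, h5⟩⟩ := mem_subT.1 hx
  have h7 : x.2 7 = 2 * k4 - x.2 3 - x.2 5 := by linarith
  have h6 : x.2 6 = 2 * k5 - x.2 1 - x.2 2 := by linarith
  rw [latA_form, formE8_coord, h1, h2, h3, h6, h7]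
  generalize x.2 1 = a1
  generalize x.2 2 = a2
  generalize x.2 3 = a3
  generalize x.2 5 = a5
  exact ⟨x.1 0 * k1 - (2 * k2 * k2 + 2 * k3 * k3 - k2 * a2 - a3 * k3 - k3 * a5 +
    (a1 * a1 + a2 * a2 + a1 * a2) + (a3 * a3 + a5 * a5 + a3 * a5) - 2 * k5 * (a1 + a2) +
    2 * k5 * k5 - 2 * k4 * (a3 + a5) + 2 * k4 * k4 - k4 * (2 * k5 - a1 - a2) - k5 * a3 +
    a3 * (2 * k5 - a1 - a2)), by ring⟩

/-- `subT` modulo two is its own orthogonal complement: the five test vectors lie in it and recover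
its five conditions. -/
theorem mem_subT_of_dvd {a : LA} (h : ∀ t ∈ subT, 2 ∣ latA.form a t) : a ∈ subT := by
  have h0 := h (![1, 0], 0) (by rw [mem_subT]; simp)
  have h1 := h (0, ![0, 0, 0, 0, 0, 1, 0, 1]) (by rw [mem_subT]; simp)
  have h2 := h (0, ![0, 0, 0, 1, 0, 0, 0, 1]) (by rw [mem_subT]; simp)
  have h3 := h (0, ![0, 0, 1, 0, 0, 0, 1, 0]) (by rw [mem_subT]; simp)
  have h4 := h (0, ![0, 1, 0, 0, 0, 0, 1, 0]) (by rw [mem_subT]; simp)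
  rw [latA_form, formE8_coord] at h0 h1 h2 h3 h4
  simp at h0 h1 h2 h3 h4
  rw [mem_subT]
  refine ⟨by omega, by omega, by omega, by omega, by omega⟩

/-! ### The orthogonal complement of an Enriques sublattice -/

/-- `f` embeds `(U ⊕ E₈)(2)` into `S` as a primitive sublattice orthogonal to no `(-2)`-vector. -/
structure IsEnriquesEmbedding (f : LA →ₗ[ℤ] LS) : Prop where
  inner : ∀ a b, latS.form (f a) (f b) = 2 * latA.form a b
  primitive : EvenForm.Primitive (LinearMap.range f)
  no_root : ∀ x ∈ latS.perp (LinearMap.range f), latS.form x x ≠ -2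

theorem IsEnriquesSublattice.exists_embedding {M : Submodule ℤ LS} (hM : IsEnriquesSublattice M) :
    ∃ f, IsEnriquesEmbedding f ∧ LinearMap.range f = M := by
  obtain ⟨e⟩ := hM.iso
  let g : LA →ₗ[ℤ] LS := M.subtype ∘ₗ e.toLinearEquiv.symm.toLinearMap
  have hg : LinearMap.range g = M := by
    rw [LinearMap.range_comp_of_range_eq_top _ (LinearEquiv.range _), Submodule.range_subtype]
  refine ⟨g, ⟨fun a b => ?_, hg.symm ▸ hM.primitive, hg.symm ▸ hM.no_root⟩, hg⟩
  have h := e.map_app' (e.toLinearEquiv.symm a) (e.toLinearEquiv.symm b)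
  have h1 : e.toFun (e.toLinearEquiv.symm a) = a := e.toLinearEquiv.apply_symm_apply a
  have h2 : e.toFun (e.toLinearEquiv.symm b) = b := e.toLinearEquiv.apply_symm_apply b
  rw [h1, h2, latU2E82_form] at h
  exact h.symm

theorem latA_eq_zero {a : LA} (h : ∀ b, latA.form a b = 0) : a = 0 := by
  obtain ⟨b, rfl⟩ := latA_dvd (a := a) two_ne_zero (fun y => by rw [h y]; exact dvd_zero _)
  have h' : ∀ y, latA.form b y = 0 := fun y => by
    have := h y
    rw [map_smul, LinearMap.smul_apply, smul_eq_mul] at this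
    omega
  have h1 := h' (![1, 0], 0)
  have h2 := h' (![0, 1], 0)
  have h3 := h' (0, b.2)
  rw [latA_form] at h1 h2 h3
  simp only [map_zero, sub_zero, Pi.zero_apply, mul_zero, zero_add, zero_sub, neg_eq_zero,
    Matrix.cons_val_zero, Matrix.cons_val_one, mul_one] at h1 h2 h3
  have k2 : b.2 = 0 := by
    by_contra hne
    have := formE8_pos _ hne
    omega
  have k1 : b.1 = 0 := by
    ext i; fin_cases i
    · simpa using h2
    · simpa using h1
  have h0 : b = 0 := Prod.ext k1 k2
  rw [h0, smul_zero]

namespace IsEnriquesEmbedding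

variable {f : LA →ₗ[ℤ] LS}

theorem mem_perp {x : LS} :
    x ∈ latS.perp (LinearMap.range f) ↔ ∀ a, latS.form (f a) x = 0 := by
  constructor
  · intro h a
    exact h (f a) ⟨a, rfl⟩
  · rintro h _ ⟨a, rfl⟩
    exact h a

theorem perp_primitive : EvenForm.Primitive (latS.perp (LinearMap.range f)) := by
  intro k x hk hx
  rw [mem_perp] at hx ⊢
  intro a
  have := hx a
  rw [map_smul, smul_eq_mul] at this
  exact (mul_eq_zero.1 this).resolve_left hk

variable (hf : IsEnriquesEmbedding f)
include hf

theorem injective : Function.Injective f := by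
  rw [← LinearMap.ker_eq_bot, LinearMap.ker_eq_bot']
  intro a ha
  apply latA_eq_zero
  intro b
  have := hf.inner a b
  rw [ha] at this
  simpa using this.symm

/-- Vectors with even inner products with `M` split into a component in `M` and one in `M^⊥`. -/
theorem exists_decomp {r : LS} (h : ∀ a, 2 ∣ latS.form r (f a)) :
    ∃ a, r - f a ∈ latS.perp (LinearMap.range f) := by
  obtain ⟨ψ, hψ⟩ := exists_functional_of_dvd (latS.form r ∘ₗ f) two_ne_zero h
  obtain ⟨a, ha⟩ := latA_unimodular ψ
  refine ⟨a, mem_perp.2 fun b => ?_⟩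
  have := hψ b
  rw [LinearMap.comp_apply] at this
  rw [latS.symm, map_sub, LinearMap.sub_apply, this, hf.inner, ha, sub_self]

theorem exists_decomp_two_smul (s : LS) :
    ∃ a, (2 : ℤ) • s - f a ∈ latS.perp (LinearMap.range f) :=
  hf.exists_decomp fun a =>
    ⟨latS.form s (f a), by rw [map_smul, LinearMap.smul_apply, smul_eq_mul]⟩

/-- This is 2N* ⊂ N. Extend `φ` to S, represent twice the extension by a vector of S, and remove its
component in M, which is integral because the pairing with M is even. -/
theorem perp_exists_two_dual (φ : latS.perp (LinearMap.range f) →ₗ[ℤ] ℤ) :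
    ∃ n ∈ latS.perp (LinearMap.range f), ∀ y : latS.perp (LinearMap.range f),
      latS.form n y = 2 * φ y := by
  obtain ⟨π, hπ⟩ := exists_retraction_of_primitive (perp_primitive (f := f))
  obtain ⟨r, hr⟩ := latS_exists_two_dual (φ ∘ₗ π)
  obtain ⟨a, ha⟩ := hf.exists_decomp (r := r) fun a => ⟨_, hr _⟩
  refine ⟨_, ha, fun y => ?_⟩
  rw [map_sub, LinearMap.sub_apply, hr, mem_perp.1 y.2 a, LinearMap.comp_apply, hπ, sub_zero]

theorem perp_neg {x : LS} (hx : x ∈ latS.perp (LinearMap.range f)) (h0 : x ≠ 0) :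
    latS.form x x < 0 := by
  -- This vector of M has norm 4.
  refine latS_neg_of_orthogonal (f (![1, 1], 0)) x ?_ (mem_perp.1 hx _) h0
  rw [hf.inner, latA_form]
  simp

theorem finrank_perp : Module.finrank ℤ (latS.perp (LinearMap.range f)) = 8 := by
  have hinj : Function.Injective (f.coprod (latS.perp (LinearMap.range f)).subtype) := by
    rw [← LinearMap.ker_eq_bot, LinearMap.ker_eq_bot']
    rintro ⟨a, n⟩ h
    rw [LinearMap.coprod_apply, Submodule.subtype_apply] at h
    have ha : a = 0 := by
      apply latA_eq_zero
      intro b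
      have h1 : latS.form (f b) (f a + n) = 0 := by rw [h, map_zero]
      rw [map_add, hf.inner, mem_perp.1 n.2 b] at h1
      rw [latA.symm]; omega
    subst ha
    rw [map_zero, zero_add] at h
    exact Prod.ext rfl (Subtype.ext h)
  have h1 := finrank_eq_of_two_smul_mem
    (LinearMap.range (f.coprod (latS.perp (LinearMap.range f)).subtype)) (fun s => by
      obtain ⟨a, ha⟩ := hf.exists_decomp_two_smul s
      exact ⟨(a, ⟨_, ha⟩), by simp⟩)
  rw [LinearMap.finrank_range_of_inj hinj, Module.finrank_prod] at h1
  simp [Module.finrank_prod] at h1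
  omega

omit hf in
variable (f) in
/-- Twice an even unimodular overlattice of `M^⊥`. -/
def subF : Submodule ℤ LS :=
  (subD ⊔ subT.map f) ⊓ latS.perp (LinearMap.range f)

omit hf in
theorem mem_subF {n : LS} : n ∈ subF f ↔
    n ∈ latS.perp (LinearMap.range f) ∧ ∃ t ∈ subT, n + f t ∈ subD := by
  rw [subF, Submodule.mem_inf, Submodule.mem_sup, and_comm]
  refine and_congr_right fun _ => ⟨?_, ?_⟩
  · rintro ⟨d, hd, _, ⟨t, ht, rfl⟩, rfl⟩
    exact ⟨-t, subT.neg_mem ht, by simpa using hd⟩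
  · rintro ⟨t, ht, h⟩
    exact ⟨_, h, _, ⟨-t, subT.neg_mem ht, rfl⟩, by simp⟩

/-- Orthogonality gives (n, n) = (n + f t, n + f t) - 2 (t, t), and 8 divides both terms. -/
theorem subF_norm {n : LS} (hn : n ∈ subF f) : 8 ∣ latS.form n n := by
  obtain ⟨hn, t, ht, hd⟩ := mem_subF.1 hn
  have h1 := subD_norm hd
  have h2 := subT_norm ht
  have h3 := mem_perp.1 hn t
  have h4 := latS.symm n (f t)
  simp only [map_add, LinearMap.add_apply, hf.inner] at h1
  omega

/-- Self-duality of `subF`/2. Otherwise a functional `φ` is even on `subD ⊔ subT.map f` and odd at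
`x`. The vector `r` representing 2φ lies in `subD` and its M-component comes from `subT`, so its
N-component lies in `subF`, yet pairs with `x` to 2φ(x), not divisible by 4. -/
theorem mem_subF_of_dvd {x : LS} (hx : x ∈ latS.perp (LinearMap.range f))
    (h : ∀ n ∈ subF f, 4 ∣ latS.form x n) : x ∈ subF f := by
  by_contra hxF
  have hxH : x ∉ subD ⊔ subT.map f := fun hx' => hxF ⟨hx', hx⟩
  obtain ⟨φ, hφ, hφx⟩ := exists_parity_functional (subD ⊔ subT.map f)
    (fun y => Submodule.mem_sup_left (two_smul_mem_subD y)) hxH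
  obtain ⟨r, hr⟩ := latS_exists_two_dual φ
  have hrD : r ∈ subD := mem_subD_of_dvd (fun y => ⟨_, hr y⟩) fun d hd => by
    obtain ⟨k, hk⟩ := hφ d (Submodule.mem_sup_left hd)
    exact ⟨k, by rw [hr, hk]; ring⟩
  obtain ⟨a, ha⟩ := hf.exists_decomp (r := r) fun a => ⟨_, hr _⟩
  have haT : a ∈ subT := mem_subT_of_dvd fun t ht => by
    obtain ⟨k, hk⟩ := hφ (f t) (Submodule.mem_sup_right ⟨t, ht, rfl⟩)
    have h1 := hr (f t)
    have h2 := mem_perp.1 ha t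
    rw [latS.symm, map_sub, LinearMap.sub_apply, hf.inner] at h2
    exact ⟨k, by omega⟩
  have hn : r - f a ∈ subF f := mem_subF.2 ⟨ha, a, haT, by simpa using hrD⟩
  obtain ⟨k, hk⟩ := h _ hn
  have h1 := mem_perp.1 hx a
  rw [map_sub, latS.symm x r, latS.symm x (f a), h1, hr] at hk
  exact hφx ⟨k, by omega⟩

omit hf in
theorem two_smul_mem_subF {n : LS} (hn : n ∈ latS.perp (LinearMap.range f)) :
    (2 : ℤ) • n ∈ subF f :=
  ⟨Submodule.mem_sup_left (two_smul_mem_subD n), Submodule.smul_mem _ _ hn⟩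

/-- The overlattice of `M^⊥` is even unimodular. -/
theorem exists_formF : ∃ B : LinearMap.BilinForm ℤ (subF f),
    (∀ x y : subF f, latS.form x y = -4 * B x y) ∧ IsEvenUnimodular8 B := by
  obtain ⟨B, hB⟩ := exists_bilin_of_dvd
    (latS.form.compl₁₂ (subF f).subtype (subF f).subtype) (k := -4) (by norm_num)
    (fun x y => by
      rw [neg_dvd]
      exact dvd_inner_of_dvd_norm latS.form latS.symm (subF f) (fun _ h => hf.subF_norm h)
        x.2 y.2)
  have hB' : ∀ x y : subF f, latS.form x y = -4 * B x y := hB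
  refine ⟨B, hB', fun x y => ?_, fun x => ?_, fun x hx => ?_, fun φ => ?_, ?_⟩
  · have h1 := hB' x y
    have h2 := hB' y x
    have h3 := latS.symm x y
    omega
  · obtain ⟨k, hk⟩ := hf.subF_norm x.2
    have h1 := hB' x x
    exact ⟨-k, by omega⟩
  · have h1 := hB' x x
    have h2 := hf.perp_neg x.2.2 (fun h => hx (Subtype.ext h))
    omega
  -- To represent `φ`, pull it back along n ↦ 2n from N to `subF` and use 2N* ⊂ N.
  · let dbl : latS.perp (LinearMap.range f) →ₗ[ℤ] subF f :=
      LinearMap.codRestrict (subF f) ((2 : ℤ) • (Submodule.subtype _))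
        (fun n => two_smul_mem_subF n.2)
    obtain ⟨n, hn, hnφ⟩ := hf.perp_exists_two_dual (φ ∘ₗ dbl)
    have key : ∀ y : subF f, latS.form n y = 4 * φ y := fun y => by
      have h1 := hnφ ⟨y, y.2.2⟩
      have h2 : dbl ⟨y, y.2.2⟩ = (2 : ℤ) • y := rfl
      rw [LinearMap.comp_apply, h2, map_smul, smul_eq_mul] at h1
      change latS.form n y = _ at h1
      omega
    have hnF : n ∈ subF f := hf.mem_subF_of_dvd hn fun y hy => ⟨_, key ⟨y, hy⟩⟩
    refine ⟨-⟨n, hnF⟩, fun y => ?_⟩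
    have h1 := hB' ⟨n, hnF⟩ y
    have h2 := key y
    change latS.form n y = _ at h1
    rw [map_neg, LinearMap.neg_apply]
    omega
  · have h1 := finrank_eq_of_two_smul_mem
      ((subF f).submoduleOf (latS.perp (LinearMap.range f))) (fun n => two_smul_mem_subF n.2)
    rw [hf.finrank_perp] at h1
    exact (Submodule.submoduleOfEquivOfLe (p := subF f) inf_le_right).finrank_eq.symm.trans h1

/-- Inspect the class of 2n modulo 2 `subF`. If it contains a root `r` of `B`, then r/2 lies in N
and has norm -2 in S, which is forbidden. In the other two cases the norm of n is divisible by 4. -/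
theorem four_dvd_perp_norm {n : LS} (hn : n ∈ latS.perp (LinearMap.range f)) :
    4 ∣ latS.form n n := by
  obtain ⟨B, hB, hE⟩ := hf.exists_formF
  have h2n := hB ⟨_, two_smul_mem_subF hn⟩ ⟨_, two_smul_mem_subF hn⟩
  simp only [map_smul, LinearMap.smul_apply, smul_eq_mul] at h2n
  obtain ⟨y, hy⟩ | ⟨r, y, hr, hy⟩ | ⟨r, s, y, hr, hs, hrs, hy⟩ :=
    hE.hasShortRep ⟨_, two_smul_mem_subF hn⟩
  · have : n = y := two_smul_injective (congrArg Subtype.val hy)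
    have h8 := hf.subF_norm y.2
    rw [this]; omega
  · exfalso
    have h1 : (r : LS) = (2 : ℤ) • (n - y) := by
      have := congrArg Subtype.val hy
      simp only [Submodule.coe_add, Submodule.coe_smul] at this
      rw [smul_sub, this]; abel
    have h2 := hB r r
    rw [hr, h1] at h2
    simp only [map_smul, LinearMap.smul_apply, smul_eq_mul] at h2
    exact hf.no_root (n - y) (Submodule.sub_mem _ hn y.2.2) (by omega)
  · rw [hy] at h2n
    have e1 := hE.symm r y
    have e2 := hE.symm s y
    have e3 := hE.symm r s
    obtain ⟨k, hk⟩ := hE.even y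
    simp only [map_add, LinearMap.add_apply, map_smul, LinearMap.smul_apply, smul_eq_mul] at h2n
    omega

/-- N(-1/2) is even by `four_dvd_perp_norm` and unimodular by `perp_exists_two_dual`. -/
theorem exists_formN : ∃ B : LinearMap.BilinForm ℤ (latS.perp (LinearMap.range f)),
    (∀ x y : latS.perp (LinearMap.range f), latS.form x y = -2 * B x y) ∧
      IsEvenUnimodular8 B := by
  obtain ⟨B, hB⟩ := exists_bilin_of_dvd
    (latS.form.compl₁₂ (latS.perp (LinearMap.range f)).subtype
      (latS.perp (LinearMap.range f)).subtype) (k := -2) (by norm_num)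
    (fun x y => by
      rw [neg_dvd]
      exact dvd_inner_of_dvd_norm latS.form latS.symm _ (fun _ h => hf.four_dvd_perp_norm h)
        x.2 y.2)
  have hB' : ∀ x y : latS.perp (LinearMap.range f), latS.form x y = -2 * B x y := hB
  refine ⟨B, hB', fun x y => ?_, fun x => ?_, fun x hx => ?_, fun φ => ?_, hf.finrank_perp⟩
  · have h1 := hB' x y
    have h2 := hB' y x
    have h3 := latS.symm x y
    omega
  · obtain ⟨k, hk⟩ := hf.four_dvd_perp_norm x.2
    have h1 := hB' x x
    exact ⟨-k, by omega⟩
  · have h1 := hB' x x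
    have h2 := hf.perp_neg x.2 (fun h => hx (Subtype.ext h))
    omega
  · obtain ⟨n, hn, hnφ⟩ := hf.perp_exists_two_dual φ
    refine ⟨-⟨n, hn⟩, fun y => ?_⟩
    have h1 := hB' ⟨n, hn⟩ y
    have h2 := hnφ y
    change latS.form n y = _ at h1
    rw [map_neg, LinearMap.neg_apply]
    omega

end IsEnriquesEmbedding

theorem IsEnriquesSublattice.perp_iso {M : Submodule ℤ LS} (hM : IsEnriquesSublattice M) :
    (latS.restrict (latS.perp M)).Iso (latE8.scale 2) := by
  obtain ⟨f, hf, rfl⟩ := hM.exists_embedding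
  obtain ⟨B, hB, hE⟩ := hf.exists_formN
  obtain ⟨e, he⟩ := hE.exists_frame
  obtain ⟨e', h, hh, -⟩ := he.exists_hamming hE
  obtain ⟨g, hg, -⟩ := hh.exists_equiv hE
  refine ⟨⟨g.symm, fun x y => ?_⟩⟩
  change (2 • latE8.form) (g.symm x) (g.symm y) = latS.form x y
  rw [hB, ← g.apply_symm_apply x, ← g.apply_symm_apply y, hg]
  simp [latE8_form]

/-! ### Reduction modulo two -/

theorem exists_one_tmul {L : Type*} [AddCommGroup L] (v : ZMod 2 ⊗[ℤ] L) :
    ∃ x : L, (1 : ZMod 2) ⊗ₜ[ℤ] x = v := by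
  induction v with
  | zero => exact ⟨0, TensorProduct.tmul_zero _ _⟩
  | tmul c x =>
    obtain ⟨k, rfl⟩ := ZMod.intCast_surjective c
    exact ⟨k • x, by rw [← TensorProduct.smul_tmul, zsmul_one]⟩
  | add v w hv hw =>
    obtain ⟨x, rfl⟩ := hv
    obtain ⟨y, rfl⟩ := hw
    exact ⟨x + y, TensorProduct.tmul_add _ _ _⟩

theorem one_tmul_eq_zero {L : Type*} [AddCommGroup L] [Module.Free ℤ L] {x : L} :
    (1 : ZMod 2) ⊗ₜ[ℤ] x = 0 ↔ ∃ y, x = (2 : ℤ) • y := by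
  constructor
  · intro h
    by_contra hx
    obtain ⟨φ, -, hφ⟩ := exists_parity_functional (LinearMap.range ((2 : ℤ) • LinearMap.id (M := L)))
      (fun y => ⟨y, rfl⟩) (x := x) (by rintro ⟨y, hy⟩; exact hx ⟨y, hy.symm⟩)
    have h1 := congrArg (φ.lTensor (ZMod 2)) h
    rw [LinearMap.lTensor_tmul, map_zero] at h1
    have h2 := congrArg (TensorProduct.rid ℤ (ZMod 2)) h1
    rw [TensorProduct.rid_tmul, map_zero, zsmul_one, ZMod.intCast_zmod_eq_zero_iff_dvd] at h2
    exact hφ (by exact_mod_cast h2)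
  · rintro ⟨y, rfl⟩
    rw [← TensorProduct.smul_tmul, zsmul_one]
    have : ((2 : ℤ) : ZMod 2) = 0 := rfl
    rw [this, TensorProduct.zero_tmul]

theorem baseChange_two_eq_zero {L : Type*} [AddCommGroup L] (B : LinearMap.BilinForm ℤ L) (x y : L) :
    B.baseChange (ZMod 2) (1 ⊗ₜ[ℤ] x) (1 ⊗ₜ[ℤ] y) = 0 ↔ 2 ∣ B x y := by
  rw [LinearMap.BilinForm.baseChange_tmul, mul_one, zsmul_one, ZMod.intCast_zmod_eq_zero_iff_dvd]
  norm_num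

theorem IsEvenUnimodular8.exists_smul {E : Type*} [AddCommGroup E]
    {B : LinearMap.BilinForm ℤ E} (hB : IsEvenUnimodular8 B) {x : E} {k : ℤ} (hk : k ≠ 0)
    (h : ∀ y, k ∣ B x y) : ∃ y, x = k • y := by
  obtain ⟨ψ, hψ⟩ := exists_functional_of_dvd (B x) hk h
  obtain ⟨m, hm⟩ := hB.unimodular ψ
  refine ⟨m, ?_⟩
  by_contra hne
  have h1 := hB.pos _ (sub_ne_zero.2 hne)
  have h2 : ∀ y, B (x - k • m) y = 0 := fun y => by
    rw [map_sub B, LinearMap.sub_apply, hψ, map_smul B, LinearMap.smul_apply, hm, smul_eq_mul,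
      sub_self]
  exact h1.ne' (h2 _)

theorem IsEvenUnimodular8.exists_two_smul {E : Type*} [AddCommGroup E]
    {B : LinearMap.BilinForm ℤ E} (hB : IsEvenUnimodular8 B) {x : E} (h : ∀ y, 2 ∣ B x y) :
    ∃ y, x = (2 : ℤ) • y :=
  hB.exists_smul two_ne_zero h

/-- Generators of the radical of the form of `S` modulo two. -/
def radS : (Fin 4 → ℤ) →ₗ[ℤ] LS where
  toFun c := (0, ![c 0, 0, c 1, -c 0 - c 1], ![c 2, 0, c 3, -c 2 - c 3])
  map_add' c d := by
    simp only [Prod.mk_add_mk, Matrix.cons_add_cons, Matrix.empty_add_empty, Pi.add_apply, add_zero]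
    ring_nf
  map_smul' k c := by
    simp only [Prod.smul_mk, Matrix.smul_cons, Matrix.smul_empty, Pi.smul_apply, smul_eq_mul,
      eq_intCast, Int.cast_id, smul_zero]
    ring_nf

theorem exists_radS {r : LS} (h : ∀ s, 2 ∣ latS.form r s) :
    ∃ c s, r = radS c + (2 : ℤ) • s := by
  obtain ⟨b, hb⟩ := latA_dvd (a := r.1) two_ne_zero (fun y => by
    have := h (y, 0)
    rw [latS_form] at this
    simpa using this)
  have h1 := h (0, (Pi.single 0 1, 0))
  have h2 := h (0, (Pi.single 1 1, 0))
  have h3 := h (0, (0, Pi.single 0 1))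
  have h4 := h (0, (0, Pi.single 1 1))
  rw [latS_form, latD4_form, latD4_form] at h1 h2 h3 h4
  simp at h1 h2 h3 h4
  obtain ⟨k1, h1⟩ := h1
  obtain ⟨k2, h2⟩ := h2
  obtain ⟨k3, h3⟩ := h3
  obtain ⟨k4, h4⟩ := h4
  refine ⟨![r.2.1 0, r.2.1 2, r.2.2 0, r.2.2 2], (b, ![0, k1 + r.2.1 0, 0, k2 + r.2.1 1],
    ![0, k3 + r.2.2 0, 0, k4 + r.2.2 1]), ?_⟩
  refine Prod.ext (by rw [hb]; simp [radS]) (Prod.ext ?_ ?_) <;> ext i <;> fin_cases i <;>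
    (simp [radS]; try omega)

theorem radS_even (c : Fin 4 → ℤ) (s : LS) : 2 ∣ latS.form (radS c) s := by
  rw [latS_form, latD4_form, latD4_form]
  simp [radS]
  exact ⟨- c 0 * s.2.1 0 - c 1 * s.2.1 2 + (c 0 + c 1) * s.2.1 3 - c 2 * s.2.2 0 -
    c 3 * s.2.2 2 + (c 2 + c 3) * s.2.2 3, by ring⟩

/-- U and E₈ are unimodular, and each `D₄` has a radical of dimension 2 modulo two. -/
theorem finrank_radical_latS :
    Module.finrank (ZMod 2) ((latS.form.baseChange (ZMod 2)).orthogonal ⊤) = 4 := by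
  have hinj : Function.Injective (radS.baseChange (ZMod 2)) := by
    refine (injective_iff_map_eq_zero _).2 fun v hv => ?_
    obtain ⟨c, rfl⟩ := exists_one_tmul v
    obtain ⟨s, hs⟩ := (one_tmul_eq_zero (x := radS c)).1 hv
    have h1 := congrArg (fun x => x.2.1 0) hs
    have h2 := congrArg (fun x => x.2.1 2) hs
    have h3 := congrArg (fun x => x.2.2 0) hs
    have h4 := congrArg (fun x => x.2.2 2) hs
    simp [radS] at h1 h2 h3 h4
    refine one_tmul_eq_zero.2 (exists_two_smul_of_dvd fun i => ?_)
    fin_cases i <;> simp <;> omega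
  have hrange : (latS.form.baseChange (ZMod 2)).orthogonal ⊤ =
      LinearMap.range (radS.baseChange (ZMod 2)) := by
    ext v
    obtain ⟨r, rfl⟩ := exists_one_tmul v
    constructor
    · intro h
      obtain ⟨c, s, rfl⟩ := exists_radS (r := r) fun s => by
        rw [latS.symm]
        exact (baseChange_two_eq_zero latS.form s r).1 (h _ trivial)
      refine ⟨1 ⊗ₜ c, ?_⟩
      rw [TensorProduct.tmul_add, one_tmul_eq_zero.2 ⟨s, rfl⟩, add_zero]
      rfl
    · rintro ⟨v, hv⟩ w -
      obtain ⟨c, rfl⟩ := exists_one_tmul v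
      obtain ⟨s, rfl⟩ := exists_one_tmul w
      rw [← hv]
      change latS.form.baseChange (ZMod 2) (1 ⊗ₜ s) (1 ⊗ₜ radS c) = 0
      rw [baseChange_two_eq_zero, latS.symm]
      exact radS_even c s
  rw [hrange, LinearMap.finrank_range_of_inj hinj, Module.finrank_baseChange]
  simp

/-! ### The orthogonal complement of the gluing group has order two -/

namespace IsEnriquesEmbedding
variable {f : LA →ₗ[ℤ] LS} (hf : IsEnriquesEmbedding f)
include hf

theorem exists_two_smul_of_range {a : LA} {s : LS} (h : f a = (2 : ℤ) • s) :
    ∃ b, a = (2 : ℤ) • b := by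
  obtain ⟨b, hb⟩ := hf.primitive 2 s two_ne_zero (h ▸ ⟨a, rfl⟩)
  exact ⟨b, hf.injective (by rw [h, map_smul, hb])⟩

/-- The kernel of (M ⊕ N)/2 → S/2S consists of the pairs glued in S, and is a copy of Γ. It has
dimension 7, so the orthogonal complement of its projection to N/2N, of dimension 8, is a line. -/
theorem exists_glue_vector : ∃ z ∈ latS.perp (LinearMap.range f),
    (∀ y, z ≠ (2 : ℤ) • y) ∧ (∀ s, 2 ∣ latS.form z s) ∧
    ∀ n ∈ latS.perp (LinearMap.range f), (∀ s, 2 ∣ latS.form n s) →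
      (∃ y, n = (2 : ℤ) • y) ∨ ∃ y, n = z + (2 : ℤ) • y := by
  obtain ⟨B, hB, hE⟩ := hf.exists_formN
  let N := latS.perp (LinearMap.range f)
  let h : LA × N →ₗ[ℤ] LS := f.coprod N.subtype
  have h_app : ∀ a n, h (a, n) = f a + n := fun a n => rfl
  let h' := h.baseChange (ZMod 2)
  have h'_app : ∀ p, h' (1 ⊗ₜ p) = 1 ⊗ₜ h p := fun p => rfl
  let b := latS.form.baseChange (ZMod 2)
  have hrefl : b.IsRefl :=
    (LinearMap.BilinForm.IsSymm.baseChange (ZMod 2) (B₂ := latS.form) ⟨latS.symm⟩).isRefl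
  have hinn : ∀ a n a' n', latS.form (h (a, n)) (h (a', n')) =
      2 * latA.form a a' - 2 * B n n' := by
    intro a n a' n'
    have h1 := mem_perp.1 n'.2 a
    have h2 := mem_perp.1 n.2 a'
    have h3 := hB n n'
    have h4 := latS.symm n (f a')
    rw [h_app, h_app]
    simp only [map_add, LinearMap.add_apply, hf.inner]
    omega
  -- Products inside M ⊕ N are even; conversely a vector with even products with M already splits.
  have horth : b.orthogonal (LinearMap.range h') = LinearMap.range h' := by
    ext v
    obtain ⟨s, rfl⟩ := exists_one_tmul v
    constructor
    · intro hs
      obtain ⟨a, ha⟩ := hf.exists_decomp (r := s) fun a => by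
        have := hs (h' (1 ⊗ₜ (a, 0))) ⟨_, rfl⟩
        rw [h'_app, baseChange_two_eq_zero, h_app,
          Submodule.coe_zero, add_zero, latS.symm] at this
        exact this
      exact ⟨1 ⊗ₜ (a, ⟨_, ha⟩), by rw [h'_app, h_app]; simp⟩
    · rintro ⟨w, hw⟩ _ ⟨w', rfl⟩
      obtain ⟨⟨a, n⟩, rfl⟩ := exists_one_tmul w
      obtain ⟨⟨a', n'⟩, rfl⟩ := exists_one_tmul w'
      rw [← hw, h'_app, h'_app, baseChange_two_eq_zero, hinn]
      omega
  -- The self-orthogonal image contains the radical, so twice its dimension is 18 + 4. Thus it has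
  -- dimension 11, and the kernel 18 - 11 = 7.
  have hrad : LinearMap.range h' ⊓ b.orthogonal ⊤ = b.orthogonal ⊤ :=
    inf_eq_right.2 ((LinearMap.BilinForm.orthogonal_le le_top).trans horth.le)
  have hdim := LinearMap.BilinForm.finrank_add_finrank_orthogonal (B := b) hrefl
    (LinearMap.range h')
  rw [horth, hrad, finrank_radical_latS, Module.finrank_baseChange] at hdim
  have hker := LinearMap.finrank_range_add_finrank_ker h'
  rw [Module.finrank_baseChange, Module.finrank_prod, hf.finrank_perp] at hker
  simp only [Module.finrank_prod, Module.finrank_fintype_fun_eq_card, Fintype.card_fin] at hdim hker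
  have hk : Module.finrank (ZMod 2) (LinearMap.ker h') = 7 := by
    have hdim' : Module.finrank (ZMod 2) (LinearMap.range h') +
      Module.finrank (ZMod 2) (LinearMap.range h') = 22 := hdim
    have hker' : Module.finrank (ZMod 2) (LinearMap.range h') +
      Module.finrank (ZMod 2) (LinearMap.ker h') = 18 := hker
    omega
  let p := (LinearMap.snd ℤ LA N).baseChange (ZMod 2)
  -- Projection of Γ to N loses nothing because M is primitive.
  have hp : Function.Injective (p.domRestrict (LinearMap.ker h')) := by
    refine (injective_iff_map_eq_zero _).2 ?_
    rintro ⟨v, hv⟩ h0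
    obtain ⟨⟨a, n⟩, rfl⟩ := exists_one_tmul v
    have h0' : (1 : ZMod 2) ⊗ₜ[ℤ] n = 0 := h0
    obtain ⟨m, rfl⟩ := one_tmul_eq_zero.1 h0'
    have h1 : (1 : ZMod 2) ⊗ₜ[ℤ] h (a, (2 : ℤ) • m) = 0 := hv
    obtain ⟨s, hs⟩ := one_tmul_eq_zero.1 h1
    obtain ⟨c, rfl⟩ := hf.exists_two_smul_of_range (a := a) (s := s - m) (by
      rw [smul_sub, ← hs, h_app, Submodule.coe_smul]; abel)
    exact Subtype.ext (one_tmul_eq_zero.2 ⟨(c, m), rfl⟩)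
  let β := B.baseChange (ZMod 2)
  have hβ0 : ∀ n : N, (∀ y, 2 ∣ B n y) → (1 : ZMod 2) ⊗ₜ[ℤ] n = 0 := fun n hn =>
    one_tmul_eq_zero.2 (hE.exists_two_smul hn)
  have hβ : β.Nondegenerate := by
    constructor <;> (intro v hv; obtain ⟨n, rfl⟩ := exists_one_tmul v; refine hβ0 n fun y => ?_)
    · exact (baseChange_two_eq_zero B n y).1 (hv (1 ⊗ₜ y))
    · rw [hE.symm]
      exact (baseChange_two_eq_zero B y n).1 (hv (1 ⊗ₜ y))
  let X := (LinearMap.ker h').map p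
  have hX : Module.finrank (ZMod 2) X = 7 := by
    rw [← hk, ← LinearMap.finrank_range_of_inj hp, LinearMap.range_domRestrict]
  have h1 := LinearMap.BilinForm.finrank_orthogonal hβ X
  rw [hX, Module.finrank_baseChange, hf.finrank_perp] at h1
  have hmem : ∀ n : N, (1 : ZMod 2) ⊗ₜ[ℤ] n ∈ β.orthogonal X ↔ ∀ s, 2 ∣ latS.form n s := by
    intro n
    constructor
    · intro hn s
      obtain ⟨a, ha⟩ := hf.exists_decomp_two_smul s
      have h2 := hn (1 ⊗ₜ ⟨_, ha⟩) ⟨1 ⊗ₜ (a, ⟨_, ha⟩), one_tmul_eq_zero.2 ⟨s, by simp [h_app]⟩, rfl⟩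
      change β _ (1 ⊗ₜ n) = 0 at h2
      rw [baseChange_two_eq_zero] at h2
      have h3 := hB ⟨_, ha⟩ n
      have h4 := mem_perp.1 n.2 a
      simp only [map_sub, LinearMap.sub_apply, map_smul, LinearMap.smul_apply, smul_eq_mul] at h3
      rw [latS.symm]
      omega
    · rintro hn _ ⟨v, hv, rfl⟩
      obtain ⟨⟨a, n'⟩, rfl⟩ := exists_one_tmul v
      have h1 : (1 : ZMod 2) ⊗ₜ[ℤ] h (a, n') = 0 := hv
      obtain ⟨s, hs⟩ := one_tmul_eq_zero.1 h1
      change β (1 ⊗ₜ n') (1 ⊗ₜ n) = 0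
      rw [baseChange_two_eq_zero]
      have h2 := hn s
      have h3 := congrArg (latS.form n) hs
      have h4 := mem_perp.1 n.2 a
      have h5 := hB n n'
      rw [h_app, map_add, map_smul, latS.symm n (f a), smul_eq_mul] at h3
      rw [hE.symm]
      omega
  have h1' : Module.finrank (ZMod 2) (β.orthogonal X) = 1 := h1
  obtain ⟨⟨v, hv⟩, hv0, hv1⟩ := finrank_eq_one_iff'.1 h1'
  obtain ⟨z, rfl⟩ := exists_one_tmul v
  refine ⟨z, z.2, fun y hy => hv0 ?_, (hmem z).1 hv, fun n hn hns => ?_⟩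
  · have hyN : y ∈ N := perp_primitive 2 y two_ne_zero (hy ▸ z.2)
    exact Subtype.ext (one_tmul_eq_zero.2 ⟨⟨y, hyN⟩, Subtype.ext hy⟩)
  · obtain ⟨c, hc⟩ := hv1 ⟨_, (hmem ⟨n, hn⟩).2 hns⟩
    have hc' : c • (1 : ZMod 2) ⊗ₜ[ℤ] z = 1 ⊗ₜ ⟨n, hn⟩ := congrArg Subtype.val hc
    obtain rfl | rfl : c = 0 ∨ c = 1 := by clear hc hc'; revert c; decide
    · left
      rw [zero_smul] at hc'
      obtain ⟨y, hy⟩ := one_tmul_eq_zero.1 hc'.symm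
      exact ⟨y, congrArg Subtype.val hy⟩
    · right
      rw [one_smul, eq_comm, ← sub_eq_zero, ← TensorProduct.tmul_sub] at hc'
      obtain ⟨y, hy⟩ := one_tmul_eq_zero.1 hc'
      exact ⟨y, by rw [← sub_eq_iff_eq_add']; exact congrArg Subtype.val hy⟩

end IsEnriquesEmbedding

/-! ### Isometries of even lattices -/

namespace EvenForm

variable {L : Type*} [AddCommGroup L] (S : EvenForm L)

/-- `g` preserves the form. -/
def IsIsometry (g : L ≃ₗ[ℤ] L) : Prop := ∀ x y, S.form (g x) (g y) = S.form x y

variable {S}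

theorem IsIsometry.symm {g : L ≃ₗ[ℤ] L} (hg : S.IsIsometry g) : S.IsIsometry g.symm := fun x y => by
  rw [← hg, g.apply_symm_apply, g.apply_symm_apply]

theorem IsIsometry.trans {g h : L ≃ₗ[ℤ] L} (hg : S.IsIsometry g) (hh : S.IsIsometry h) :
    S.IsIsometry (g.trans h) := fun x y => by
  rw [LinearEquiv.trans_apply, LinearEquiv.trans_apply, hh, hg]

variable (S) in
/-- The Eichler transvection `x ↦ x + (x, d) e - (x, e) d - m (x, e) e`. -/
def eichlerMap (e d : L) (m : ℤ) : L →ₗ[ℤ] L :=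
  LinearMap.id + (S.form d).smulRight e - (S.form e).smulRight d - (m • S.form e).smulRight e

theorem eichlerMap_apply (e d : L) (m : ℤ) (x : L) : S.eichlerMap e d m x =
    x + S.form x d • e - S.form x e • d - (m * S.form x e) • e := by
  simp [eichlerMap, S.symm x]

theorem eichlerMap_neg {e d : L} {m : ℤ} (he : S.form e e = 0) (hed : S.form e d = 0)
    (hd : S.form d d = 2 * m) (x : L) : S.eichlerMap e (-d) m (S.eichlerMap e d m x) = x := by
  have h1 : S.form (S.eichlerMap e d m x) e = S.form x e := by
    rw [eichlerMap_apply]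
    simp [he, S.symm d e, hed]
  have h2 : S.form (S.eichlerMap e d m x) d = S.form x d - 2 * m * S.form x e := by
    rw [eichlerMap_apply]
    simp [hd, hed]
    ring
  rw [eichlerMap_apply, h1, map_neg, h2, eichlerMap_apply]
  module

/-- Eichler transvections are isometries. -/
theorem exists_eichler {e d : L} {m : ℤ} (he : S.form e e = 0) (hed : S.form e d = 0)
    (hd : S.form d d = 2 * m) : ∃ g : L ≃ₗ[ℤ] L, S.IsIsometry g ∧ ∀ x, g x =
      x + S.form x d • e - S.form x e • d - (m * S.form x e) • e := by
  refine ⟨LinearEquiv.ofLinearMap (S.eichlerMap e d m) (S.eichlerMap e (-d) m) ?_ ?_, fun x y => ?_,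
    fun x => eichlerMap_apply _ _ _ _⟩
  · ext x
    have := eichlerMap_neg (S := S) (d := -d) (m := m) he (by simp [hed]) (by simp [hd]) x
    rwa [neg_neg] at this
  · ext x
    exact eichlerMap_neg he hed hd x
  · rw [LinearEquiv.coe_ofLinearMap, eichlerMap_apply, eichlerMap_apply]
    simp [he, hed, hd, S.symm d e, S.symm e y, S.symm d y]
    ring

/-- Reflections in `(-2)`-vectors are isometries. -/
theorem exists_reflection {r : L} (hr : S.form r r = -2) :
    ∃ g : L ≃ₗ[ℤ] L, S.IsIsometry g ∧ ∀ x, g x = x + S.form x r • r := by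
  have h : ∀ x, x + S.form x r • r + S.form (x + S.form x r • r) r • r = x := fun x => by
    rw [map_add, LinearMap.add_apply, map_smul, LinearMap.smul_apply, hr, smul_eq_mul]
    module
  refine ⟨LinearEquiv.ofLinearMap (LinearMap.id + (S.form r).smulRight r)
    (LinearMap.id + (S.form r).smulRight r) ?_ ?_, fun x y => ?_, fun x => ?_⟩
  · ext x; simpa [S.symm r] using h x
  · ext x; simpa [S.symm r] using h x
  · simp [hr, S.symm r]; ring
  · simp [S.symm r]

end EvenForm

/-! ### Congruence modulo two -/

/-- Congruence modulo `2L`. -/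
def ModTwo {L : Type*} [AddCommGroup L] (x y : L) : Prop := ∃ w, x = y + (2 : ℤ) • w

namespace ModTwo

variable {L : Type*} [AddCommGroup L] {x y z : L}

theorem symm (h : ModTwo x y) : ModTwo y x := by
  obtain ⟨w, rfl⟩ := h
  exact ⟨-w, by module⟩

theorem trans (h : ModTwo x y) (h' : ModTwo y z) : ModTwo x z := by
  obtain ⟨w, rfl⟩ := h
  obtain ⟨w', rfl⟩ := h'
  exact ⟨w' + w, by module⟩

theorem map {L' : Type*} [AddCommGroup L'] (g : L →ₗ[ℤ] L') (h : ModTwo x y) :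
    ModTwo (g x) (g y) := by
  obtain ⟨w, rfl⟩ := h
  exact ⟨g w, by rw [map_add, map_smul]⟩

theorem form_right (S : EvenForm L) (h : ModTwo x y) (z : L) : 2 ∣ S.form z x - S.form z y := by
  obtain ⟨w, rfl⟩ := h
  exact ⟨S.form z w, by simp⟩

end ModTwo

/-! ### The orthogonal group of `U ⊕ E₈` modulo two -/

theorem latA_exists_swap : ∃ g : LA ≃ₗ[ℤ] LA, latA.IsIsometry g ∧
    ∀ x, (g x).1 0 = x.1 1 ∧ (g x).1 1 = x.1 0 := by
  refine ⟨(LinearEquiv.funCongrLeft ℤ ℤ (Equiv.swap (0 : Fin 2) 1)).prodCongr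
    (LinearEquiv.refl ℤ _), fun x y => ?_, fun x => ⟨rfl, rfl⟩⟩
  rw [latA_form, latA_form]
  change x.1 1 * y.1 0 + x.1 0 * y.1 1 - _ = _
  simp
  ring

/-- Every vector not divisible by two is equivalent to a vector of the hyperbolic plane modulo
two. -/
theorem exists_isometry_hyperbolic {x : LA} (hx : ∀ y, x ≠ (2 : ℤ) • y) {k : ℤ}
    (hk : 4 ∣ latA.form x x - 2 * k) :
    ∃ g, latA.IsIsometry g ∧ ModTwo (g x) (![k, 1], 0) := by
  have hodd : ∀ x : LA, ¬ 2 ∣ x.1 1 → 4 ∣ latA.form x x - 2 * k →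
      ∃ g, latA.IsIsometry g ∧ ModTwo (g x) (![k, 1], 0) := by
    intro x hx1 hk
    obtain ⟨m, hm⟩ := latA.even (0, x.2)
    -- As `x.1 1` is odd, this transvection kills the `E₈`-component modulo two; the norm then fixes
    -- the parity of the first coordinate.
    obtain ⟨g, hg, hgx⟩ := EvenForm.exists_eichler (S := latA) (e := (![1, 0], 0)) (d := (0, x.2))
      (m := m) (by rw [latA_form]; simp) (by rw [latA_form]; simp) (by rw [hm]; ring)
    have hn := hg x x
    have h1 : (g x).1 1 = x.1 1 := by
      rw [hgx]; simp [Matrix.vecHead, Matrix.vecTail]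
    have h2 : (g x).2 = x.2 - x.1 1 • x.2 := by
      rw [hgx, latA_form, latA_form]; simp
    obtain ⟨j, hj⟩ : ∃ j, x.1 1 = 2 * j + 1 := ⟨x.1 1 / 2, by omega⟩
    obtain ⟨w, h3⟩ : ∃ w, (g x).2 = (2 : ℤ) • w := ⟨-j • x.2, by rw [h2, hj]; module⟩
    rw [latA_form, h3, h1, hj] at hn
    obtain ⟨i, hi⟩ : 2 ∣ (g x).1 0 - k := by
      simp only [map_smul, LinearMap.smul_apply, smul_eq_mul] at hn
      have ht : (2 * j + 1) * (g x).1 0 = 2 * ((g x).1 0 * j) + (g x).1 0 := by ring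
      rw [mul_comm ((g x).1 0), ht] at hn
      omega
    refine ⟨g, hg, (![i, j], w), Prod.ext ?_ ?_⟩
    · ext a
      fin_cases a
      · simp; omega
      · simp; omega
    · simpa using h3
  by_cases h1 : 2 ∣ x.1 1
  · have hswap : ∀ y : LA, ¬ 2 ∣ y.1 0 → 4 ∣ latA.form y y - 2 * k →
      ∃ g, latA.IsIsometry g ∧ ModTwo (g y) (![k, 1], 0) := by
      intro y hy hky
      obtain ⟨s, hs, hsy⟩ := latA_exists_swap
      obtain ⟨g, hg, hgy⟩ := hodd (s y) (by rwa [(hsy y).2]) (by rwa [hs])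
      exact ⟨s.trans g, hs.trans hg, hgy⟩
    by_cases h0 : 2 ∣ x.1 0
    -- When both hyperbolic coordinates are even, a transvection along `c` makes the first one odd.
    · obtain ⟨c, hc⟩ : ∃ c, ¬ 2 ∣ formE8 x.2 c := by
        by_contra! hc
        obtain ⟨y, hy⟩ := isEvenUnimodular8_formE8.exists_two_smul hc
        obtain ⟨u, hu⟩ := exists_two_smul_of_dvd (x := x.1) (fun i => by
          fin_cases i
          · exact h0
          · exact h1)
        exact hx (u, y) (Prod.ext hu hy)
      obtain ⟨m, hm⟩ := latA.even (0, c)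
      obtain ⟨g, hg, hgx⟩ := EvenForm.exists_eichler (S := latA) (e := (![1, 0], 0)) (d := (0, c))
        (m := m) (by rw [latA_form]; simp) (by rw [latA_form]; simp) (by rw [hm]; ring)
      obtain ⟨g', hg', hgy⟩ := hswap (g x) (by
        rw [hgx, latA_form, latA_form]
        simp only [Prod.fst_sub, Prod.fst_add, Prod.smul_fst, Pi.sub_apply, Pi.add_apply,
          Pi.smul_apply, Pi.zero_apply, Matrix.cons_val_zero, Matrix.cons_val_one, smul_eq_mul,
          map_zero, smul_zero, mul_zero, mul_one, zero_add, add_zero, sub_zero, zero_sub]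
        have := h1.mul_left m
        omega) (by rwa [hg])
      exact ⟨g.trans g', hg.trans hg', hgy⟩
    · exact hswap x h0 hk
  · exact hodd x h1 hk

/-- A nonzero class modulo two has lifts of every norm permitted modulo 4, with some inner product
equal to 1. This lets transvections modulo two lift to isometries over ℤ. -/
theorem exists_isometric_lift {x : LA} (hx : ∀ y, x ≠ (2 : ℤ) • y) {k : ℤ}
    (hk : 4 ∣ latA.form x x - 2 * k) :
    ∃ r, ModTwo r x ∧ latA.form r r = 2 * k ∧ ∃ t, latA.form r t = 1 := by
  obtain ⟨g, hg, hgx⟩ := exists_isometry_hyperbolic hx hk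
  refine ⟨g.symm (![k, 1], 0), ?_, ?_, g.symm (![1, 0], 0), ?_⟩
  · simpa using (hgx.map g.symm.toLinearMap).symm
  · rw [hg.symm, latA_form]; simp; ring
  · rw [hg.symm, latA_form]; simp

/-- Lift `w` to a (-2)-vector and reflect in it. -/
theorem latA_exists_transvection {w : LA} (hw : 4 ∣ latA.form w w - 2) :
    ∃ g, latA.IsIsometry g ∧ ∀ x, ModTwo (g x) (x + latA.form x w • w) := by
  obtain ⟨r, ⟨v, rfl⟩, hr, -⟩ := exists_isometric_lift (x := w) (k := -1) (by
    rintro y rfl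
    rw [map_smul, map_smul, LinearMap.smul_apply, smul_eq_mul, smul_eq_mul] at hw
    omega) (by omega)
  obtain ⟨g, hg, hgx⟩ := EvenForm.exists_reflection hr
  refine ⟨g, hg, fun x => ⟨latA.form x v • w + latA.form x (w + (2 : ℤ) • v) • v, ?_⟩⟩
  rw [hgx, map_add, map_smul, smul_eq_mul]
  module

/-- Lift `e` to an isotropic vector having product 1 with some `t`, then correct `d` by an even
multiple of `t` to make it orthogonal to the lift. Since 4 divides the norm of the new `d`, the
quadratic term disappears modulo two. -/
theorem latA_exists_eichler {e d : LA} (he : ∀ y, e ≠ (2 : ℤ) • y) (he4 : 4 ∣ latA.form e e)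
    (hed : 2 ∣ latA.form e d) (hd : 4 ∣ latA.form d d) :
    ∃ g, latA.IsIsometry g ∧
      ∀ x, ModTwo (g x) (x + latA.form x d • e + latA.form x e • d) := by
  obtain ⟨r, ⟨v, rfl⟩, hr, t, ht⟩ := exists_isometric_lift (k := 0) he (by omega)
  obtain ⟨a, ha⟩ : 2 ∣ latA.form (e + (2 : ℤ) • v) d := by
    simp only [map_add, map_smul, LinearMap.add_apply, LinearMap.smul_apply, smul_eq_mul]
    omega
  obtain ⟨b, hb⟩ : 4 ∣ latA.form (d - (2 * a) • t) (d - (2 * a) • t) := by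
    obtain ⟨i, hi⟩ := latA.even t
    obtain ⟨j, hj⟩ := hd
    refine ⟨j - a * latA.form d t + a * a * (i + i), ?_⟩
    simp only [map_sub, map_smul, LinearMap.sub_apply, LinearMap.smul_apply, smul_eq_mul,
      latA.symm t d, hi, hj]
    ring
  obtain ⟨g, hg, hgx⟩ := EvenForm.exists_eichler (S := latA) (d := d - (2 * a) • t) (m := 2 * b)
    hr (by rw [map_sub, map_smul, ha, ht]; simp) (by rw [hb]; ring)
  refine ⟨g, hg, fun x => ⟨latA.form x d • v - (a * latA.form x t) • (e + (2 : ℤ) • v) -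
    latA.form x e • d - latA.form x v • d + ((latA.form x e + 2 * latA.form x v) * a) • t -
    (b * (latA.form x e + 2 * latA.form x v)) • (e + (2 : ℤ) • v), ?_⟩⟩
  rw [hgx]
  simp only [map_sub, map_smul, map_add, smul_eq_mul]
  module

/-! ### Extension of partial isometries modulo two -/

theorem exists_common_functional {H : Set LA} {x x' : LA}
    (hx : ∃ u, (∀ h ∈ H, 2 ∣ latA.form u h) ∧ ¬ 2 ∣ latA.form u x)
    (hx' : ∃ u, (∀ h ∈ H, 2 ∣ latA.form u h) ∧ ¬ 2 ∣ latA.form u x') :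
    ∃ u, (∀ h ∈ H, 2 ∣ latA.form u h) ∧ ¬ 2 ∣ latA.form u x ∧ ¬ 2 ∣ latA.form u x' := by
  obtain ⟨u, hu, hux⟩ := hx
  obtain ⟨u', hu', hux'⟩ := hx'
  by_cases h1 : 2 ∣ latA.form u x'
  · by_cases h2 : 2 ∣ latA.form u' x
    · refine ⟨u + u', fun h hh => ?_, ?_, ?_⟩
      · rw [map_add]; exact dvd_add (hu h hh) (hu' h hh)
      · rw [map_add, LinearMap.add_apply]; omega
      · rw [map_add, LinearMap.add_apply]; omega
    · exact ⟨u', hu', h2, hux'⟩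
  · exact ⟨u, hu, hux, h1⟩

/-- `x` can be moved to `x'` modulo two by an isometry that is trivial on `H` modulo two. -/
def CanMove (H : Set LA) (x x' : LA) : Prop :=
  ∃ g, latA.IsIsometry g ∧ (∀ h ∈ H, ModTwo (g h) h) ∧ ModTwo (g x) x'

theorem CanMove.trans {H : Set LA} {x y z : LA} (h : CanMove H x y) (h' : CanMove H y z) :
    CanMove H x z := by
  obtain ⟨g, hg, hgH, hgx⟩ := h
  obtain ⟨g', hg', hgH', hgx'⟩ := h'
  exact ⟨g.trans g', hg.trans hg', fun h hh => ((hgH h hh).map g'.toLinearMap).trans (hgH' h hh),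
    (hgx.map g'.toLinearMap).trans hgx'⟩

/-- The transvection in w = x + x' works: (w, w) ≡ 2 modulo 4, (x, w) is odd, and w is orthogonal to
`H` modulo two. -/
theorem canMove_of_odd {H : Set LA} {x x' : LA}
    (hH : ∀ h ∈ H, 2 ∣ latA.form x h - latA.form x' h)
    (hq : 4 ∣ latA.form x x - latA.form x' x') (hxx : ¬ 2 ∣ latA.form x x') : CanMove H x x' := by
  obtain ⟨i, hi⟩ := latA.even x
  have hs := latA.symm x x'
  obtain ⟨g, hg, hgx⟩ := latA_exists_transvection (w := x + x') (by
    simp only [map_add, LinearMap.add_apply]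
    omega)
  refine ⟨g, hg, fun h hh => (hgx h).trans ?_, (hgx x).trans ?_⟩
  · obtain ⟨j, hj⟩ : 2 ∣ latA.form h (x + x') := by
      have := hH h hh
      rw [map_add, latA.symm h, latA.symm h]
      omega
    exact ⟨j • (x + x'), by rw [hj]; module⟩
  · obtain ⟨j, hj⟩ : 2 ∣ latA.form x (x + x') - 1 := by
      rw [map_add]; omega
    exact ⟨x + j • (x + x'), by rw [eq_add_of_sub_eq hj]; module⟩

/-- When (x, x') is even, pass through x + w, where w is orthogonal to `H`, odd against both x and
x', and (w, w) ≡ 2 modulo 4. Adding `t` to a candidate for w repairs its norm if necessary. -/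
theorem canMove_of_toggle {H : Set LA} {x x' : LA}
    (hH : ∀ h ∈ H, 2 ∣ latA.form x h - latA.form x' h)
    (hq : 4 ∣ latA.form x x - latA.form x' x')
    (hx : ∃ u, (∀ h ∈ H, 2 ∣ latA.form u h) ∧ ¬ 2 ∣ latA.form u x)
    (hx' : ∃ u, (∀ h ∈ H, 2 ∣ latA.form u h) ∧ ¬ 2 ∣ latA.form u x')
    (ht : 2 ∣ latA.form x x' → ∃ t, (∀ h ∈ H, 2 ∣ latA.form t h) ∧ 2 ∣ latA.form t x ∧
      2 ∣ latA.form t x' ∧ ∀ u, (∀ h ∈ H, 2 ∣ latA.form u h) → ¬ 2 ∣ latA.form u x →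
        ¬ 4 ∣ latA.form t t + 2 * latA.form t u) : CanMove H x x' := by
  by_cases hxx : 2 ∣ latA.form x x'
  · obtain ⟨w, hwH, hwx, hwx', hw⟩ : ∃ w, (∀ h ∈ H, 2 ∣ latA.form w h) ∧ ¬ 2 ∣ latA.form w x ∧
        ¬ 2 ∣ latA.form w x' ∧ 4 ∣ latA.form w w - 2 := by
      obtain ⟨u, huH, hux, hux'⟩ := exists_common_functional hx hx'
      obtain ⟨t, htH, htx, htx', htt⟩ := ht hxx
      have htu := htt u huH hux
      obtain ⟨i, hi⟩ := latA.even u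
      obtain ⟨j, hj⟩ := latA.even t
      by_cases hu : 4 ∣ latA.form u u - 2
      · exact ⟨u, huH, hux, hux', hu⟩
      · refine ⟨u + t, fun h hh => ?_, ?_, ?_, ?_⟩
        · rw [map_add]; exact dvd_add (huH h hh) (htH h hh)
        · rw [map_add, LinearMap.add_apply]; omega
        · rw [map_add, LinearMap.add_apply]; omega
        · have := latA.symm u t
          simp only [map_add, LinearMap.add_apply]
          omega
    have s1 := latA.symm x w
    obtain ⟨i, hi⟩ := latA.even x
    refine CanMove.trans (y := x + w) (canMove_of_odd (fun h hh => ?_) ?_ ?_)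
      (canMove_of_odd (fun h hh => ?_) ?_ ?_)
    · have := hwH h hh
      rw [map_add, LinearMap.add_apply]; omega
    · simp only [map_add, LinearMap.add_apply]; omega
    · rw [map_add]; omega
    · have := hwH h hh
      have := hH h hh
      rw [map_add, LinearMap.add_apply]; omega
    · simp only [map_add, LinearMap.add_apply]; omega
    · rw [map_add, LinearMap.add_apply]; omega
  · exact canMove_of_odd hH hq hxx

theorem canMove_of_forall_not_mem {H : Set LA} {x x' : LA} (hH : ∀ h, h ∉ H)
    (hq : 4 ∣ latA.form x x - latA.form x' x')
    (hx : ∃ u, (∀ h ∈ H, 2 ∣ latA.form u h) ∧ ¬ 2 ∣ latA.form u x)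
    (hx' : ∃ u, (∀ h ∈ H, 2 ∣ latA.form u h) ∧ ¬ 2 ∣ latA.form u x') : CanMove H x x' := by
  obtain ⟨k, hk⟩ := latA.even x
  obtain ⟨g, hg, hgx⟩ := exists_isometry_hyperbolic (x := x) (k := k) (by
    rintro y rfl
    obtain ⟨u, -, hu⟩ := hx
    rw [map_smul, smul_eq_mul] at hu
    exact hu ⟨_, rfl⟩) (by omega)
  obtain ⟨g', hg', hgx'⟩ := exists_isometry_hyperbolic (x := x') (k := k) (by
    rintro y rfl
    obtain ⟨u, -, hu⟩ := hx'
    rw [map_smul, smul_eq_mul] at hu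
    exact hu ⟨_, rfl⟩) (by omega)
  refine ⟨g.trans g'.symm, hg.trans hg'.symm, fun h hh => absurd hh (hH h), ?_⟩
  simpa using (hgx.trans hgx'.symm).map g'.symm.toLinearMap

/-- Here `x` itself serves as the norm-changing vector. -/
theorem canMove_of_isotropic {H : Set LA} {x x' : LA}
    (hH : ∀ h ∈ H, 2 ∣ latA.form x h - latA.form x' h)
    (hq : 4 ∣ latA.form x x - latA.form x' x')
    (hx : ∃ u, (∀ h ∈ H, 2 ∣ latA.form u h) ∧ ¬ 2 ∣ latA.form u x)
    (hx' : ∃ u, (∀ h ∈ H, 2 ∣ latA.form u h) ∧ ¬ 2 ∣ latA.form u x')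
    (hxH : ∀ h ∈ H, 2 ∣ latA.form x h) (hxx : 4 ∣ latA.form x x) : CanMove H x x' :=
  canMove_of_toggle hH hq hx hx' fun h => ⟨x, hxH, by omega, h, fun u _ hux => by
    rw [latA.symm x u]; omega⟩

/-- Here `z` changes the norm: vectors orthogonal to `H` pair evenly with it, while (z, z) ≡ 2
modulo 4. -/
theorem canMove_of_anisotropic {H : Set LA} {x x' z : LA}
    (hH : ∀ h ∈ H, 2 ∣ latA.form x h - latA.form x' h)
    (hq : 4 ∣ latA.form x x - latA.form x' x')
    (hx : ∃ u, (∀ h ∈ H, 2 ∣ latA.form u h) ∧ ¬ 2 ∣ latA.form u x)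
    (hx' : ∃ u, (∀ h ∈ H, 2 ∣ latA.form u h) ∧ ¬ 2 ∣ latA.form u x')
    (hz : z ∈ H) (hzH : ∀ h ∈ H, 2 ∣ latA.form z h) (hzx : 2 ∣ latA.form z x)
    (hzz : ¬ 4 ∣ latA.form z z) : CanMove H x x' :=
  canMove_of_toggle hH hq hx hx' fun h => ⟨z, hzH, hzx, by
    have := hH z hz
    rw [latA.symm z] at hzx ⊢
    omega, fun u hu _ => by
    have := hu z hz
    rw [latA.symm z u]; omega⟩

/-- If (x, x') is even, use the Eichler map of `e` and d = x + x': modulo two it sends x to x + (x,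
d) e + (x, e) d = x', because (x, d) is even and (x, e) is odd. -/
theorem canMove_of_pairing {H : Set LA} {x x' e : LA}
    (hH : ∀ h ∈ H, 2 ∣ latA.form x h - latA.form x' h)
    (hq : 4 ∣ latA.form x x - latA.form x' x') (he : e ∈ H) (heH : ∀ h ∈ H, 2 ∣ latA.form e h)
    (hee : 4 ∣ latA.form e e) (hex : ¬ 2 ∣ latA.form e x) : CanMove H x x' := by
  by_cases hxx : 2 ∣ latA.form x x'
  · have hs := latA.symm x x'
    have hse := latA.symm e x
    have hse' := latA.symm e x'
    have hHe := hH e he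
    obtain ⟨i, hi⟩ := latA.even x
    obtain ⟨g, hg, hgx⟩ := latA_exists_eichler (e := e) (d := x + x') (by
        rintro y rfl
        rw [map_smul, LinearMap.smul_apply, smul_eq_mul] at hex
        exact hex ⟨_, rfl⟩) hee (by rw [map_add]; omega)
      (by simp only [map_add, LinearMap.add_apply]; omega)
    refine ⟨g, hg, fun h hh => (hgx h).trans ?_, (hgx x).trans ?_⟩
    · obtain ⟨j, hj⟩ : 2 ∣ latA.form h (x + x') := by
        have := hH h hh
        rw [map_add, latA.symm h, latA.symm h]
        omega
      obtain ⟨k, hk⟩ := heH h hh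
      exact ⟨j • e + k • (x + x'), by rw [hj, latA.symm h e, hk]; module⟩
    · obtain ⟨j, hj⟩ : 2 ∣ latA.form x (x + x') := by
        rw [map_add]; omega
      obtain ⟨k, hk⟩ : 2 ∣ latA.form x e - 1 := by omega
      exact ⟨x + j • e + k • (x + x'), by rw [hj, eq_add_of_sub_eq hk]; module⟩
  · exact canMove_of_odd hH hq hxx

/-- The condition under which the `i`-th vector of a family can be moved while fixing the earlier
ones modulo two. -/
def StepCondition {L : Type*} [AddCommGroup L] (B : LinearMap.BilinForm ℤ L) {n : ℕ}
    (v : Fin n → L) (i : Fin n) : Prop :=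
  (∀ j, ¬ j < i) ∨
  ((∀ j < i, 2 ∣ B (v i) (v j)) ∧ 4 ∣ B (v i) (v i)) ∨
  (∃ k < i, (∀ j < i, 2 ∣ B (v k) (v j)) ∧ 2 ∣ B (v k) (v i) ∧ ¬ 4 ∣ B (v k) (v k)) ∨
  (∃ k < i, (∀ j < i, 2 ∣ B (v k) (v j)) ∧ ¬ 2 ∣ B (v k) (v i) ∧ 4 ∣ B (v k) (v k))

theorem StepCondition.congr {L L' : Type*} [AddCommGroup L] [AddCommGroup L']
    {B : LinearMap.BilinForm ℤ L} {B' : LinearMap.BilinForm ℤ L'} {n : ℕ} {v : Fin n → L}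
    {v' : Fin n → L'} (hb : ∀ i j, 2 ∣ B (v i) (v j) - B' (v' i) (v' j))
    (hq : ∀ i, 4 ∣ B (v i) (v i) - B' (v' i) (v' i)) {i : Fin n} (h : StepCondition B v i) :
    StepCondition B' v' i := by
  have h2 : ∀ i j, 2 ∣ B (v i) (v j) → 2 ∣ B' (v' i) (v' j) := fun i j h => by
    have := hb i j; omega
  obtain h | ⟨h, h4⟩ | ⟨k, hk, h, hi, h4⟩ | ⟨k, hk, h, hi, h4⟩ := h
  · exact Or.inl h
  · exact Or.inr (Or.inl ⟨fun j hj => h2 _ _ (h j hj), by have := hq i; omega⟩)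
  · exact Or.inr (Or.inr (Or.inl ⟨k, hk, fun j hj => h2 _ _ (h j hj), h2 _ _ hi, by
      have := hq k; omega⟩))
  · exact Or.inr (Or.inr (Or.inr ⟨k, hk, fun j hj => h2 _ _ (h j hj), by have := hb k i; omega, by
      have := hq k; omega⟩))

/-- Families of vectors of `U ⊕ E₈` with the same Gram matrix modulo two are equivalent under the
orthogonal group modulo two. -/
theorem exists_isometry_modTwo {n : ℕ} (v v' : Fin n → LA)
    (hb : ∀ i j, 2 ∣ latA.form (v i) (v j) - latA.form (v' i) (v' j))
    (hq : ∀ i, 4 ∣ latA.form (v i) (v i) - latA.form (v' i) (v' i))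
    (hv : ∀ i, ∃ u, (∀ j < i, 2 ∣ latA.form u (v j)) ∧ ¬ 2 ∣ latA.form u (v i))
    (hv' : ∀ i, ∃ u, (∀ j < i, 2 ∣ latA.form u (v' j)) ∧ ¬ 2 ∣ latA.form u (v' i))
    (hs : ∀ i, StepCondition latA.form v' i) :
    ∃ g, latA.IsIsometry g ∧ ∀ i, ModTwo (g (v i)) (v' i) := by
  -- Induct on the number of vectors already carried to their targets. Hypotheses `hv` and `hv'`
  -- express linear independence modulo two.
  suffices h : ∀ k : ℕ, ∃ g, latA.IsIsometry g ∧ ∀ i : Fin n, i.val < k → ModTwo (g (v i)) (v' i) by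
    obtain ⟨g, hg, h⟩ := h n
    exact ⟨g, hg, fun i => h i i.2⟩
  intro k
  induction k with
  | zero => exact ⟨LinearEquiv.refl ℤ LA, fun _ _ => rfl, fun i hi => absurd hi (Nat.not_lt_zero _)⟩
  | succ k ih =>
    obtain ⟨g, hg, hgv⟩ := ih
    by_cases hk : k < n
    swap
    · exact ⟨g, hg, fun i _ => hgv i (i.2.trans_le (not_lt.1 hk))⟩
    let i : Fin n := ⟨k, hk⟩
    suffices h : CanMove {h | ∃ j < i, h = v' j} (g (v i)) (v' i) by
      obtain ⟨g', hg', hH, hx⟩ := h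
      refine ⟨g.trans g', hg.trans hg', fun j hj => ?_⟩
      obtain hj | hj := Nat.lt_succ_iff_lt_or_eq.1 hj
      · exact ((hgv j hj).map g'.toLinearMap).trans (hH _ ⟨j, hj, rfl⟩)
      · obtain rfl : j = i := Fin.ext hj
        exact hx
    have hH : ∀ h ∈ {h | ∃ j < i, h = v' j}, 2 ∣ latA.form (g (v i)) h - latA.form (v' i) h := by
      rintro _ ⟨j, hj, rfl⟩
      have h1 := (hgv j hj).form_right latA (g (v i))
      have h2 := hb i j
      rw [hg] at h1
      omega
    have hQ : 4 ∣ latA.form (g (v i)) (g (v i)) - latA.form (v' i) (v' i) := by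
      rw [hg]; exact hq i
    have hx : ∃ u, (∀ h ∈ {h | ∃ j < i, h = v' j}, 2 ∣ latA.form u h) ∧
        ¬ 2 ∣ latA.form u (g (v i)) := by
      obtain ⟨u, hu, hui⟩ := hv i
      refine ⟨g u, ?_, by rwa [hg]⟩
      rintro _ ⟨j, hj, rfl⟩
      have h1 := (hgv j hj).form_right latA (g u)
      have h2 := hu j hj
      rw [hg] at h1
      omega
    have hx' : ∃ u, (∀ h ∈ {h | ∃ j < i, h = v' j}, 2 ∣ latA.form u h) ∧
        ¬ 2 ∣ latA.form u (v' i) := by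
      obtain ⟨u, hu, hui⟩ := hv' i
      refine ⟨u, ?_, hui⟩
      rintro _ ⟨j, hj, rfl⟩
      exact hu j hj
    obtain h | ⟨h, h4⟩ | ⟨l, hl, h, h2, h4⟩ | ⟨l, hl, h, h2, h4⟩ := hs i
    · exact canMove_of_forall_not_mem (by rintro _ ⟨j, hj, rfl⟩; exact h j hj) hQ hx hx'
    · refine canMove_of_isotropic hH hQ hx hx' ?_ (by omega)
      rintro _ ⟨j, hj, rfl⟩
      have h1 := hH _ ⟨j, hj, rfl⟩
      have h2 := h j hj
      omega
    · refine canMove_of_anisotropic hH hQ hx hx' ⟨l, hl, rfl⟩ ?_ ?_ h4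
      · rintro _ ⟨j, hj, rfl⟩
        exact h j hj
      · have h1 := hH _ ⟨l, hl, rfl⟩
        rw [latA.symm] at h2 ⊢
        omega
    · refine canMove_of_pairing hH hQ ⟨l, hl, rfl⟩ ?_ h4 ?_
      · rintro _ ⟨j, hj, rfl⟩
        exact h j hj
      · have h1 := hH _ ⟨l, hl, rfl⟩
        rw [latA.symm] at h2 ⊢
        omega

/-! ### A family spanning the orthogonal complement of a class of `E₈` modulo two -/

/-- Vectors of `E₈` spanning the orthogonal complement of `classRep c` modulo two. -/
def glueFamily (c : ℤ) : Fin 7 → Fin 8 → ℤ :=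
  if c % 2 = 0 then
    ![![0, 0, 0, 0, 0, 1, 0, 1], ![0, 0, 0, 0, 1, 0, 0, 1], ![0, 0, 0, 1, 0, 0, 1, 0],
      ![0, 0, 0, 1, 0, 1, 0, 0], ![0, 0, 1, 0, 0, 1, 1, 0], ![0, 0, 1, 1, 0, 0, 1, 1],
      ![0, 1, 1, 0, 0, 0, 0, 0]]
  else
    ![![0, 1, 0, 0, 1, 0, 1, 0], ![0, 0, 0, 0, 0, 0, 1, 0], ![0, 0, 0, 0, 0, 1, 0, 0],
      ![0, 0, 0, 1, 0, 0, 0, 0], ![0, 0, 1, 0, 0, 0, 0, 0], ![0, 1, 1, 0, 0, 0, 0, 0],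
      ![1, 0, 0, 1, 0, 0, 0, 0]]

/-- Vectors of `E₈` dual to `glueFamily c` modulo two. -/
def glueDual (c : ℤ) : Fin 7 → Fin 8 → ℤ :=
  if c % 2 = 0 then
    ![![0, 0, 0, 0, 1, 0, 0, 1], ![0, 0, 0, 0, 0, 1, 0, 1], ![0, 0, 0, 1, 0, 1, 0, 0],
      ![0, 0, 0, 1, 0, 0, 1, 0], ![0, 0, 1, 1, 0, 0, 1, 1], ![0, 0, 1, 0, 0, 1, 1, 0],
      ![1, 0, 0, 1, 0, 1, 0, 1]]
  else
    ![![0, 0, 0, 0, 0, 1, 0, 1], ![0, 0, 0, 0, 0, 1, 0, 0], ![0, 0, 0, 0, 0, 0, 1, 0],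
      ![0, 0, 1, 0, 0, 0, 0, 0], ![0, 0, 0, 1, 0, 0, 0, 0], ![1, 0, 0, 1, 0, 0, 0, 0],
      ![0, 1, 1, 0, 0, 0, 0, 0]]

theorem glueFamily_orthogonal (c : ℤ) (i : Fin 7) :
    2 ∣ formE8 (classRep c) (glueFamily c i) := by
  revert i
  unfold classRep glueFamily
  simp only [formE8_coord]
  split_ifs <;> decide

/-- For even `c` the family is three hyperbolic pairs followed by the class of `classRep c`, which
is singular: the first member of a pair is isotropic and orthogonal to its predecessors, the second
pairs with the first. For odd `c` the anisotropic class of `classRep c` comes first and handles all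
later vectors. -/
theorem glueFamily_step (c : ℤ) (i : Fin 7) : StepCondition formE8 (glueFamily c) i := by
  revert i
  unfold StepCondition glueFamily
  simp only [formE8_coord]
  split_ifs <;> decide

theorem glueDual_apply (c : ℤ) (i j : Fin 7) :
    2 ∣ formE8 (glueDual c i) (glueFamily c j) - if i = j then 1 else 0 := by
  revert i j
  unfold glueDual glueFamily
  simp only [formE8_coord]
  split_ifs <;> decide

theorem exists_glueFamily_sum {c : ℤ} {n : Fin 8 → ℤ} (h : 2 ∣ formE8 (classRep c) n) :
    ∃ (k : Fin 7 → ℤ) (y : Fin 8 → ℤ), n = ∑ i, k i • glueFamily c i + (2 : ℤ) • y := by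
  suffices h : ∃ y, n - ∑ i, formE8 (glueDual c i) n • glueFamily c i = (2 : ℤ) • y by
    obtain ⟨y, hy⟩ := h
    exact ⟨_, y, by rw [← hy]; abel⟩
  refine exists_two_smul_of_dvd fun l => ?_
  revert h
  unfold classRep glueDual glueFamily
  simp only [formE8_coord, Fin.sum_univ_seven]
  split_ifs <;> intro h <;> fin_cases l <;> simp [frameCoord] at h ⊢ <;> omega

/-! ### Glue vectors -/

/-- `z` represents twice the generator of the orthogonal complement of the gluing group of
`M^⊥`. -/
structure IsGlueVector (M : Submodule ℤ LS) (z : LS) : Prop where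
  mem : z ∈ latS.perp M
  ne : ∀ y, z ≠ (2 : ℤ) • y
  even : ∀ s, 2 ∣ latS.form z s
  unique : ∀ n ∈ latS.perp M, (∀ s, 2 ∣ latS.form n s) →
    (∃ y, n = (2 : ℤ) • y) ∨ ∃ y, n = z + (2 : ℤ) • y

/-- An identification of `E₈(2)` with the orthogonal complement of the image of `f`, compatible with
glue vectors. -/
structure IsMarking (f : LA →ₗ[ℤ] LS) (c : ℤ) (g : (Fin 8 → ℤ) →ₗ[ℤ] LS) : Prop where
  inner : ∀ x y, latS.form (g x) (g y) = -2 * formE8 x y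
  mem : ∀ x, g x ∈ latS.perp (LinearMap.range f)
  surj : ∀ n ∈ latS.perp (LinearMap.range f), ∃ x, g x = n
  inj : Function.Injective g
  glue : ∀ x, (∃ a s, f a + g x = (2 : ℤ) • s) ↔ 2 ∣ formE8 (classRep c) x

namespace IsEnriquesEmbedding
variable {f : LA →ₗ[ℤ] LS} (hf : IsEnriquesEmbedding f)
include hf

/-- Choose the identification with E₈(2) that sends `classRep c` to `z` modulo two. Then Γ_N, being
the orthogonal complement of `z`, corresponds to that of `classRep c`. -/
theorem exists_marking {z : LS} (hz : IsGlueVector (LinearMap.range f) z) {c : ℤ}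
    (hc : latS.form z z = -4 * c) : ∃ g, IsMarking f c g := by
  obtain ⟨B, hB, hE⟩ := hf.exists_formN
  have hBz : latS.form z z = -2 * B ⟨z, hz.mem⟩ ⟨z, hz.mem⟩ := hB ⟨z, hz.mem⟩ ⟨z, hz.mem⟩
  obtain ⟨e, he, y, hy⟩ := hE.exists_equiv (z := ⟨z, hz.mem⟩) (c := c)
    (fun y hy => hz.ne y (congrArg Subtype.val hy)) (by omega)
  refine ⟨(latS.perp (LinearMap.range f)).subtype ∘ₗ e.toLinearMap, fun x y => ?_, fun x => (e x).2,
    fun n hn => ⟨e.symm ⟨n, hn⟩, ?_⟩, fun x y h => e.injective (Subtype.ext h), fun x => ?_⟩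
  · change latS.form (e x) (e y) = _
    rw [hB, he]
  · change ((e (e.symm ⟨n, hn⟩) : latS.perp (LinearMap.range f)) : LS) = n
    rw [e.apply_symm_apply]
  · have hzx : ∀ n : latS.perp (LinearMap.range f),
        2 ∣ B ⟨z, hz.mem⟩ n ↔ 2 ∣ formE8 (classRep c) (e.symm n) := fun n => by
      have h1 := congrArg (fun w => B w n) hy
      simp only [map_add, map_smul, LinearMap.add_apply, LinearMap.smul_apply, smul_eq_mul] at h1
      have h2 := he (classRep c) (e.symm n)
      rw [e.apply_symm_apply] at h2
      omega
    have hx := hzx (e x)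
    rw [e.symm_apply_apply] at hx
    rw [← hx]
    change (∃ a s, f a + ((e x : latS.perp (LinearMap.range f)) : LS) = (2 : ℤ) • s) ↔ _
    generalize e x = n
    constructor
    · rintro ⟨a, s, hs⟩
      have h1 := congrArg (latS.form z) hs
      rw [map_add, map_smul, smul_eq_mul, latS.symm, mem_perp.1 hz.mem, zero_add] at h1
      have h2 : latS.form z n = -2 * B ⟨z, hz.mem⟩ n := hB ⟨z, hz.mem⟩ n
      have h3 := hz.even s
      omega
    · intro hn
      by_contra hno
      -- `H` is the preimage of Γ_N in N. A parity functional vanishing on `H` is represented by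
      -- some `m` with even products with S, so `m` is 0 or `z` modulo two, and both are even on
      -- `n`.
      have hsub : ∃ H : Submodule ℤ (latS.perp (LinearMap.range f)),
          ∀ m, m ∈ H ↔ ∃ a s, f a + (m : LS) = (2 : ℤ) • s := by
        refine ⟨((LinearMap.range f) ⊔ LinearMap.range ((2 : ℤ) • LinearMap.id (M := LS))).comap
          (Submodule.subtype _), fun m => ?_⟩
        rw [Submodule.mem_comap, Submodule.mem_sup]
        constructor
        · rintro ⟨_, ⟨a, rfl⟩, _, ⟨s, rfl⟩, h⟩
          exact ⟨-a, s, by rw [map_neg]; exact neg_add_eq_of_eq_add h.symm⟩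
        · rintro ⟨a, s, h⟩
          exact ⟨_, ⟨-a, rfl⟩, _, ⟨s, rfl⟩, by rw [map_neg]; exact neg_add_eq_of_eq_add h.symm⟩
      obtain ⟨H, hH⟩ := hsub
      obtain ⟨φ, hφ, hφn⟩ := exists_parity_functional H
        (fun y => (hH _).2 ⟨0, y, by rw [map_zero, zero_add]; rfl⟩) (x := n)
        (fun h => hno ((hH n).1 h))
      obtain ⟨m, hm⟩ := hE.unimodular φ
      have hmeven : ∀ s, 2 ∣ latS.form m s := fun s => by
        obtain ⟨a, ha⟩ := hf.exists_decomp_two_smul s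
        have h1 := hφ ⟨_, ha⟩ ((hH _).2 ⟨a, s, by simp⟩)
        rw [← hm] at h1
        have h2 := hB m ⟨_, ha⟩
        have h3 := mem_perp.1 m.2 a
        simp only [map_sub, map_smul, smul_eq_mul, latS.symm m (f a)] at h2
        omega
      rw [← hm] at hφn
      obtain ⟨w, hw⟩ | ⟨w, hw⟩ := hz.unique m m.2 hmeven
      · have hwN : w ∈ latS.perp (LinearMap.range f) :=
          perp_primitive 2 w two_ne_zero (hw ▸ m.2)
        obtain rfl : m = (2 : ℤ) • ⟨w, hwN⟩ := Subtype.ext hw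
        rw [map_smul, LinearMap.smul_apply, smul_eq_mul] at hφn
        exact hφn ⟨_, rfl⟩
      · have hwN : w ∈ latS.perp (LinearMap.range f) :=
          perp_primitive 2 w two_ne_zero (by
            rw [← sub_eq_iff_eq_add'.2 hw]
            exact Submodule.sub_mem _ m.2 hz.mem)
        obtain rfl : m = ⟨z, hz.mem⟩ + (2 : ℤ) • ⟨w, hwN⟩ := Subtype.ext hw
        simp only [map_add, map_smul, LinearMap.add_apply, LinearMap.smul_apply,
          smul_eq_mul] at hφn
        omega

variable {c : ℤ} {g : (Fin 8 → ℤ) →ₗ[ℤ] LS} (hg : IsMarking f c g)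
include hg

/-- From 4(s, s) = 2(a, a) - 2(n, n) with (s, s) even: gluing preserves the quadratic form modulo
two. -/
theorem glue_norm {a : LA} {n : Fin 8 → ℤ} {s : LS} (h : f a + g n = (2 : ℤ) • s) :
    4 ∣ formE8 n n - latA.form a a := by
  have h1 := congrArg (fun x => latS.form x x) h
  have h2 := mem_perp.1 (hg.mem n) a
  obtain ⟨i, hi⟩ := latS.even s
  simp only [map_add, map_smul, LinearMap.add_apply, LinearMap.smul_apply, smul_eq_mul, hf.inner,
    hg.inner, latS.symm (g n), h2, hi] at h1
  omega

theorem glue_inner {a a' : LA} {n n' : Fin 8 → ℤ} {s s' : LS} (h : f a + g n = (2 : ℤ) • s)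
    (h' : f a' + g n' = (2 : ℤ) • s') : 2 ∣ formE8 n n' - latA.form a a' := by
  have h1 := congrArg₂ (fun x y => latS.form x y) h h'
  have h2 := mem_perp.1 (hg.mem n') a
  have h3 := mem_perp.1 (hg.mem n) a'
  simp only [map_add, map_smul, LinearMap.add_apply, LinearMap.smul_apply, smul_eq_mul, hf.inner,
    hg.inner, latS.symm (g n), h2, h3] at h1
  omega

omit hf in
theorem exists_two_smul_of_glue {n : Fin 8 → ℤ} {s : LS} (h : g n = (2 : ℤ) • s) :
    ∃ y, n = (2 : ℤ) • y := by
  obtain ⟨y, hy⟩ := hg.surj s (perp_primitive 2 s two_ne_zero (h ▸ hg.mem n))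
  exact ⟨y, hg.inj (by rw [h, map_smul, hy])⟩

omit hf in
-- Linear independence of the `v i` modulo two, transported from `glueFamily`. `K` collects the `a`
-- glued to some `n` having even product with `glueDual c i`; it contains the other `v j` but not `v
-- i`, since `a` determines `n` modulo two.
theorem exists_glue_dual {v : Fin 7 → LA} {s : Fin 7 → LS}
    (hv : ∀ i, f (v i) + g (glueFamily c i) = (2 : ℤ) • s i) (i : Fin 7) :
    ∃ u, (∀ j < i, 2 ∣ latA.form u (v j)) ∧ ¬ 2 ∣ latA.form u (v i) := by
  let K : Submodule ℤ LA :=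
    { carrier := {a | ∃ n s, 2 ∣ formE8 (glueDual c i) n ∧ f a + g n = (2 : ℤ) • s}
      zero_mem' := ⟨0, 0, by simp, by simp⟩
      add_mem' := by
        rintro a a' ⟨n, s, h, hs⟩ ⟨n', s', h', hs'⟩
        refine ⟨n + n', s + s', by rw [map_add]; exact dvd_add h h', ?_⟩
        rw [smul_add, ← hs, ← hs', map_add, map_add]; abel
      smul_mem' := by
        rintro k a ⟨n, s, h, hs⟩
        refine ⟨k • n, k • s, by rw [map_smul]; exact h.mul_left k, ?_⟩
        rw [smul_comm, ← hs, map_smul, map_smul, smul_add] }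
  obtain ⟨φ, hφ, hφv⟩ := exists_parity_functional K
    (fun a => ⟨0, f a, by simp, by rw [map_smul, map_zero, add_zero]⟩) (x := v i) (by
      rintro ⟨n, t, hn, ht⟩
      obtain ⟨y, hy⟩ := exists_two_smul_of_glue (f := f) hg (n := n - glueFamily c i) (s := t - s i) (by
        rw [smul_sub, ← hv, ← ht, map_sub]; abel)
      have h1 := glueDual_apply c i i
      rw [if_pos rfl] at h1
      rw [eq_add_of_sub_eq hy, map_add, map_smul, smul_eq_mul] at hn
      omega)
  obtain ⟨u, hu⟩ := latA_unimodular φ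
  refine ⟨u, fun j hj => ?_, by rwa [hu]⟩
  rw [hu]
  refine hφ _ ⟨glueFamily c j, s j, ?_, hv j⟩
  have h1 := glueDual_apply c i j
  rw [if_neg hj.ne'] at h1
  omega

end IsEnriquesEmbedding

/-! ### Extension of isometries to `S` -/

theorem IsEnriquesEmbedding.exists_decomp_marking {f : LA →ₗ[ℤ] LS} (hf : IsEnriquesEmbedding f)
    {c : ℤ} {g : (Fin 8 → ℤ) →ₗ[ℤ] LS} (hg : IsMarking f c g) (s : LS) :
    ∃ a n, f a + g n = (2 : ℤ) • s := by
  obtain ⟨a, ha⟩ := hf.exists_decomp_two_smul s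
  obtain ⟨n, hn⟩ := hg.surj _ ha
  exact ⟨a, n, by rw [hn]; abel⟩

/-- A pair `(h, id)` that is compatible with the gluing induces an endomorphism of `S`. -/
theorem IsEnriquesEmbedding.exists_extension {f f' : LA →ₗ[ℤ] LS} (hf : IsEnriquesEmbedding f)
    {c : ℤ} {g g' : (Fin 8 → ℤ) →ₗ[ℤ] LS} (hg : IsMarking f c g) (h : LA →ₗ[ℤ] LA)
    (hc : ∀ a n s, f a + g n = (2 : ℤ) • s → ∃ s', f' (h a) + g' n = (2 : ℤ) • s') :
    ∃ T : LS →ₗ[ℤ] LS, ∀ a n s, f a + g n = (2 : ℤ) • s → f' (h a) + g' n = (2 : ℤ) • T s := by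
  have hdec := hf.exists_decomp_marking hg
  have hinj : ∀ a n, f a + g n = 0 → a = 0 ∧ n = 0 := fun a n h0 => by
    have ha : a = 0 := by
      apply latA_eq_zero
      intro b
      have h1 : latS.form (f b) (f a + g n) = 0 := by rw [h0, map_zero]
      rw [map_add, hf.inner, mem_perp.1 (hg.mem n) b] at h1
      rw [latA.symm]; omega
    subst ha
    rw [map_zero, zero_add] at h0
    exact ⟨rfl, hg.inj (by rw [h0, map_zero])⟩
  have huniq : ∀ a n a' n', f a + g n = f a' + g n' → a = a' ∧ n = n' := fun a n a' n' h => by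
    obtain ⟨h1, h2⟩ := hinj (a - a') (n - n') (by
      rw [map_sub, map_sub, sub_add_sub_comm, h, sub_self])
    exact ⟨sub_eq_zero.1 h1, sub_eq_zero.1 h2⟩
  have hT : ∀ s : LS, ∃ s', ∀ a n, f a + g n = (2 : ℤ) • s → f' (h a) + g' n = (2 : ℤ) • s' := by
    intro s
    obtain ⟨a, n, hs⟩ := hdec s
    obtain ⟨s', hs'⟩ := hc a n s hs
    refine ⟨s', fun a' n' hs1 => ?_⟩
    obtain ⟨rfl, rfl⟩ := huniq a n a' n' (by rw [hs, hs1])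
    exact hs'
  choose T hT using hT
  refine ⟨{ toFun := T, map_add' := fun s t => ?_, map_smul' := fun k s => ?_ },
    fun a n s => hT s a n⟩
  · obtain ⟨a, n, hs⟩ := hdec s
    obtain ⟨a', n', ht⟩ := hdec t
    apply two_smul_injective
    rw [smul_add, ← hT _ _ _ hs, ← hT _ _ _ ht, ← hT (s + t) (a + a') (n + n') (by
      rw [smul_add, ← hs, ← ht, map_add, map_add]; abel)]
    simp only [map_add]; abel
  · obtain ⟨a, n, hs⟩ := hdec s
    apply two_smul_injective
    rw [smul_comm, RingHom.id_apply, ← hT _ _ _ hs, ← hT (k • s) (k • a) (k • n) (by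
      rw [smul_comm, ← hs, map_smul, map_smul, smul_add])]
    simp only [map_smul, smul_add]

/-- Γ_N is spanned by `glueFamily` and, M being primitive, `a` is determined by `n` modulo two. So
compatibility on the family implies it everywhere. -/
theorem exists_glue_of_modTwo {f f' : LA →ₗ[ℤ] LS} (hf : IsEnriquesEmbedding f) {c : ℤ}
    {g g' : (Fin 8 → ℤ) →ₗ[ℤ] LS} (hg : IsMarking f c g) {h : LA →ₗ[ℤ] LA}
    {v v' : Fin 7 → LA} {t t' : Fin 7 → LS}
    (hv : ∀ i, f (v i) + g (glueFamily c i) = (2 : ℤ) • t i)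
    (hv' : ∀ i, f' (v' i) + g' (glueFamily c i) = (2 : ℤ) • t' i)
    (hh : ∀ i, ModTwo (h (v i)) (v' i)) {a : LA} {n : Fin 8 → ℤ} {s : LS}
    (hs : f a + g n = (2 : ℤ) • s) : ∃ s', f' (h a) + g' n = (2 : ℤ) • s' := by
  obtain ⟨k, y, rfl⟩ := exists_glueFamily_sum ((hg.glue n).1 ⟨a, s, hs⟩)
  obtain ⟨b, hb⟩ := hf.exists_two_smul_of_range (a := a - ∑ i, k i • v i)
    (s := s - ∑ i, k i • t i - g y) (by
      have h1 : ∑ i, k i • (2 : ℤ) • t i = ∑ i, k i • (f (v i) + g (glueFamily c i)) := by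
        simp_rw [hv]
      simp only [smul_sub, Finset.smul_sum, smul_comm (2 : ℤ), h1]
      rw [← hs]
      simp only [map_sub, map_add, map_sum, map_smul, smul_add, Finset.sum_add_distrib]
      abel)
  choose w hw using hh
  refine ⟨∑ i, k i • (t' i + f' (w i)) + f' (h b) + g' y, ?_⟩
  have h1 : ∑ i, k i • (2 : ℤ) • t' i = ∑ i, k i • (f' (v' i) + g' (glueFamily c i)) := by
    simp_rw [hv']
  rw [eq_add_of_sub_eq hb]
  simp only [smul_add, Finset.smul_sum, smul_comm (2 : ℤ), Finset.sum_add_distrib, h1, map_add,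
    map_sum, map_smul, hw]
  abel

/-- Enriques embeddings with glue vectors of the same type are equivalent under `O(S)`. -/
theorem IsEnriquesEmbedding.exists_isometry {f f' : LA →ₗ[ℤ] LS} (hf : IsEnriquesEmbedding f)
    (hf' : IsEnriquesEmbedding f') {c : ℤ} {g g' : (Fin 8 → ℤ) →ₗ[ℤ] LS} (hg : IsMarking f c g)
    (hg' : IsMarking f' c g') : latS.SameOrbit (LinearMap.range f) (LinearMap.range f') := by
  choose v t hv using fun i => (hg.glue _).2 (glueFamily_orthogonal c i)
  choose v' t' hv' using fun i => (hg'.glue _).2 (glueFamily_orthogonal c i)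
  obtain ⟨h, hh, hhv⟩ := exists_isometry_modTwo v v'
    (fun i j => by
      have h1 := hf.glue_inner hg (hv i) (hv j)
      have h2 := hf'.glue_inner hg' (hv' i) (hv' j)
      omega)
    (fun i => by
      have h1 := hf.glue_norm hg (hv i)
      have h2 := hf'.glue_norm hg' (hv' i)
      omega)
    (exists_glue_dual hg hv) (exists_glue_dual hg' hv')
    (fun i => (glueFamily_step c i).congr (fun i j => hf'.glue_inner hg' (hv' i) (hv' j))
      (fun i => hf'.glue_norm hg' (hv' i)))
  -- The isometry `h` respects the gluing, as does its inverse; the two induced endomorphisms of S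
  -- are mutually inverse.
  obtain ⟨T, hT⟩ := hf.exists_extension hg h.toLinearMap fun a n s hs =>
    exists_glue_of_modTwo hf hg hv hv' hhv hs
  obtain ⟨T', hT'⟩ := hf'.exists_extension hg' h.symm.toLinearMap fun a n s hs =>
    exists_glue_of_modTwo (f' := f) (g' := g) hf' hg' hv' hv (h := h.symm.toLinearMap)
      (fun i => by simpa using ((hhv i).map h.symm.toLinearMap).symm) hs
  have hTT : T' ∘ₗ T = LinearMap.id := by
    refine LinearMap.ext fun s => ?_
    obtain ⟨a, n, hs⟩ := hf.exists_decomp_marking hg s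
    apply two_smul_injective
    have := hT' _ _ _ (hT _ _ _ hs)
    rw [LinearMap.comp_apply, ← this, LinearMap.id_apply, ← hs]
    simp
  have hTT' : T ∘ₗ T' = LinearMap.id := by
    refine LinearMap.ext fun s => ?_
    obtain ⟨a, n, hs⟩ := hf'.exists_decomp_marking hg' s
    apply two_smul_injective
    have := hT _ _ _ (hT' _ _ _ hs)
    rw [LinearMap.comp_apply, ← this, LinearMap.id_apply, ← hs]
    simp
  refine ⟨⟨LinearEquiv.ofLinearMap T T' hTT' hTT, fun s s' => ?_⟩, ?_⟩
  · change latS.form (T s) (T s') = latS.form s s'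
    obtain ⟨a, n, hs⟩ := hf.exists_decomp_marking hg s
    obtain ⟨a', n', hs'⟩ := hf.exists_decomp_marking hg s'
    have h1 := congrArg₂ (fun x y => latS.form x y) hs hs'
    have h2 := congrArg₂ (fun x y => latS.form x y) (hT _ _ _ hs) (hT _ _ _ hs')
    have e1 := mem_perp.1 (hg.mem n') a
    have e2 := mem_perp.1 (hg.mem n) a'
    have e3 := mem_perp.1 (hg'.mem n') (h a)
    have e4 := mem_perp.1 (hg'.mem n) (h a')
    have e5 := hh a a'
    simp only [map_add, map_smul, LinearMap.add_apply, LinearMap.smul_apply, smul_eq_mul,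
      hf.inner, hg.inner, hf'.inner, hg'.inner, latS.symm (g n), latS.symm (g' n), e1, e2, e3,
      e4, e5, LinearEquiv.coe_coe] at h1 h2
    omega
  · have hTf : ∀ a, T (f a) = f' (h a) := fun a => by
      apply two_smul_injective
      rw [← hT ((2 : ℤ) • a) 0 (f a) (by rw [map_smul, map_zero, add_zero])]
      change f' (h ((2 : ℤ) • a)) + g' 0 = _
      rw [map_smul, map_smul, map_zero, add_zero]
    change (LinearMap.range f).map T = LinearMap.range f'
    ext s
    constructor
    · rintro ⟨_, ⟨a, rfl⟩, rfl⟩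
      exact ⟨h a, (hTf a).symm⟩
    · rintro ⟨a, rfl⟩
      exact ⟨_, ⟨h.symm a, rfl⟩, by rw [hTf, h.apply_symm_apply]⟩

/-! ### Norms of glue vectors -/

theorem IsEnriquesEmbedding.exists_isGlueVector {f : LA →ₗ[ℤ] LS} (hf : IsEnriquesEmbedding f) :
    ∃ z, IsGlueVector (LinearMap.range f) z := by
  obtain ⟨z, h1, h2, h3, h4⟩ := hf.exists_glue_vector
  exact ⟨z, h1, h2, h3, h4⟩

namespace IsGlueVector

variable {M M' : Submodule ℤ LS} {z z' : LS}

theorem norm_congr (hz : IsGlueVector M z) (hz' : IsGlueVector M z') :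
    8 ∣ latS.form z z - latS.form z' z' := by
  obtain ⟨y, hy⟩ | ⟨y, rfl⟩ := hz.unique z' hz'.mem hz'.even
  · exact absurd hy (hz'.ne y)
  · have h1 := hz.even y
    have h2 := latS.symm z y
    obtain ⟨i, hi⟩ := latS.even y
    simp only [map_add, map_smul, LinearMap.add_apply, LinearMap.smul_apply, smul_eq_mul]
    omega

theorem map (hz : IsGlueVector M z) (φ : latS.form.IsometryEquiv latS.form) :
    IsGlueVector (M.map φ.toLinearEquiv.toLinearMap) (φ.toLinearEquiv z) := by
  have hφ : ∀ x y, latS.form (φ.toLinearEquiv x) (φ.toLinearEquiv y) = latS.form x y := φ.map_app'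
  have hφ' : ∀ x y, latS.form (φ.toLinearEquiv x) y = latS.form x (φ.toLinearEquiv.symm y) :=
    fun x y => by rw [← hφ x, φ.toLinearEquiv.apply_symm_apply]
  constructor
  · rintro _ ⟨m, hm, rfl⟩
    exact (hφ m z).trans (hz.mem m hm)
  · intro y hy
    exact hz.ne (φ.toLinearEquiv.symm y) (by rw [← map_smul, ← hy, LinearEquiv.symm_apply_apply])
  · intro s
    rw [hφ']
    exact hz.even _
  · intro n hn hns
    have h := hz.unique (φ.toLinearEquiv.symm n) (fun m hm => by
      have h1 : latS.form (φ.toLinearEquiv m) n = 0 := hn _ ⟨m, hm, rfl⟩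
      rw [hφ'] at h1
      exact h1) (fun s => by
      rw [latS.symm, ← hφ', latS.symm]
      exact hns _)
    simp_rw [LinearEquiv.symm_apply_eq, map_add, map_smul] at h
    obtain ⟨y, hy⟩ | ⟨y, hy⟩ := h
    · exact Or.inl ⟨_, hy⟩
    · exact Or.inr ⟨_, hy⟩

end IsGlueVector

/-- The norm of the glue vector modulo eight classifies Enriques sublattices. -/
theorem sameOrbit_iff {M M' : Submodule ℤ LS} (hM : IsEnriquesSublattice M)
    (hM' : IsEnriquesSublattice M') {z z' : LS} (hz : IsGlueVector M z) (hz' : IsGlueVector M' z') :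
    latS.SameOrbit M M' ↔ 8 ∣ latS.form z z - latS.form z' z' := by
  constructor
  · rintro ⟨φ, rfl⟩
    have h1 := (hz.map φ).norm_congr hz'
    have h2 : latS.form (φ.toLinearEquiv z) (φ.toLinearEquiv z) = latS.form z z := φ.map_app' z z
    rwa [h2] at h1
  · intro h
    obtain ⟨f, hf, rfl⟩ := hM.exists_embedding
    obtain ⟨f', hf', rfl⟩ := hM'.exists_embedding
    obtain ⟨i, hi⟩ := hf.four_dvd_perp_norm hz.mem
    obtain ⟨j, hj⟩ := hf'.four_dvd_perp_norm hz'.mem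
    obtain ⟨g, hg⟩ := hf.exists_marking hz (c := -i) (by omega)
    obtain ⟨g', hg'⟩ := hf'.exists_marking hz' (c := -j) (by omega)
    have hij : classRep (-j) = classRep (-i) := by
      unfold classRep
      rw [show (-j) % 2 = (-i) % 2 by omega]
    exact hf.exists_isometry hf' hg
      ⟨hg'.inner, hg'.mem, hg'.surj, hg'.inj, fun x => by rw [hg'.glue, hij]⟩

/-! ### The discriminant group of the orthogonal complement -/

namespace EvenForm

variable {L : Type*} [AddCommGroup L] (S : EvenForm L)

theorem formQ_tmul (a b : ℚ) (x y : L) : S.formQ (a ⊗ₜ x) (b ⊗ₜ y) = a * b * S.form x y := by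
  rw [formQ, LinearMap.BilinForm.baseChange_tmul, zsmul_eq_mul, mul_comm]

theorem formQ_lTensor_subtype (N : Submodule ℤ L) (x y : ℚ ⊗[ℤ] N) :
    S.formQ (N.subtype.lTensor ℚ x) (N.subtype.lTensor ℚ y) = (S.restrict N).formQ x y := by
  induction x with
  | zero => simp
  | add x x' hx hx' => rw [map_add, map_add, map_add, LinearMap.add_apply, LinearMap.add_apply, hx, hx']
  | tmul a m =>
    induction y with
    | zero => simp
    | add y y' hy hy' => rw [map_add, map_add, map_add, hy, hy']
    | tmul b n =>
      rw [LinearMap.lTensor_tmul, LinearMap.lTensor_tmul, formQ_tmul, formQ_tmul]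
      rfl

theorem formQ_lTensor_perp (M : Submodule ℤ L) (x : ℚ ⊗[ℤ] M) (y : ℚ ⊗[ℤ] S.perp M) :
    S.formQ (M.subtype.lTensor ℚ x) ((S.perp M).subtype.lTensor ℚ y) = 0 := by
  induction x with
  | zero => simp
  | add x x' hx hx' => rw [map_add, map_add, LinearMap.add_apply, hx, hx', add_zero]
  | tmul a m =>
    induction y with
    | zero => simp
    | add y y' hy hy' => rw [map_add, map_add, hy, hy', add_zero]
    | tmul b n =>
      have h : S.form m n = 0 := n.2 m m.2
      rw [LinearMap.lTensor_tmul, LinearMap.lTensor_tmul, formQ_tmul]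
      simp [h]

theorem mem_dual {x : ℚ ⊗[ℤ] L} : x ∈ S.dual ↔ ∀ y : L, ∃ k : ℤ, S.formQ x (1 ⊗ₜ y) = k := by
  constructor
  · intro h y
    obtain ⟨k, hk⟩ := Submodule.mem_one.1 (h (1 ⊗ₜ y) ⟨y, rfl⟩)
    exact ⟨k, hk.symm⟩
  · rintro h _ ⟨y, rfl⟩
    obtain ⟨k, hk⟩ := h y
    exact Submodule.mem_one.2 ⟨k, hk.symm⟩

theorem exists_smul_eq_one_tmul (x : ℚ ⊗[ℤ] L) : ∃ (k : ℤ) (n : L), k ≠ 0 ∧ (k : ℚ) • x = 1 ⊗ₜ n := by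
  induction x with
  | zero => exact ⟨1, 0, one_ne_zero, by simp⟩
  | tmul a n =>
    refine ⟨a.den, a.num • n, by exact_mod_cast a.den_ne_zero, ?_⟩
    rw [TensorProduct.smul_tmul', ← TensorProduct.smul_tmul, zsmul_one, smul_eq_mul]
    congr 1
    exact_mod_cast Rat.den_mul_eq_num a
  | add x y hx hy =>
    obtain ⟨k, n, hk, hn⟩ := hx
    obtain ⟨l, m, hl, hm⟩ := hy
    refine ⟨k * l, l • n + k • m, mul_ne_zero hk hl, ?_⟩
    rw [TensorProduct.tmul_add, TensorProduct.tmul_smul, TensorProduct.tmul_smul, ← hn, ← hm,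
      ← Int.cast_smul_eq_zsmul ℚ, ← Int.cast_smul_eq_zsmul ℚ]
    push_cast
    module

theorem half_mem_dual {x : L} (h : ∀ y, 2 ∣ S.form x y) : (1 / 2 : ℚ) ⊗ₜ[ℤ] x ∈ S.dual := by
  rw [mem_dual]
  intro y
  obtain ⟨k, hk⟩ := h y
  exact ⟨k, by rw [formQ_tmul, hk]; push_cast; ring⟩

end EvenForm

/-- This is N* = N/2. If kx = n lies in N, then k divides all products of 2n under the unimodular
form `B`, so 2n = km and x = m/2. -/
theorem IsEnriquesEmbedding.exists_half {f : LA →ₗ[ℤ] LS} (hf : IsEnriquesEmbedding f)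
    {x : ℚ ⊗[ℤ] latS.perp (LinearMap.range f)}
    (hx : x ∈ (latS.restrict (latS.perp (LinearMap.range f))).dual) :
    ∃ n : latS.perp (LinearMap.range f), x = (1 / 2 : ℚ) ⊗ₜ n := by
  set R := latS.restrict (latS.perp (LinearMap.range f)) with hR
  obtain ⟨B, hB, hE⟩ := hf.exists_formN
  obtain ⟨k, n, hk, hn⟩ := EvenForm.exists_smul_eq_one_tmul x
  have hkn : ∀ y, k ∣ B ((2 : ℤ) • n) y := fun y => by
    obtain ⟨l, hl⟩ := R.mem_dual.1 hx y
    have h1 : R.formQ ((k : ℚ) • x) (1 ⊗ₜ y) = k * l := by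
      rw [map_smul, LinearMap.smul_apply, hl, smul_eq_mul]
    rw [hn, R.formQ_tmul, one_mul, one_mul] at h1
    have h2 : latS.form n y = k * l := by exact_mod_cast h1
    rw [hB] at h2
    refine ⟨-l, ?_⟩
    rw [map_smul, LinearMap.smul_apply, smul_eq_mul]
    linarith
  obtain ⟨m, hm⟩ := hE.exists_smul hk hkn
  refine ⟨m, ?_⟩
  have hk' : (2 * k : ℚ) ≠ 0 := mul_ne_zero two_ne_zero (by exact_mod_cast hk)
  apply smul_right_injective _ hk'
  change (2 * k : ℚ) • x = (2 * k : ℚ) • _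
  rw [mul_smul, hn, TensorProduct.smul_tmul', TensorProduct.smul_tmul']
  have h1 : (2 : ℚ) ⊗ₜ[ℤ] n = 1 ⊗ₜ ((2 : ℤ) • n) := by
    rw [← TensorProduct.smul_tmul, zsmul_one]; rfl
  rw [smul_eq_mul, mul_one, h1, hm, ← TensorProduct.smul_tmul, zsmul_one]
  congr 1
  rw [smul_eq_mul]; ring

set_option maxHeartbeats 800000 in
/-- The class of half a glue vector generates the orthogonal complement of the gluing group. -/
theorem IsEnriquesEmbedding.exists_isGlueGenerator {f : LA →ₗ[ℤ] LS} (hf : IsEnriquesEmbedding f)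
    {z : LS} (hz : IsGlueVector (LinearMap.range f) z) :
    ∃ ζ, latS.IsGlueGenerator (LinearMap.range f) ζ ∧
      (latS.restrict (latS.perp (LinearMap.range f))).discQuad ζ =
        ((latS.form z z / 4 : ℚ) : AddCircle (2 : ℚ)) := by
  set N := latS.perp (LinearMap.range f) with hN
  set R := latS.restrict N with hR
  obtain ⟨B, hB, hE⟩ := hf.exists_formN
  have hRB : ∀ x y, R.form x y = -2 * B x y := hB
  have heven : ∀ n : N, (1 / 2 : ℚ) ⊗ₜ[ℤ] n ∈ R.dual := fun n =>
    R.half_mem_dual fun y => ⟨-B n y, by rw [hRB]; ring⟩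
  let half : N → R.Disc := fun n => R.latInDual.mkQ ⟨_, heven n⟩
  have hhalf_two : ∀ y : N, half ((2 : ℤ) • y) = 0 := fun y => by
    refine (Submodule.Quotient.mk_eq_zero _).2 ?_
    refine ⟨y, ?_⟩
    change (1 : ℚ) ⊗ₜ[ℤ] y = (1 / 2 : ℚ) ⊗ₜ[ℤ] ((2 : ℤ) • y)
    rw [← TensorProduct.smul_tmul]
    congr 1
    norm_num
  have hhalf_add : ∀ x y : N, half (x + y) = half x + half y := fun x y => by
    change R.latInDual.mkQ _ = R.latInDual.mkQ _ + R.latInDual.mkQ _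
    rw [← map_add]
    congr 1
    exact Subtype.ext (TensorProduct.tmul_add _ _ _)
  have hhalf_zero : ∀ x : N, half x = 0 → ∃ y, x = (2 : ℤ) • y := fun x hx => by
    obtain ⟨y, hy⟩ := (Submodule.Quotient.mk_eq_zero _).1 hx
    have hy : (1 : ℚ) ⊗ₜ[ℤ] y = (1 / 2 : ℚ) ⊗ₜ[ℤ] x := hy
    refine hE.exists_two_smul fun w => ⟨B y w, ?_⟩
    have h1 := congrArg (fun t => R.formQ t (1 ⊗ₜ w)) hy
    simp only [R.formQ_tmul, hRB] at h1
    have h2 : (B x w : ℚ) = 2 * B y w := by push_cast at h1; linarith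
    exact_mod_cast h2
  have hsurj : ∀ a : R.Disc, ∃ n, a = half n := fun a => by
    obtain ⟨x, rfl⟩ := Submodule.mkQ_surjective _ a
    obtain ⟨n, hn⟩ := hf.exists_half x.2
    exact ⟨n, congrArg R.latInDual.mkQ (Subtype.ext hn)⟩
  -- The N*-component of s is (2s - f a)/2, and its product with n/2 is (n, s)/2. So orthogonality
  -- to Γ_N means that `n` has even products with S.
  have hperp : ∀ n : N, half n ∈ R.discPerp (latS.glueN (LinearMap.range f)) ↔
      ∀ s, 2 ∣ latS.form n s := by
    intro n
    constructor
    · intro h s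
      obtain ⟨a, ha⟩ := hf.exists_decomp_two_smul s
      have hfa : (1 / 2 : ℚ) ⊗ₜ[ℤ] (⟨f a, a, rfl⟩ : LinearMap.range f) ∈
          (latS.restrict (LinearMap.range f)).dual := by
        refine EvenForm.half_mem_dual _ ?_
        rintro ⟨_, b, rfl⟩
        exact ⟨_, hf.inner a b⟩
      have hmem : half ⟨_, ha⟩ ∈ latS.glueN (LinearMap.range f) := by
        refine ⟨((latS.restrict (LinearMap.range f)).latInDual.mkQ ⟨_, hfa⟩, half ⟨_, ha⟩), ?_, rfl⟩
        refine ⟨(⟨_, hfa⟩, ⟨_, heven ⟨_, ha⟩⟩), ⟨s, ?_⟩, rfl⟩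
        change (1 : ℚ) ⊗ₜ[ℤ] s = (1 / 2 : ℚ) ⊗ₜ[ℤ] (f a) + (1 / 2 : ℚ) ⊗ₜ[ℤ] ((2 : ℤ) • s - f a)
        rw [← TensorProduct.tmul_add, add_sub_cancel, ← TensorProduct.smul_tmul]
        congr 1
        norm_num
      have h1 := h _ hmem
      rw [EvenForm.discBilin_mk, AddCircle.coe_eq_zero_iff] at h1
      obtain ⟨k, hk⟩ := h1
      have h2 : R.form ⟨_, ha⟩ n = 2 * latS.form n s := by
        change latS.form ((2 : ℤ) • s - f a) n = _
        rw [latS.symm, map_sub, map_smul, latS.symm _ (f a), mem_perp.1 n.2 a, sub_zero,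
          smul_eq_mul]
      rw [R.formQ_tmul, h2] at hk
      refine ⟨k, ?_⟩
      have h3 : (latS.form n s : ℚ) = 2 * k := by
        push_cast at hk
        rw [zsmul_one] at hk
        linarith
      exact_mod_cast h3
    · rintro h _ ⟨⟨_, _⟩, ⟨⟨x, y⟩, ⟨s, hs⟩, hxy⟩, rfl⟩
      cases hxy
      change R.discBilin (R.latInDual.mkQ y) (R.latInDual.mkQ _) = 0
      rw [EvenForm.discBilin_mk, AddCircle.coe_eq_zero_iff]
      obtain ⟨k, hk⟩ := h s
      refine ⟨k, ?_⟩
      rw [← EvenForm.formQ_lTensor_subtype]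
      have hs' : N.subtype.lTensor ℚ y.1 = (1 : ℚ) ⊗ₜ[ℤ] s -
          (LinearMap.range f).subtype.lTensor ℚ x.1 := eq_sub_of_add_eq' hs.symm
      rw [hs', map_sub, LinearMap.sub_apply, EvenForm.formQ_lTensor_perp, sub_zero,
        LinearMap.lTensor_tmul, EvenForm.formQ_tmul, latS.symm]
      change k • (1 : ℚ) = 1 * (1 / 2) * (latS.form n s : ℚ)
      rw [hk, zsmul_one]
      push_cast
      ring
  refine ⟨half ⟨z, hz.mem⟩, ⟨fun h => ?_, ?_⟩, ?_⟩
  · obtain ⟨y, hy⟩ := hhalf_zero _ h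
    exact hz.ne y (congrArg Subtype.val hy)
  · ext a
    obtain ⟨n, rfl⟩ := hsurj a
    rw [SetLike.mem_coe, hperp, Set.mem_insert_iff, Set.mem_singleton_iff]
    constructor
    · intro h
      obtain ⟨y, hy⟩ | ⟨y, hy⟩ := hz.unique n n.2 h
      · have hyN : y ∈ N := perp_primitive 2 y two_ne_zero (hy ▸ n.2)
        left
        rw [show n = (2 : ℤ) • ⟨y, hyN⟩ from Subtype.ext hy, hhalf_two]
      · have hyN : y ∈ N := perp_primitive 2 y two_ne_zero (by
          rw [← sub_eq_iff_eq_add'.2 hy]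
          exact Submodule.sub_mem _ n.2 hz.mem)
        right
        rw [show n = ⟨z, hz.mem⟩ + (2 : ℤ) • ⟨y, hyN⟩ from Subtype.ext hy, hhalf_add, hhalf_two,
          add_zero]
    · rintro (h | h) s
      · obtain ⟨y, rfl⟩ := hhalf_zero n h
        exact ⟨latS.form y s, by
          rw [Submodule.coe_smul, map_smul, LinearMap.smul_apply, smul_eq_mul]⟩
      · obtain ⟨y, hy⟩ := hhalf_zero (n + ⟨z, hz.mem⟩) (by
          rw [hhalf_add, h, ← hhalf_add, ← two_zsmul]
          exact hhalf_two _)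
        have hy' : (n : LS) + z = (2 : ℤ) • (y : LS) := congrArg Subtype.val hy
        have h1 := congrArg (fun t => latS.form t s) hy'
        have h2 := hz.even s
        simp only [map_add, map_smul, LinearMap.add_apply, LinearMap.smul_apply, smul_eq_mul] at h1
        omega
  · rw [EvenForm.discQuad_mk, R.formQ_tmul]
    congr 1
    change _ * _ * (latS.form z z : ℚ) = _
    ring

/-! ### Explicit embeddings for both values of the invariant -/

/-- An embedding of `(U ⊕ E₈)(2)` into `S`. -/
def embAEven : LA →ₗ[ℤ] LS where
  toFun a :=
    ((![33 * a.1 0 + 28 * a.1 1 + 4 * a.2 0 + a.2 2 + a.2 3 + 2 * a.2 5 - a.2 6 + 2 * a.2 7,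
    26 * a.1 0 + 22 * a.1 1 + 5 * a.2 0 + a.2 3 + a.2 5 - a.2 6 + 2 * a.2 7], ![-2 * a.1 0 -
    2 * a.1 1 + a.2 2 - a.2 3 + a.2 4 - a.2 6 - a.2 7, 2 * a.1 0 + a.1 1 + a.2 0 + a.2 4 - a.2 6 -
    a.2 7, 4 * a.1 0 + 3 * a.1 1 + a.2 0 + a.2 2 + a.2 4 - 2 * a.2 6 - a.2 7, -3 * a.1 0 - 4 * a.1 1
    + a.2 2 + a.2 4 - 2 * a.2 6 - 3 * a.2 7, 3 * a.1 0 + 2 * a.1 1 + a.2 0 + a.2 2 + a.2 4 - a.2 6 -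
    3 * a.2 7, -7 * a.1 0 - 6 * a.1 1 - a.2 0 + a.2 4 - a.2 6 - 3 * a.2 7, 5 * a.1 0 + 4 * a.1 1 +
    a.2 2 + a.2 4 - a.2 6 - a.2 7, -3 * a.1 0 - 3 * a.1 1 - a.2 0 + a.2 4 - a.2 5 - a.2 7]),
    (![a.1 0, a.1 0 + a.1 1, -12 * a.1 0 - 10 * a.1 1 - 2 * a.2 0 + a.2 1 - a.2 3 - a.2 5 + a.2 6 -
    a.2 7, -12 * a.1 0 - 10 * a.1 1 - 2 * a.2 0 - a.2 1 - a.2 5 + a.2 6 - a.2 7], ![-12 * a.1 0 -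
    10 * a.1 1 - 2 * a.2 0 - a.2 5 - a.2 7, 2 * a.1 0 + 2 * a.1 1 + a.2 3 - a.2 5, -11 * a.1 0 -
    9 * a.1 1 - 2 * a.2 0 - a.2 5, a.1 0 + a.1 1 + a.2 4 - a.2 5]))
  map_add' _ _ := by
    simp only [Prod.mk_add_mk, Matrix.cons_add_cons, Matrix.empty_add_empty, Prod.fst_add,
      Prod.snd_add, Pi.add_apply]
    ring_nf
  map_smul' _ _ := by
    simp only [Prod.smul_mk, Matrix.smul_cons, Matrix.smul_empty, Prod.smul_fst, Prod.smul_snd,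
      Pi.smul_apply, smul_eq_mul, eq_intCast, Int.cast_id]
    ring_nf

/-- The orthogonal complement of the image of `embAEven`. -/
def embEEven : (Fin 8 → ℤ) →ₗ[ℤ] LS where
  toFun n :=
    ((![6 * n 0 + 2 * n 1 + n 2 + n 3 + 2 * n 5 + n 6 + n 7, 4 * n 0 + n 1 + n 2 + n 3 + 2 * n 5 +
    n 6], ![n 0 - n 1 - n 4 + n 6, 3 * n 0 - n 1 - n 2 - n 4 + n 5 + n 6, 4 * n 0 - n 1 - n 3 - n 4
    + n 5 + 2 * n 6, 4 * n 0 - 3 * n 1 - n 2 - n 3 - n 4 + n 5 + 2 * n 6, 4 * n 0 - 2 * n 1 - n 3 -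
    n 4 + 2 * n 5 + n 6, n 0 - 2 * n 1 - n 3 - n 4 + n 5 + n 6 - n 7, 2 * n 0 - n 1 - n 4 + 2 * n 5
    + n 6 - n 7, -n 1 - n 4 + n 5]), (![n 0 - n 7, 2 * n 0 - n 1 - n 2 + n 3 - n 7, -n 0 - n 1 - n 2
    - n 5 - n 7, -n 0 - n 1 - n 2 - n 5 - n 7], ![-2 * n 0 - n 2 - n 5 - n 6, n 3 - n 5, -2 * n 0 -
    n 1 - n 5 - n 6, n 4 - n 5]))
  map_add' _ _ := by
    simp only [Prod.mk_add_mk, Matrix.cons_add_cons, Matrix.empty_add_empty, Pi.add_apply]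
    ring_nf
  map_smul' _ _ := by
    simp only [Prod.smul_mk, Matrix.smul_cons, Matrix.smul_empty, Pi.smul_apply, smul_eq_mul,
      eq_intCast, Int.cast_id]
    ring_nf

/-- A left inverse of `embAEven`. -/
def retractAEven : LS →ₗ[ℤ] LA where
  toFun s :=
    (![s.2.1 0, -s.2.1 0 + s.2.1 1], ![s.1.2 0 + s.1.2 1 - s.1.2 2 - s.1.2 7 - s.2.1 1 + s.2.2 1,
    s.1.1 0 + s.1.2 1 - s.1.2 6 + s.1.2 7 - s.2.1 0 - 2 * s.2.1 1 + s.2.1 2 + s.2.2 2 - s.2.2 3,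
    s.1.1 0 + s.1.2 3 - s.1.2 6 - s.2.1 0 - 2 * s.2.1 1 + s.2.1 2 + s.2.1 3 - 2 * s.2.2 0 +
    2 * s.2.2 2, s.1.1 0 - s.1.2 0 + 2 * s.1.2 1 - s.2.1 0 - 3 * s.2.1 1 + s.2.1 2 + s.2.1 3 -
    s.2.2 0 + 2 * s.2.2 2 - s.2.2 3, s.1.1 0 - s.1.1 1 + s.1.2 0 + 2 * s.1.2 1 - s.1.2 2 - s.1.2 6 -
    s.2.1 0 - 2 * s.2.1 1 - s.2.2 0 + s.2.2 1 + s.2.2 2, s.1.1 0 - s.1.1 1 + s.1.2 1 - s.1.2 2 +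
    s.1.2 3 - s.1.2 6 - s.1.2 7 - s.2.1 0 - s.2.1 1 - s.2.2 0 + s.2.2 2 + s.2.2 3, s.1.1 0 + s.1.2 1
    - s.1.2 6 + s.1.2 7 - s.2.1 0 - 2 * s.2.1 1 + s.2.1 2 + s.2.1 3 - s.2.2 0 + s.2.2 2 - s.2.2 3,
    -s.2.1 1 - s.2.2 0 + s.2.2 2])
  map_add' _ _ := by
    simp only [Prod.mk_add_mk, Matrix.cons_add_cons, Matrix.empty_add_empty, Prod.fst_add,
      Prod.snd_add, Pi.add_apply]
    ring_nf
  map_smul' _ _ := by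
    simp only [Prod.smul_mk, Matrix.smul_cons, Matrix.smul_empty, Prod.smul_fst, Prod.smul_snd,
      Pi.smul_apply, smul_eq_mul, eq_intCast, Int.cast_id]
    ring_nf

/-- A left inverse of `embEEven`. -/
def retractEEven : LS →ₗ[ℤ] Fin 8 → ℤ where
  toFun s :=
    ![s.1.2 0 - s.1.2 2 + 2 * s.1.2 5 - s.1.2 6 - s.1.2 7 + s.2.1 1 - s.2.1 2 - s.2.1 3 + s.2.2 0 -
    s.2.2 2, s.1.2 1 + s.1.2 3 - 3 * s.1.2 4 + 2 * s.1.2 5 - s.1.2 7 + s.2.1 0 + s.2.1 1 -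
    2 * s.2.1 2 - 2 * s.2.1 3 + s.2.2 0 - s.2.2 1 + s.2.2 2, -s.1.1 0 + s.1.1 1 + s.1.2 0 + s.1.2 1
    - s.1.2 2 + s.1.2 5 - s.1.2 6 - s.1.2 7 + s.2.1 0 - s.2.1 2 - s.2.1 3, -2 * s.1.2 1 +
    2 * s.1.2 4 - 2 * s.1.2 5 - s.2.1 0 + s.2.1 2 + 2 * s.2.1 3 - s.2.2 0 + s.2.2 1 - s.2.2 2 -
    2 * s.2.2 3, s.1.1 0 - s.1.2 0 - s.1.2 1 + s.1.2 4 - s.1.2 5 + s.1.2 7 - s.2.1 0 - s.2.1 1 +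
    2 * s.2.1 2 + 2 * s.2.1 3 - s.2.2 0, -s.1.2 5 + s.1.2 7 + s.2.1 2 - s.2.2 0 - s.2.2 1, -s.1.1 1
    + s.1.2 0 - s.1.2 3 + s.1.2 4 - s.1.2 5 + s.1.2 6 - s.2.1 0 + s.2.1 3 - s.2.2 0 - s.2.2 2 +
    s.2.2 3, s.1.1 1 + s.1.2 5 - s.1.2 6 - s.2.1 0 + s.2.2 0]
  map_add' _ _ := by
    simp only [Matrix.cons_add_cons, Matrix.empty_add_empty, Prod.fst_add, Prod.snd_add,
      Pi.add_apply]
    ring_nf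
  map_smul' _ _ := by
    simp only [Matrix.smul_cons, Matrix.smul_empty, Prod.smul_fst, Prod.smul_snd, Pi.smul_apply,
      smul_eq_mul, eq_intCast, Int.cast_id]
    ring_nf

/-- An embedding of `(U ⊕ E₈)(2)` into `S`. -/
def embAOdd : LA →ₗ[ℤ] LS where
  toFun a :=
    ((![3 * a.1 0 + 3 * a.1 1 - a.2 1 - a.2 3 + a.2 4 + a.2 6, 3 * a.1 0 + 3 * a.1 1 + a.2 0 - a.2 2
    - a.2 3 + a.2 4 + a.2 7], ![a.1 1 + a.2 2 - a.2 3, -a.1 0 + a.1 1 - a.2 6, -a.1 0 + a.1 1 +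
    a.2 2 - a.2 4 - a.2 6, -2 * a.1 0 + 2 * a.1 1 + a.2 2 - a.2 4 - a.2 6 - a.2 7, -2 * a.1 0 +
    2 * a.1 1 + a.2 2 - a.2 4 - a.2 6, -a.1 0 + 2 * a.1 1 + a.2 0 - a.2 4, -a.1 0 + a.1 1 - a.2 1 +
    a.2 3 - a.2 4, a.1 0 + 2 * a.1 1 - a.2 1 + a.2 7]), (![-a.1 0 - 2 * a.1 1 + a.2 3 - a.2 4, a.1 0
    - a.1 1, a.1 0, a.1 0], ![a.1 0 + a.1 1 + a.2 0 - a.2 1, a.2 2 - a.2 4, a.1 0 + a.1 1 - a.2 4 +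
    a.2 5, a.1 0 + a.1 1 - a.2 5 + a.2 6]))
  map_add' _ _ := by
    simp only [Prod.mk_add_mk, Matrix.cons_add_cons, Matrix.empty_add_empty, Prod.fst_add,
      Prod.snd_add, Pi.add_apply]
    ring_nf
  map_smul' _ _ := by
    simp only [Prod.smul_mk, Matrix.smul_cons, Matrix.smul_empty, Prod.smul_fst, Prod.smul_snd,
      Pi.smul_apply, smul_eq_mul, eq_intCast, Int.cast_id]
    ring_nf

/-- The orthogonal complement of the image of `embAOdd`. -/
def embEOdd : (Fin 8 → ℤ) →ₗ[ℤ] LS where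
  toFun n :=
    ((![n 1 + n 2 + n 4 - 3 * n 5 - n 7, n 1 + n 2 + n 3 - n 4 - 2 * n 5 - n 7], ![n 0, n 0 - n 2 +
    n 4, n 0 - n 1 + n 4, n 0 - n 1 - n 2 + n 3 + n 4, n 4, n 4 - n 7, n 5 - n 7, n 3 - n 5 - n 7]),
    (![-n 2 + n 5 + n 7, -n 0 + n 1, n 1 - n 5 + n 6 - n 7, n 1 - n 6], ![n 1 - n 5, n 1 - n 2, n 1
    - n 5, n 1 - n 5]))
  map_add' _ _ := by
    simp only [Prod.mk_add_mk, Matrix.cons_add_cons, Matrix.empty_add_empty, Pi.add_apply]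
    ring_nf
  map_smul' _ _ := by
    simp only [Prod.smul_mk, Matrix.smul_cons, Matrix.smul_empty, Pi.smul_apply, smul_eq_mul,
      eq_intCast, Int.cast_id]
    ring_nf

/-- A left inverse of `embAOdd`. -/
def retractAOdd : LS →ₗ[ℤ] LA where
  toFun s :=
    (![s.2.1 2, -s.2.1 1 + s.2.1 2], ![-s.1.1 0 - s.1.2 1 - s.2.1 0 - s.2.1 1 + s.2.1 3 + s.2.2 0,
    -s.1.2 0 - s.1.2 1 + s.1.2 4 - s.1.2 6 - s.2.1 1 + s.2.1 2, -s.1.1 0 - s.1.2 0 - 2 * s.1.2 1 +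
    s.1.2 4 - s.1.2 5 - 2 * s.2.1 0 - s.2.1 1 + s.2.2 0 + s.2.2 1, -s.1.1 0 - 2 * s.1.2 0 -
    2 * s.1.2 1 + s.1.2 4 - s.1.2 5 - 2 * s.2.1 0 - 2 * s.2.1 1 + s.2.1 3 + s.2.2 0 + s.2.2 1,
    -s.1.1 0 - s.1.2 0 - s.1.2 1 - s.1.2 2 + s.1.2 4 - s.1.2 5 - 2 * s.2.1 0 - s.2.1 1 + s.2.2 0 +
    s.2.2 1, -s.1.1 1 - s.1.2 0 - s.1.2 3 + s.1.2 4 - s.1.2 6 - s.2.1 0 - s.2.1 1 + s.2.2 0 +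
    s.2.2 2, -s.1.2 1 - s.2.1 1, -s.1.1 0 - s.1.2 1 + s.1.2 7 - s.2.1 0])
  map_add' _ _ := by
    simp only [Prod.mk_add_mk, Matrix.cons_add_cons, Matrix.empty_add_empty, Prod.fst_add,
      Prod.snd_add, Pi.add_apply]
    ring_nf
  map_smul' _ _ := by
    simp only [Prod.smul_mk, Matrix.smul_cons, Matrix.smul_empty, Prod.smul_fst, Prod.smul_snd,
      Pi.smul_apply, smul_eq_mul, eq_intCast, Int.cast_id]
    ring_nf

/-- A left inverse of `embEOdd`. -/
def retractEOdd : LS →ₗ[ℤ] Fin 8 → ℤ where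
  toFun s :=
    ![s.1.2 0, s.1.2 0 + s.2.1 1, s.1.2 0 - s.1.2 1 + s.1.2 4, s.1.1 1 + s.1.2 4 + s.2.1 0 -
    s.2.2 0, s.1.2 4, s.1.2 4 - s.1.2 5 + s.1.2 6, s.1.2 4 - s.1.2 5 + s.2.1 2 - s.2.2 0, s.1.2 4 -
    s.1.2 5]
  map_add' _ _ := by
    simp only [Matrix.cons_add_cons, Matrix.empty_add_empty, Prod.fst_add, Prod.snd_add,
      Pi.add_apply]
    ring_nf
  map_smul' _ _ := by
    simp only [Matrix.smul_cons, Matrix.smul_empty, Prod.smul_fst, Prod.smul_snd, Pi.smul_apply,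
      smul_eq_mul, eq_intCast, Int.cast_id]
    ring_nf

theorem embAEven_inner (a b : LA) : latS.form (embAEven a) (embAEven b) = 2 * latA.form a b := by
  simp only [embAEven, LinearMap.coe_mk, AddHom.coe_mk, latS_form, latA_form, latD4_form,
    formE8_coord, Matrix.cons_val]
  ring

theorem embEEven_inner (m n : Fin 8 → ℤ) :
    latS.form (embEEven m) (embEEven n) = -2 * formE8 m n := by
  simp only [embEEven, LinearMap.coe_mk, AddHom.coe_mk, latS_form, latA_form, latD4_form,
    formE8_coord, Matrix.cons_val]
  ring

theorem embAEven_embEEven (a : LA) (n : Fin 8 → ℤ) :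
    latS.form (embAEven a) (embEEven n) = 0 := by
  simp only [embAEven, embEEven, LinearMap.coe_mk, AddHom.coe_mk, latS_form, latA_form,
    latD4_form, formE8_coord, Matrix.cons_val]
  ring

theorem retractAEven_embAEven (a : LA) : retractAEven (embAEven a) = a := by
  simp only [embAEven, retractAEven, LinearMap.coe_mk, AddHom.coe_mk, Matrix.cons_val]
  ring_nf
  ext i <;> fin_cases i <;> rfl

theorem retractEEven_embEEven (n : Fin 8 → ℤ) : retractEEven (embEEven n) = n := by
  simp only [embEEven, retractEEven, LinearMap.coe_mk, AddHom.coe_mk, Matrix.cons_val]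
  ring_nf
  ext i
  fin_cases i <;> rfl

theorem exists_embEven_eq_two_smul (s : LS) : ∃ a n, (2 : ℤ) • s = embAEven a + embEEven n := by
  -- The witnesses are forced: pairing with the two images gives (a, b) = (s, f b) and `formE8 n m`
  -- = -(s, g m), where f, g are the two embeddings.
  refine ⟨
    (![22 * s.1.1 0 + 28 * s.1.1 1 + 7 * s.1.2 0 - 6 * s.1.2 1 - 12 * s.1.2 2 + 14 * s.1.2 3 -
    14 * s.1.2 4 + 18 * s.1.2 5 - 17 * s.1.2 6 + 10 * s.1.2 7 + s.2.1 0 - 22 * s.2.1 1 +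
    21 * s.2.1 2 + 21 * s.2.1 3 + 22 * s.2.2 0 - 22 * s.2.2 1 + 20 * s.2.2 2, 26 * s.1.1 0 +
    33 * s.1.1 1 + 8 * s.1.2 0 - 7 * s.1.2 1 - 13 * s.1.2 2 + 15 * s.1.2 3 - 16 * s.1.2 4 +
    22 * s.1.2 5 - 20 * s.1.2 6 + 11 * s.1.2 7 - s.2.1 0 - 25 * s.2.1 1 + 25 * s.2.1 2 +
    25 * s.2.1 3 + 26 * s.2.2 0 - 26 * s.2.2 1 + 24 * s.2.2 2], ![-36 * s.1.1 0 - 45 * s.1.1 1 -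
    11 * s.1.2 0 + 11 * s.1.2 1 + 18 * s.1.2 2 - 22 * s.1.2 3 + 23 * s.1.2 4 - 30 * s.1.2 5 +
    28 * s.1.2 6 - 17 * s.1.2 7 + 34 * s.2.1 1 - 34 * s.2.1 2 - 34 * s.2.1 3 - 36 * s.2.2 0 +
    36 * s.2.2 1 - 32 * s.2.2 2, -49 * s.1.1 0 - 63 * s.1.1 1 - 16 * s.1.2 0 + 15 * s.1.2 1 +
    25 * s.1.2 2 - 30 * s.1.2 3 + 31 * s.1.2 4 - 41 * s.1.2 5 + 39 * s.1.2 6 - 23 * s.1.2 7 +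
    47 * s.2.1 1 - 46 * s.2.1 2 - 48 * s.2.1 3 - 50 * s.2.2 0 + 50 * s.2.2 1 - 44 * s.2.2 2,
    -67 * s.1.1 0 - 86 * s.1.1 1 - 21 * s.1.2 0 + 20 * s.1.2 1 + 34 * s.1.2 2 - 41 * s.1.2 3 +
    43 * s.1.2 4 - 57 * s.1.2 5 + 54 * s.1.2 6 - 32 * s.1.2 7 + 64 * s.2.1 1 - 64 * s.2.1 2 -
    64 * s.2.1 3 - 68 * s.2.2 0 + 68 * s.2.2 1 - 60 * s.2.2 2, -98 * s.1.1 0 - 126 * s.1.1 1 -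
    32 * s.1.2 0 + 30 * s.1.2 1 + 50 * s.1.2 2 - 60 * s.1.2 3 + 62 * s.1.2 4 - 82 * s.1.2 5 +
    78 * s.1.2 6 - 46 * s.1.2 7 + 94 * s.2.1 1 - 94 * s.2.1 2 - 94 * s.2.1 3 - 100 * s.2.2 0 +
    100 * s.2.2 1 - 88 * s.2.2 2, -79 * s.1.1 0 - 102 * s.1.1 1 - 25 * s.1.2 0 + 25 * s.1.2 1 +
    40 * s.1.2 2 - 49 * s.1.2 3 + 50 * s.1.2 4 - 66 * s.1.2 5 + 63 * s.1.2 6 - 37 * s.1.2 7 +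
    76 * s.2.1 1 - 76 * s.2.1 2 - 76 * s.2.1 3 - 81 * s.2.2 0 + 80 * s.2.2 1 - 71 * s.2.2 2 +
    s.2.2 3, -60 * s.1.1 0 - 78 * s.1.1 1 - 19 * s.1.2 0 + 19 * s.1.2 1 + 30 * s.1.2 2 -
    37 * s.1.2 3 + 38 * s.1.2 4 - 50 * s.1.2 5 + 48 * s.1.2 6 - 29 * s.1.2 7 + 58 * s.2.1 1 -
    58 * s.2.1 2 - 58 * s.2.1 3 - 62 * s.2.2 0 + 61 * s.2.2 1 - 54 * s.2.2 2, -40 * s.1.1 0 -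
    52 * s.1.1 1 - 13 * s.1.2 0 + 13 * s.1.2 1 + 20 * s.1.2 2 - 25 * s.1.2 3 + 26 * s.1.2 4 -
    34 * s.1.2 5 + 32 * s.1.2 6 - 19 * s.1.2 7 + 38 * s.2.1 1 - 38 * s.2.1 2 - 38 * s.2.1 3 -
    42 * s.2.2 0 + 41 * s.2.2 1 - 36 * s.2.2 2, -21 * s.1.1 0 - 27 * s.1.1 1 - 7 * s.1.2 0 +
    7 * s.1.2 1 + 11 * s.1.2 2 - 13 * s.1.2 3 + 13 * s.1.2 4 - 18 * s.1.2 5 + 17 * s.1.2 6 -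
    10 * s.1.2 7 + 20 * s.2.1 1 - 20 * s.2.1 2 - 20 * s.2.1 3 - 22 * s.2.2 0 + 21 * s.2.2 1 -
    18 * s.2.2 2]),
    ![-54 * s.1.1 0 - 69 * s.1.1 1 - 17 * s.1.2 0 + 14 * s.1.2 1 + 29 * s.1.2 2 - 33 * s.1.2 3 +
    34 * s.1.2 4 - 45 * s.1.2 5 + 41 * s.1.2 6 - 23 * s.1.2 7 + 54 * s.2.1 1 - 52 * s.2.1 2 -
    52 * s.2.1 3 - 54 * s.2.2 0 + 54 * s.2.2 1 - 50 * s.2.2 2, -77 * s.1.1 0 - 98 * s.1.1 1 -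
    24 * s.1.2 0 + 20 * s.1.2 1 + 41 * s.1.2 2 - 47 * s.1.2 3 + 48 * s.1.2 4 - 64 * s.1.2 5 +
    59 * s.1.2 6 - 33 * s.1.2 7 + 76 * s.2.1 1 - 74 * s.2.1 2 - 74 * s.2.1 3 - 76 * s.2.2 0 +
    77 * s.2.2 1 - 72 * s.2.2 2, -104 * s.1.1 0 - 132 * s.1.1 1 - 32 * s.1.2 0 + 26 * s.1.2 1 +
    55 * s.1.2 2 - 63 * s.1.2 3 + 65 * s.1.2 4 - 86 * s.1.2 5 + 79 * s.1.2 6 - 44 * s.1.2 7 +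
    103 * s.2.1 1 - 100 * s.2.1 2 - 100 * s.2.1 3 - 104 * s.2.2 0 + 104 * s.2.2 1 - 96 * s.2.2 2,
    -153 * s.1.1 0 - 194 * s.1.1 1 - 47 * s.1.2 0 + 39 * s.1.2 1 + 80 * s.1.2 2 - 92 * s.1.2 3 +
    95 * s.1.2 4 - 127 * s.1.2 5 + 117 * s.1.2 6 - 65 * s.1.2 7 - s.2.1 0 + 152 * s.2.1 1 -
    147 * s.2.1 2 - 147 * s.2.1 3 - 152 * s.2.2 0 + 153 * s.2.2 1 - 142 * s.2.2 2, -124 * s.1.1 0 -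
    157 * s.1.1 1 - 39 * s.1.2 0 + 31 * s.1.2 1 + 65 * s.1.2 2 - 74 * s.1.2 3 + 77 * s.1.2 4 -
    103 * s.1.2 5 + 95 * s.1.2 6 - 53 * s.1.2 7 - s.2.1 0 + 123 * s.2.1 1 - 119 * s.2.1 2 -
    119 * s.2.1 3 - 123 * s.2.2 0 + 123 * s.2.2 1 - 115 * s.2.2 2 + s.2.2 3, -95 * s.1.1 0 -
    120 * s.1.1 1 - 30 * s.1.2 0 + 24 * s.1.2 1 + 50 * s.1.2 2 - 57 * s.1.2 3 + 59 * s.1.2 4 -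
    79 * s.1.2 5 + 73 * s.1.2 6 - 40 * s.1.2 7 - s.2.1 0 + 94 * s.2.1 1 - 91 * s.2.1 2 -
    91 * s.2.1 3 - 94 * s.2.2 0 + 94 * s.2.2 1 - 88 * s.2.2 2, -64 * s.1.1 0 - 81 * s.1.1 1 -
    20 * s.1.2 0 + 16 * s.1.2 1 + 34 * s.1.2 2 - 38 * s.1.2 3 + 39 * s.1.2 4 - 53 * s.1.2 5 +
    49 * s.1.2 6 - 27 * s.1.2 7 - s.2.1 0 + 63 * s.2.1 1 - 61 * s.2.1 2 - 61 * s.2.1 3 -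
    64 * s.2.2 0 + 64 * s.2.2 1 - 60 * s.2.2 2, -32 * s.1.1 0 - 41 * s.1.1 1 - 10 * s.1.2 0 +
    8 * s.1.2 1 + 17 * s.1.2 2 - 19 * s.1.2 3 + 20 * s.1.2 4 - 27 * s.1.2 5 + 24 * s.1.2 6 -
    13 * s.1.2 7 - s.2.1 0 + 32 * s.2.1 1 - 31 * s.2.1 2 - 31 * s.2.1 3 - 32 * s.2.2 0 +
    32 * s.2.2 1 - 30 * s.2.2 2], ?_⟩
  simp only [embAEven, embEEven, LinearMap.coe_mk, AddHom.coe_mk, Matrix.cons_val, Prod.mk_add_mk,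
    Matrix.cons_add_cons, Matrix.empty_add_empty]
  ring_nf
  ext i <;> fin_cases i <;> rfl

theorem embAOdd_inner (a b : LA) : latS.form (embAOdd a) (embAOdd b) = 2 * latA.form a b := by
  simp only [embAOdd, LinearMap.coe_mk, AddHom.coe_mk, latS_form, latA_form, latD4_form,
    formE8_coord, Matrix.cons_val]
  ring

theorem embEOdd_inner (m n : Fin 8 → ℤ) :
    latS.form (embEOdd m) (embEOdd n) = -2 * formE8 m n := by
  simp only [embEOdd, LinearMap.coe_mk, AddHom.coe_mk, latS_form, latA_form, latD4_form,
    formE8_coord, Matrix.cons_val]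
  ring

theorem embAOdd_embEOdd (a : LA) (n : Fin 8 → ℤ) :
    latS.form (embAOdd a) (embEOdd n) = 0 := by
  simp only [embAOdd, embEOdd, LinearMap.coe_mk, AddHom.coe_mk, latS_form, latA_form,
    latD4_form, formE8_coord, Matrix.cons_val]
  ring

theorem retractAOdd_embAOdd (a : LA) : retractAOdd (embAOdd a) = a := by
  simp only [embAOdd, retractAOdd, LinearMap.coe_mk, AddHom.coe_mk, Matrix.cons_val]
  ring_nf
  ext i <;> fin_cases i <;> rfl

theorem retractEOdd_embEOdd (n : Fin 8 → ℤ) : retractEOdd (embEOdd n) = n := by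
  simp only [embEOdd, retractEOdd, LinearMap.coe_mk, AddHom.coe_mk, Matrix.cons_val]
  ring_nf
  ext i
  fin_cases i <;> rfl

theorem exists_embOdd_eq_two_smul (s : LS) : ∃ a n, (2 : ℤ) • s = embAOdd a + embEOdd n := by
  refine ⟨
    (![3 * s.1.1 0 + 3 * s.1.1 1 - s.1.2 0 + s.1.2 2 - s.1.2 5 + 2 * s.1.2 6 - 3 * s.1.2 7 +
    3 * s.2.1 0 - s.2.1 2 - s.2.1 3 - 2 * s.2.2 0 + 3 * s.2.2 1 - 2 * s.2.2 2 - 2 * s.2.2 3,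
    3 * s.1.1 0 + 3 * s.1.1 1 - s.1.2 0 + s.1.2 4 - s.1.2 5 + 2 * s.1.2 6 - 3 * s.1.2 7 +
    3 * s.2.1 0 - s.2.1 1 - s.2.1 2 - s.2.1 3 - 2 * s.2.2 0 + 3 * s.2.2 1 - 2 * s.2.2 2 -
    2 * s.2.2 3], ![3 * s.1.1 0 + 3 * s.1.1 1 - s.1.2 0 - s.1.2 1 + s.1.2 4 + s.1.2 6 - 3 * s.1.2 7
    + 4 * s.2.1 0 - 2 * s.2.1 1 - s.2.2 0 + 3 * s.2.2 1 - 3 * s.2.2 2 - 3 * s.2.2 3, 5 * s.1.1 0 +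
    5 * s.1.1 1 - 2 * s.1.2 0 - s.1.2 1 + 2 * s.1.2 4 - s.1.2 5 + 2 * s.1.2 6 - 5 * s.1.2 7 +
    6 * s.2.1 0 - 3 * s.2.1 1 - 4 * s.2.2 0 + 5 * s.2.2 1 - 4 * s.2.2 2 - 4 * s.2.2 3, 7 * s.1.1 0 +
    6 * s.1.1 1 - 2 * s.1.2 0 - 2 * s.1.2 1 + 3 * s.1.2 4 - 2 * s.1.2 5 + 3 * s.1.2 6 - 6 * s.1.2 7
    + 8 * s.2.1 0 - 4 * s.2.1 1 - 4 * s.2.2 0 + 7 * s.2.2 1 - 6 * s.2.2 2 - 6 * s.2.2 3,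
    10 * s.1.1 0 + 9 * s.1.1 1 - 4 * s.1.2 0 - 2 * s.1.2 1 + 4 * s.1.2 4 - 3 * s.1.2 5 + 5 * s.1.2 6
    - 9 * s.1.2 7 + 12 * s.2.1 0 - 6 * s.2.1 1 - 6 * s.2.2 0 + 9 * s.2.2 1 - 8 * s.2.2 2 -
    8 * s.2.2 3, 7 * s.1.1 0 + 6 * s.1.1 1 - 2 * s.1.2 0 - s.1.2 1 - s.1.2 2 + 3 * s.1.2 4 -
    2 * s.1.2 5 + 3 * s.1.2 6 - 6 * s.1.2 7 + 8 * s.2.1 0 - 4 * s.2.1 1 - 4 * s.2.2 0 + 6 * s.2.2 1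
    - 6 * s.2.2 2 - 6 * s.2.2 3, 5 * s.1.1 0 + 4 * s.1.1 1 - s.1.2 0 - s.1.2 1 - s.1.2 2 +
    2 * s.1.2 4 - s.1.2 5 + 2 * s.1.2 6 - 4 * s.1.2 7 + 6 * s.2.1 0 - 3 * s.2.1 1 - 3 * s.2.2 0 +
    4 * s.2.2 1 - 3 * s.2.2 2 - 5 * s.2.2 3, 3 * s.1.1 0 + 2 * s.1.1 1 - s.1.2 1 - s.1.2 2 + s.1.2 4
    + s.1.2 6 - 2 * s.1.2 7 + 4 * s.2.1 0 - 2 * s.2.1 1 - 2 * s.2.2 0 + 2 * s.2.2 1 - 2 * s.2.2 2 -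
    2 * s.2.2 3, s.1.1 0 + s.1.1 1 - s.1.2 3 + s.1.2 4 + 2 * s.2.1 0 - s.2.1 1 - s.2.2 0 + s.2.2 1 -
    s.2.2 2 - s.2.2 3]),
    ![s.1.2 0 + s.2.1 0 - s.2.1 1 + s.2.1 2 + s.2.1 3 - s.2.2 1, s.1.2 0 - s.1.2 2 + s.1.2 4 +
    s.2.1 0 + s.2.1 2 + s.2.1 3 - s.2.2 1, s.1.2 0 - s.1.2 1 + s.1.2 4 + s.2.1 0 + s.2.1 2 + s.2.1 3
    - 2 * s.2.2 1, s.1.1 0 + s.1.1 1 + s.1.2 0 - s.1.2 1 - s.1.2 2 + s.1.2 3 + s.1.2 4 + 3 * s.2.1 0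
    + s.2.1 2 + s.2.1 3 - s.2.2 0 - s.2.2 1 - s.2.2 2 - s.2.2 3, 3 * s.1.1 0 + 2 * s.1.1 1 + s.1.2 4
    + s.1.2 6 - 2 * s.1.2 7 + 4 * s.2.1 0 - 2 * s.2.2 0 + s.2.2 1 - 2 * s.2.2 2 - 2 * s.2.2 3,
    4 * s.1.1 0 + 4 * s.1.1 1 + s.1.2 4 - s.1.2 5 + 3 * s.1.2 6 - 4 * s.1.2 7 + 5 * s.2.1 0 -
    s.2.1 2 - s.2.1 3 - 3 * s.2.2 0 + 3 * s.2.2 1 - 3 * s.2.2 2 - 3 * s.2.2 3, 3 * s.1.1 0 +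
    3 * s.1.1 1 + s.1.2 4 - s.1.2 5 + 2 * s.1.2 6 - 3 * s.1.2 7 + 4 * s.2.1 0 - 2 * s.2.1 3 -
    2 * s.2.2 0 + 2 * s.2.2 1 - 2 * s.2.2 2 - 2 * s.2.2 3, 2 * s.1.1 0 + 2 * s.1.1 1 + s.1.2 4 -
    s.1.2 5 + s.1.2 6 - 2 * s.1.2 7 + 3 * s.2.1 0 - s.2.1 2 - s.2.1 3 - s.2.2 0 + s.2.2 1 - s.2.2 2
    - s.2.2 3], ?_⟩
  simp only [embAOdd, embEOdd, LinearMap.coe_mk, AddHom.coe_mk, Matrix.cons_val, Prod.mk_add_mk,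
    Matrix.cons_add_cons, Matrix.empty_add_empty]
  ring_nf
  ext i <;> fin_cases i <;> rfl

/-! ### Construction of both classes of Enriques sublattices -/

section Construction

variable {f : LA →ₗ[ℤ] LS} {g : (Fin 8 → ℤ) →ₗ[ℤ] LS}

/-- The retraction `p` gives primitivity. With `q`, the inclusion 2S ⊂ f + g identifies the
complement with the image of `g`, whose norms are divisible by 4, so none is -2. -/
theorem isEnriquesEmbedding_of_retract {p : LS →ₗ[ℤ] LA} {q : LS →ₗ[ℤ] Fin 8 → ℤ}
    (hf : ∀ a b, latS.form (f a) (f b) = 2 * latA.form a b)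
    (hg : ∀ m n, latS.form (g m) (g n) = -2 * formE8 m n)
    (hfg : ∀ a n, latS.form (f a) (g n) = 0) (hp : ∀ a, p (f a) = a) (hq : ∀ n, q (g n) = n)
    (h2 : ∀ s, ∃ a n, (2 : ℤ) • s = f a + g n) : IsEnriquesEmbedding f := by
  refine ⟨hf, ?_, ?_⟩
  · rintro k x hk ⟨a, ha⟩
    refine ⟨p x, smul_right_injective LS hk (?_ : k • f (p x) = k • x)⟩
    have h : a = k • p x := by rw [← map_smul, ← ha, hp]
    rw [← map_smul, ← h, ha]
  · intro x hx hx2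
    obtain ⟨a, n, h⟩ := h2 x
    have ha : a = 0 := latA_eq_zero fun b => by
      have h1 : latS.form (f b) ((2 : ℤ) • x) = 0 := by
        rw [map_smul, smul_eq_mul, show latS.form (f b) x = 0 from hx _ ⟨b, rfl⟩, mul_zero]
      rw [h, map_add, hfg, hf, latA.symm] at h1
      omega
    rw [ha, map_zero, zero_add] at h
    have hn : n = (2 : ℤ) • q x := by rw [← map_smul, h, hq]
    rw [hn, map_smul] at h
    have hx' : x = g (q x) := smul_right_injective LS (two_ne_zero (α := ℤ)) h
    obtain ⟨i, hi⟩ := isEvenUnimodular8_formE8.even (q x)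
    rw [hx', hg, hi] at hx2
    omega

theorem IsEnriquesEmbedding.isEnriquesSublattice (hf : IsEnriquesEmbedding f) :
    IsEnriquesSublattice (LinearMap.range f) := by
  refine ⟨hf.primitive, ⟨LinearMap.BilinForm.IsometryEquiv.symm
    { LinearEquiv.ofInjective f hf.injective with
      map_app' := fun a b => ?_ }⟩, hf.no_root⟩
  exact (hf.inner a b).trans (latU2E82_form a b).symm

/-- The glue classes form a line over 𝔽₂, so any nonzero one is the generator. -/
theorem IsEnriquesEmbedding.isGlueVector_of_radical (hf : IsEnriquesEmbedding f) {z : LS}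
    (hz : z ∈ latS.perp (LinearMap.range f)) (hne : ∀ y, z ≠ (2 : ℤ) • y)
    (heven : ∀ s, 2 ∣ latS.form z s) : IsGlueVector (LinearMap.range f) z := by
  obtain ⟨z', hz'⟩ := hf.exists_isGlueVector
  refine ⟨hz, hne, heven, fun n hn hns => ?_⟩
  obtain ⟨y, hy⟩ | ⟨y, rfl⟩ := hz'.unique z hz heven
  · exact absurd hy (hne y)
  obtain ⟨w, rfl⟩ | ⟨w, rfl⟩ := hz'.unique n hn hns
  · exact Or.inl ⟨w, rfl⟩
  · exact Or.inr ⟨w - y, by rw [smul_sub]; abel⟩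

end Construction

theorem isEnriquesEmbedding_embAEven : IsEnriquesEmbedding embAEven :=
  isEnriquesEmbedding_of_retract embAEven_inner embEEven_inner embAEven_embEEven
    retractAEven_embAEven retractEEven_embEEven exists_embEven_eq_two_smul

theorem isEnriquesEmbedding_embAOdd : IsEnriquesEmbedding embAOdd :=
  isEnriquesEmbedding_of_retract embAOdd_inner embEOdd_inner embAOdd_embEOdd
    retractAOdd_embAOdd retractEOdd_embEOdd exists_embOdd_eq_two_smul

theorem isGlueVector_embEEven :
    IsGlueVector (LinearMap.range embAEven) (embEEven ![-1, 1, 0, 0, -1, 0, 1, 1]) := by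
  refine isEnriquesEmbedding_embAEven.isGlueVector_of_radical ?_ (fun y hy => ?_) fun s => ?_
  · rintro _ ⟨a, rfl⟩
    exact embAEven_embEEven a _
  -- Coordinate 0 is odd, so the vector is not divisible by two.
  · have h := congrFun (congrArg retractEEven hy) 0
    rw [retractEEven_embEEven, map_smul] at h
    simp at h
    omega
  · have h : embEEven ![-1, 1, 0, 0, -1, 0, 1, 1] = radS ![-2, -1, 1, 0] +
        (2 : ℤ) • ((![-1, -1], ![0, -1, -1, -2, -2, -1, -1, 0]),
          (![0, -2, 0, -2], ![0, 0, 0, 0])) := by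
      ext i <;> fin_cases i <;> simp [embEEven, radS]
    rw [h, map_add, map_smul, LinearMap.add_apply, LinearMap.smul_apply, smul_eq_mul]
    exact dvd_add (radS_even _ s) (dvd_mul_right _ _)

theorem isGlueVector_embEOdd :
    IsGlueVector (LinearMap.range embAOdd) (embEOdd ![0, 0, 0, 0, 0, 0, -1, 0]) := by
  refine isEnriquesEmbedding_embAOdd.isGlueVector_of_radical ?_ (fun y hy => ?_) fun s => ?_
  · rintro _ ⟨a, rfl⟩
    exact embAOdd_embEOdd a _
  · have h := congrFun (congrArg retractEOdd hy) 6
    rw [retractEOdd_embEOdd, map_smul] at h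
    simp at h
    omega
  · have h : embEOdd ![0, 0, 0, 0, 0, 0, -1, 0] = radS ![0, -1, 0, 0] := by
      ext i <;> fin_cases i <;> simp [embEOdd, radS]
    rw [h]
    exact radS_even _ s

/-- Norm -16 gives q = -4, which is 0 in ℚ/2ℤ. -/
theorem form_embEEven : latS.form (embEEven ![-1, 1, 0, 0, -1, 0, 1, 1])
    (embEEven ![-1, 1, 0, 0, -1, 0, 1, 1]) = -16 := by
  rw [embEEven_inner, formE8_coord]
  simp

/-- Norm -4 gives q = -1, which is 1 in ℚ/2ℤ. -/
theorem form_embEOdd : latS.form (embEOdd ![0, 0, 0, 0, 0, 0, -1, 0])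
    (embEOdd ![0, 0, 0, 0, 0, 0, -1, 0]) = -4 := by
  rw [embEOdd_inner, formE8_coord]
  simp

/-! ### Classification -/

theorem addCircle_two_coe_eq_iff (i j : ℤ) :
    (((i : ℚ) : AddCircle (2 : ℚ)) = ((j : ℚ) : AddCircle (2 : ℚ))) ↔ 2 ∣ i - j := by
  rw [← sub_eq_zero, ← AddCircle.coe_sub, AddCircle.coe_eq_zero_iff]
  constructor
  · rintro ⟨n, hn⟩
    exact ⟨n, by rw [zsmul_eq_mul] at hn; exact_mod_cast (hn.symm.trans (mul_comm _ _))⟩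
  · rintro ⟨n, hn⟩
    exact ⟨n, by rw [zsmul_eq_mul, mul_comm]; exact_mod_cast hn.symm⟩

theorem EvenForm.IsGlueGenerator.unique {L : Type*} [AddCommGroup L] {S : EvenForm L}
    {M : Submodule ℤ L} {z z' : (S.restrict (S.perp M)).Disc} (hz : S.IsGlueGenerator M z)
    (hz' : S.IsGlueGenerator M z') : z = z' := by
  have h : z ∈ ({0, z'} : Set _) := by rw [← hz'.2, hz.2]; exact Or.inr rfl
  exact h.resolve_left hz.1

/-- The invariants of an Enriques sublattice: a glue vector of norm `4 i`, and a glue generator of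
norm `i`. -/
theorem IsEnriquesSublattice.exists_invariant {M : Submodule ℤ LS} (hM : IsEnriquesSublattice M) :
    ∃ (i : ℤ) (z : LS) (ζ : _), IsGlueVector M z ∧ latS.form z z = 4 * i ∧
      latS.IsGlueGenerator M ζ ∧
      (latS.restrict (latS.perp M)).discQuad ζ = ((i : ℚ) : AddCircle (2 : ℚ)) := by
  obtain ⟨f, hf, rfl⟩ := hM.exists_embedding
  obtain ⟨z, hz⟩ := hf.exists_isGlueVector
  obtain ⟨i, hi⟩ := hf.four_dvd_perp_norm hz.mem
  obtain ⟨ζ, hζ, h⟩ := hf.exists_isGlueGenerator hz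
  refine ⟨i, z, ζ, hz, hi, hζ, h.trans ?_⟩
  rw [hi]
  push_cast
  rw [mul_div_cancel_left₀ _ (by norm_num)]

theorem discQuad_eq_zero_or_one (i : ℤ) : ((i : ℚ) : AddCircle (2 : ℚ)) = 0 ∨
    ((i : ℚ) : AddCircle (2 : ℚ)) = ((1 : ℚ) : AddCircle (2 : ℚ)) := by
  have h0 := addCircle_two_coe_eq_iff i 0
  have h1 := addCircle_two_coe_eq_iff i 1
  rw [Int.cast_zero, AddCircle.coe_zero] at h0
  rw [Int.cast_one] at h1
  rw [h0, h1]
  omega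

theorem sameOrbit_iff_discQuad {M₁ M₂ : Submodule ℤ LS} (h₁ : IsEnriquesSublattice M₁)
    (h₂ : IsEnriquesSublattice M₂) {ζ₁ : _} {ζ₂ : _} (hζ₁ : latS.IsGlueGenerator M₁ ζ₁)
    (hζ₂ : latS.IsGlueGenerator M₂ ζ₂) :
    latS.SameOrbit M₁ M₂ ↔ (latS.restrict (latS.perp M₁)).discQuad ζ₁ =
      (latS.restrict (latS.perp M₂)).discQuad ζ₂ := by
  obtain ⟨i, z, ζ, hz, hi, hζ, hq⟩ := h₁.exists_invariant
  obtain ⟨j, w, ξ, hw, hj, hξ, hr⟩ := h₂.exists_invariant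
  obtain rfl := hζ.unique hζ₁
  obtain rfl := hξ.unique hζ₂
  rw [sameOrbit_iff h₁ h₂ hz hw, hq, hr, addCircle_two_coe_eq_iff, hi, hj]
  omega

theorem exists_discQuad_eq_zero : ∃ M z, IsEnriquesSublattice M ∧ latS.IsGlueGenerator M z ∧
    (latS.restrict (latS.perp M)).discQuad z = 0 := by
  obtain ⟨ζ, hζ, h⟩ := isEnriquesEmbedding_embAEven.exists_isGlueGenerator isGlueVector_embEEven
  refine ⟨_, ζ, isEnriquesEmbedding_embAEven.isEnriquesSublattice, hζ, h.trans ?_⟩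
  rw [form_embEEven, ← AddCircle.coe_zero, ← Int.cast_zero,
    show ((-16 : ℤ) : ℚ) / 4 = ((-4 : ℤ) : ℚ) by norm_num, addCircle_two_coe_eq_iff]
  decide

theorem exists_discQuad_eq_one : ∃ M z, IsEnriquesSublattice M ∧ latS.IsGlueGenerator M z ∧
    (latS.restrict (latS.perp M)).discQuad z = ((1 : ℚ) : AddCircle (2 : ℚ)) := by
  obtain ⟨ζ, hζ, h⟩ := isEnriquesEmbedding_embAOdd.exists_isGlueGenerator isGlueVector_embEOdd
  refine ⟨_, ζ, isEnriquesEmbedding_embAOdd.isEnriquesSublattice, hζ, h.trans ?_⟩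
  rw [form_embEOdd, ← Int.cast_one (R := ℚ),
    show ((-4 : ℤ) : ℚ) / 4 = ((-1 : ℤ) : ℚ) by norm_num, addCircle_two_coe_eq_iff]
  decide

theorem card_orbits : Nat.card (Quotient (latS.orbitSetoid IsEnriquesSublattice)) = 2 := by
  obtain ⟨M₀, z₀, h₀, hz₀, hq₀⟩ := exists_discQuad_eq_zero
  obtain ⟨M₁, z₁, h₁, hz₁, hq₁⟩ := exists_discQuad_eq_one
  refine Nat.card_eq_two_iff.mpr ⟨Quotient.mk _ ⟨M₀, h₀⟩, Quotient.mk _ ⟨M₁, h₁⟩, fun h => ?_,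
    Set.eq_univ_of_forall fun x => ?_⟩
  · have h' : latS.SameOrbit M₀ M₁ := Quotient.exact h
    rw [sameOrbit_iff_discQuad h₀ h₁ hz₀ hz₁, hq₀, hq₁] at h'
    have := (addCircle_two_coe_eq_iff 0 1).mp (by simpa using h')
    omega
  · induction x using Quotient.inductionOn with
    | h M =>
      obtain ⟨M, hM⟩ := M
      obtain ⟨i, z, ζ, hz, hi, hζ, hq⟩ := hM.exists_invariant
      obtain h | h := discQuad_eq_zero_or_one i
      · refine Or.inl (Quotient.sound ?_)
        exact (sameOrbit_iff_discQuad hM h₀ hζ hz₀).mpr (by rw [hq, h, hq₀])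
      · refine Or.inr (Quotient.sound ?_)
        exact (sameOrbit_iff_discQuad hM h₁ hζ hz₁).mpr (by rw [hq, h, hq₁])

theorem mainTheorem8 :
    -- the orthogonal complement is isomorphic to `E₈(2)`
    (∀ M, IsEnriquesSublattice M →
      (latS.restrict (latS.perp M)).Iso (latE8.scale 2)) ∧
    -- there are exactly two orbits under `O(S)`
    Nat.card (Quotient (latS.orbitSetoid IsEnriquesSublattice)) = 2 ∧
    -- `Γ_N^⊥` has order two and its generator has norm `0` or `1` in `ℚ/2ℤ`
    (∀ M, IsEnriquesSublattice M → ∃ z, latS.IsGlueGenerator M z ∧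
      ((latS.restrict (latS.perp M)).discQuad z = 0 ∨
        (latS.restrict (latS.perp M)).discQuad z = ((1 : ℚ) : AddCircle (2 : ℚ)))) ∧
    -- both norms occur
    (∃ M z, IsEnriquesSublattice M ∧ latS.IsGlueGenerator M z ∧
      (latS.restrict (latS.perp M)).discQuad z = 0) ∧
    (∃ M z, IsEnriquesSublattice M ∧ latS.IsGlueGenerator M z ∧
      (latS.restrict (latS.perp M)).discQuad z = ((1 : ℚ) : AddCircle (2 : ℚ))) ∧
    -- the norm of the generator distinguishes the orbits
    (∀ M₁ M₂, IsEnriquesSublattice M₁ → IsEnriquesSublattice M₂ →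
      ∀ z₁ z₂, latS.IsGlueGenerator M₁ z₁ → latS.IsGlueGenerator M₂ z₂ →
        (latS.SameOrbit M₁ M₂ ↔
          (latS.restrict (latS.perp M₁)).discQuad z₁ =
            (latS.restrict (latS.perp M₂)).discQuad z₂)) := by
  refine ⟨fun M hM => hM.perp_iso, card_orbits, fun M hM => ?_, exists_discQuad_eq_zero,
    exists_discQuad_eq_one, fun M₁ M₂ h₁ h₂ z₁ z₂ => sameOrbit_iff_discQuad h₁ h₂⟩
  obtain ⟨i, z, ζ, hz, hi, hζ, hq⟩ := hM.exists_invariant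
  exact ⟨ζ, hζ, by rw [hq]; exact discQuad_eq_zero_or_one i⟩
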